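/- A public-key encryption (PKE) scheme $\Pi=(\mathsf{KeyGen},\mathsf{Enc},\mathsf{Dec})$ consists of three (uniform) quantum polynomial-time (QPT) algorithms: $\mathsf{KeyGen}(1^\lambda)$ outputs a classical secret key $sk$ and a classical public key $pk$; $\mathsf{Enc}(pk,m)$ outputs a (quantum) ciphertext; $\mathsf{Dec}(sk,\mathsf{ct})$ outputs a message. All algorithms know the security parameter $\lambda$ in unary; decryption correctness is not assumed. *Single-key experiment.* The challenger samples $(sk,pk)\leftarrow\mathsf{KeyGen}(1^\lambda)$ and sends $pk$ to the adversary, who answers with two messages $m_0,m_1\in\{0,1\}^\lambda$. The challenger samples a uniform bit $b$ and sends $\mathsf{ct}\leftarrow\mathsf{Enc}(pk,m_b)$. The adversary outputs a bit $b'$ and wins if $b'=b$. *Many-key experiment.* The adversary first sends a number $n$ that is polynomial in $\lambda$ (written in unary). The challenger samples independent key pairs $(sk_i,pk_i)\leftarrow\mathsf{KeyGen}(1^\lambda)$ for $i\in[n]$ and sends $(pk_i)_{i\in[n]}$ to the adversary, who answers with pairs $m_{0,i},m_{1,i}\in\{0,1\}^\lambda$ for $i\in[n]$. The challenger samples a single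 uniform bit $b$ and sends $\mathsf{ct}_i\leftarrow\mathsf{Enc}(pk_i,m_{b,i})$ for all $i\in[n]$. The adversary outputs a bit $b'$ and wins if $b'=b$. $\Pi$ is IND-CPA-secure (respectively IND-MK-CPA-secure) if for every QPT adversary, which may keep a quantum state between its phases, there is a negligible function $\nu$ such that for all $\lambda$ the adversary wins the single-key (respectively many-key) experiment with probability at most $\frac12+\nu(\lambda)$. **Lemma.** Every IND-CPA-secure PKE scheme is IND-MK-CPA-secure. -/

import Mathlib

/-! ## Quantum memory -/

/-- The joint pure state of all qubits of an experiment. Qubits are numbered by `ℕ`; the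
computational basis state in which exactly the qubits of the finite set `S` are `1` is indexed
by `S`. The vector need not be normalised: its squared norm is the probability of the sequence of
measurement outcomes and coin flips that led to it. The qubits `fresh`, `fresh + 1`, … have not
been used yet and are in state `0`. -/
structure QState where
  fresh : ℕ
  amp : Finset ℕ →₀ ℂ

namespace QState

/-- No qubit has been used; all are in state `0`. -/
noncomputable def vacuum : QState := ⟨0, Finsupp.single ∅ 1⟩

/-- The squared norm of the state vector. -/
noncomputable def weight (g : QState) : ℝ := g.amp.sum fun _ z => ‖z‖ ^ 2

/-- Apply a linear map, given by its values on the computational basis. -/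
noncomputable def apply (U : Finset ℕ → (Finset ℕ →₀ ℂ)) (g : QState) : QState :=
  ⟨g.fresh, Finsupp.linearCombination ℂ U g.amp⟩

end QState

/-- The Hadamard gate on qubit `q`. -/
noncomputable def hadamardGate (q : ℕ) (S : Finset ℕ) : Finset ℕ →₀ ℂ :=
  ((Real.sqrt 2 : ℝ) : ℂ)⁻¹ •
    (Finsupp.single (S.erase q) 1 + Finsupp.single (insert q S) (if q ∈ S then -1 else 1))

/-- The `π/8` gate `diag(1, exp(iπ/4))` on qubit `q`. -/
noncomputable def tGate (q : ℕ) (S : Finset ℕ) : Finset ℕ →₀ ℂ :=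
  Finsupp.single S (if q ∈ S then Complex.exp (Complex.I * (Real.pi / 4 : ℝ)) else 1)

/-- The controlled-not gate with control `c` and target `t` (only used for `c ≠ t`). -/
noncomputable def cnotGate (c t : ℕ) (S : Finset ℕ) : Finset ℕ →₀ ℂ :=
  Finsupp.single (if c ∈ S then (if t ∈ S then S.erase t else insert t S) else S) 1

/-- The projection onto the states in which qubit `q` has value `b`. -/
noncomputable def projector (q : ℕ) (b : Bool) (S : Finset ℕ) : Finset ℕ →₀ ℂ :=
  if decide (q ∈ S) = b then Finsupp.single S 1 else 0

/-- Processes on the joint quantum memory that return a classical value: the list of all branches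
(one for each sequence of outcomes of measurements and coins), with unnormalised final states. -/
def QM (α : Type) : Type := QState → List (α × QState)

namespace QM

instance : Monad QM where
  pure a := fun g => [(a, g)]
  bind m f := fun g => (m g).flatMap fun o => f o.1 o.2

/-- A uniformly random bit. -/
noncomputable def coin : QM Bool := fun g =>
  [(false, ⟨g.fresh, ((Real.sqrt 2 : ℝ) : ℂ)⁻¹ • g.amp⟩),
    (true, ⟨g.fresh, ((Real.sqrt 2 : ℝ) : ℂ)⁻¹ • g.amp⟩)]

/-- Measure qubit `q` in the computational basis. -/
noncomputable def measure (q : ℕ) : QM Bool := fun g =>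
  [(false, g.apply (projector q false)), (true, g.apply (projector q true))]

/-- Apply a linear map to the quantum memory. -/
noncomputable def gate (U : Finset ℕ → (Finset ℕ →₀ ℂ)) : QM Unit := fun g => [((), g.apply U)]

/-- Allocate a new qubit in state `0`. -/
def newQubit : QM ℕ := fun g => [(g.fresh, ⟨g.fresh + 1, g.amp⟩)]

/-- Run `f` for `n` rounds. -/
def iter {α : Type} (f : α → QM α) : ℕ → α → QM α
  | 0, a => pure a
  | n + 1, a => do
    let a' ← f a
    iter f n a'

/-- Run `f 0`, …, `f (n - 1)` one after the other and return the list of results. -/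
def collect {α : Type} (f : ℕ → QM α) : ℕ → QM (List α)
  | 0 => pure []
  | n + 1 => do
    let l ← collect f n
    let a ← f n
    pure (l ++ [a])

/-- The probability that the process, started with unused quantum memory, returns `true`. -/
noncomputable def prob (m : QM Bool) : ℝ :=
  ((m QState.vacuum).map fun o => if o.1 then o.2.weight else 0).sum

end QM

/-! ## Quantum programs and their running time

A uniform model of computation: a random access machine that holds bit strings and controls
qubits. For each name `a` and index `i` there is a classical register `(a, i)`, which is a stack of
bits, and a quantum register `(a, i)`, which is a stack of qubits. A program text mentions finitely
many names and can address the cell `(a, i)` where `i` is a number held in unary by another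
register. Loops run for the length of a register; since only polynomial running times are
considered, this is no restriction (a program with a polynomial clock needs only such loops). -/

/-- `scalar a` is register `(a, 0)`; `cell a i` is register `(a, n)`, where `n` is the length
of the classical register `(i, 0)`. -/
inductive Addr
  | scalar (a : ℕ)
  | cell (a i : ℕ)

/-- Programs. -/
inductive Cmd
  /-- push a bit -/
  | push (b : Bool) (x : Addr)
  /-- remove the top bit -/
  | pop (x : Addr)
  /-- copy the bit string in `x` to `y`, overwriting `y` -/
  | copy (x y : Addr)
  /-- empty all registers with name `a` -/
  | wipe (a : ℕ)
  /-- push a new qubit in state `0` -/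
  | qnew (x : Addr)
  /-- move the top qubit of `x` to the top of `y` -/
  | qshift (x y : Addr)
  /-- move all qubits in `x` to `y`, discarding those in `y` -/
  | qmove (x y : Addr)
  /-- Hadamard gate on the top qubit of `x` -/
  | had (x : Addr)
  /-- `π/8` gate on the top qubit of `x` -/
  | tgate (x : Addr)
  /-- controlled-not gate on the top qubits of `x` (control) and `y` (target) -/
  | cnot (x y : Addr)
  /-- measure and discard the top qubit of `x`, and push the outcome on the classical `y` -/
  | meas (x y : Addr)
  /-- one program after the other -/
  | seq (c d : Cmd)
  /-- run `c` if the top bit of `x` is `1`, and `d` otherwise -/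
  | ite (x : Addr) (c d : Cmd)
  /-- repeat `c`, as often as the length that the classical register `x` has at the beginning -/
  | loop (x : Addr) (c : Cmd)
  /-- repeat `c`, as often as the length that the quantum register `x` has at the beginning -/
  | qloop (x : Addr) (c : Cmd)

/-- The local memory of a machine: its classical registers, the numbers of the qubits that its
quantum registers hold, and the number of steps taken so far. -/
structure Store where
  bits : ℕ × ℕ → List Bool
  qubits : ℕ × ℕ → List ℕ
  time : ℕ

namespace Store

/-- All registers empty. -/
def blank : Store := ⟨fun _ => [], fun _ => [], 0⟩

def loc (s : Store) : Addr → ℕ × ℕ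
  | .scalar a => (a, 0)
  | .cell a i => (a, (s.bits (i, 0)).length)

def tick (s : Store) (n : ℕ) : Store := { s with time := s.time + n }

def setBits (s : Store) (r : ℕ × ℕ) (l : List Bool) : Store :=
  { s with bits := Function.update s.bits r l }

def setQubits (s : Store) (r : ℕ × ℕ) (l : List ℕ) : Store :=
  { s with qubits := Function.update s.qubits r l }

/-- Write the strings `l[0]`, `l[1]`, … to the classical registers `(a, 0)`, `(a, 1)`, … -/
def setBitsArray (s : Store) (a : ℕ) (l : List (List Bool)) : Store :=
  { s with bits := fun r => if r.1 = a ∧ r.2 < l.length then l.getD r.2 [] else s.bits r }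

/-- Put the qubits `l[0]`, `l[1]`, … in the quantum registers `(a, 0)`, `(a, 1)`, … -/
def setQubitsArray (s : Store) (a : ℕ) (l : List (List ℕ)) : Store :=
  { s with qubits := fun r => if r.1 = a ∧ r.2 < l.length then l.getD r.2 [] else s.qubits r }

/-- Register `(0, 0)` holds `1^lam`, all other registers are empty. -/
def init (lam : ℕ) : Store := blank.setBits (0, 0) (List.replicate lam true)

/-- The top bit of the classical register `(a, 0)` (`0` if it is empty). -/
def topBit (s : Store) (a : ℕ) : Bool := (s.bits (a, 0)).headD false

end Store

/-- Execution of a program. Every elementary operation, test and loop iteration takes one step,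
and moving a string takes in addition as many steps as the string is long. An operation on the
top of an empty register has no effect. -/
noncomputable def Cmd.exec : Cmd → Store → QM Store
  | .push b x => fun s => pure ((s.setBits (s.loc x) (b :: s.bits (s.loc x))).tick 1)
  | .pop x => fun s => pure ((s.setBits (s.loc x) (s.bits (s.loc x)).tail).tick 1)
  | .copy x y => fun s =>
    pure ((s.setBits (s.loc y) (s.bits (s.loc x))).tick (1 + (s.bits (s.loc x)).length))
  | .wipe a => fun s =>
    pure ⟨fun r => if r.1 = a then [] else s.bits r,
      fun r => if r.1 = a then [] else s.qubits r, s.time + 1⟩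
  | .qnew x => fun s => do
    let q ← QM.newQubit
    pure ((s.setQubits (s.loc x) (q :: s.qubits (s.loc x))).tick 1)
  | .qshift x y => fun s =>
    match s.qubits (s.loc x) with
    | [] => pure (s.tick 1)
    | q :: l =>
      let s' := s.setQubits (s.loc x) l
      pure ((s'.setQubits (s.loc y) (q :: s'.qubits (s.loc y))).tick 1)
  | .qmove x y => fun s =>
    pure (((s.setQubits (s.loc x) []).setQubits (s.loc y) (s.qubits (s.loc x))).tick
      (1 + (s.qubits (s.loc x)).length))
  | .had x => fun s =>
    match s.qubits (s.loc x) with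
    | [] => pure (s.tick 1)
    | q :: _ => do
      QM.gate (hadamardGate q)
      pure (s.tick 1)
  | .tgate x => fun s =>
    match s.qubits (s.loc x) with
    | [] => pure (s.tick 1)
    | q :: _ => do
      QM.gate (tGate q)
      pure (s.tick 1)
  | .cnot x y => fun s =>
    match s.qubits (s.loc x), s.qubits (s.loc y) with
    | q :: _, r :: _ =>
      if q = r then pure (s.tick 1)
      else do
        QM.gate (cnotGate q r)
        pure (s.tick 1)
    | _, _ => pure (s.tick 1)
  | .meas x y => fun s =>
    match s.qubits (s.loc x) with
    | [] => pure (s.tick 1)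
    | q :: l => do
      let b ← QM.measure q
      pure (((s.setQubits (s.loc x) l).setBits (s.loc y) (b :: s.bits (s.loc y))).tick 1)
  | .seq c d => fun s => do
    let s' ← c.exec s
    d.exec s'
  | .ite x c d => fun s =>
    if (s.bits (s.loc x)).headD false then c.exec (s.tick 1) else d.exec (s.tick 1)
  | .loop x c => fun s =>
    QM.iter (fun s' => c.exec (s'.tick 1)) (s.bits (s.loc x)).length (s.tick 1)
  | .qloop x c => fun s =>
    QM.iter (fun s' => c.exec (s'.tick 1)) (s.qubits (s.loc x)).length (s.tick 1)

/-- On every computation path, `c` started in `s` has used at most `t` steps when it halts. -/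
def Cmd.HaltsWithin (c : Cmd) (s : Store) (t : ℕ) : Prop :=
  ∀ g : QState, ∀ o ∈ c.exec s g, o.1.time ≤ t

/-! ## Public-key encryption -/

/-- Input of an encryption algorithm: `1^lam`, the public key and the message. -/
def encInput (lam : ℕ) (pk m : List Bool) : Store :=
  ((Store.init lam).setBits (1, 0) pk).setBits (2, 0) m

/-- Input of a decryption algorithm: `1^lam`, the secret key and the (quantum) ciphertext. -/
def decInput (lam : ℕ) (sk : List Bool) (ct : List ℕ) : Store :=
  ((Store.init lam).setBits (1, 0) sk).setQubits (0, 0) ct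

/-- A public-key encryption scheme with classical keys and quantum ciphertexts: three quantum
polynomial-time algorithms. -/
structure PKE where
  keyGen : Cmd
  enc : Cmd
  dec : Cmd
  keyGen_polyTime : ∃ p : Polynomial ℕ, ∀ lam : ℕ,
    keyGen.HaltsWithin (Store.init lam) (p.eval lam)
  enc_polyTime : ∃ p : Polynomial ℕ, ∀ (lam : ℕ) (pk m : List Bool),
    enc.HaltsWithin (encInput lam pk m) (p.eval (lam + pk.length + m.length))
  dec_polyTime : ∃ p : Polynomial ℕ, ∀ (lam : ℕ) (sk : List Bool) (ct : List ℕ),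
    dec.HaltsWithin (decInput lam sk ct) (p.eval (lam + sk.length + ct.length))

namespace PKE

/-- `KeyGen(1^lam)`: the key pair `(sk, pk)`. -/
noncomputable def runKeyGen (P : PKE) (lam : ℕ) : QM (List Bool × List Bool) := do
  let s ← P.keyGen.exec (Store.init lam)
  pure (s.bits (1, 0), s.bits (2, 0))

/-- `Enc(pk, m)`: the qubits that make up the ciphertext. All other qubits that the algorithm has
used stay in the joint state, but no one has access to them any more. -/
noncomputable def runEnc (P : PKE) (lam : ℕ) (pk m : List Bool) : QM (List ℕ) := do
  let s ← P.enc.exec (encInput lam pk m)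
  pure (s.qubits (0, 0))

/-- `Dec(sk, ct)`. -/
noncomputable def runDec (P : PKE) (lam : ℕ) (sk : List Bool) (ct : List ℕ) :
    QM (List Bool) := do
  let s ← P.dec.exec (decInput lam sk ct)
  pure (s.bits (2, 0))

end PKE

/-- Read a bit string as an element of `{0,1}^lam` (cut it off, or pad it with zeros). -/
def toMessage (lam : ℕ) (l : List Bool) : List Bool := l.takeD lam false

/-! ## Single-key security -/

/-- A quantum polynomial-time adversary in the single-key experiment. It runs `choose` on `1^lam`
and the public key, and outputs two messages (registers `2` and `3`); then, on the memory it is left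
with and the ciphertext, it runs `guess` and outputs a bit (register `4`). Its total running time
is polynomial in the security parameter and the length of what it has received. -/
structure CPAAdversary where
  choose : Cmd
  guess : Cmd
  polyTime : ∃ p : Polynomial ℕ, ∀ (lam : ℕ) (pk : List Bool) (g : QState),
    ∀ o ∈ choose.exec ((Store.init lam).setBits (1, 0) pk) g,
      o.1.time ≤ p.eval (lam + pk.length) ∧
      ∀ ct : List ℕ, guess.HaltsWithin (o.1.setQubits (0, 0) ct)
        (p.eval (lam + pk.length + ct.length))

/-- The IND-CPA experiment. -/
noncomputable def cpaExperiment (P : PKE) (A : CPAAdversary) (lam : ℕ) : QM Bool := do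
  let key ← P.runKeyGen lam
  let s ← A.choose.exec ((Store.init lam).setBits (1, 0) key.2)
  let b ← QM.coin
  let m := toMessage lam (if b then s.bits (3, 0) else s.bits (2, 0))
  let ct ← P.runEnc lam key.2 m
  let s' ← A.guess.exec (s.setQubits (0, 0) ct)
  pure (s'.topBit 4 == b)

/-- A function is negligible if it decays faster than the inverse of every polynomial. -/
def Negligible (f : ℕ → ℝ) : Prop :=
  Asymptotics.SuperpolynomialDecay Filter.atTop (fun n : ℕ => (n : ℝ)) f

/-- IND-CPA security. -/
def PKE.CPASecure (P : PKE) : Prop :=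
  ∀ A : CPAAdversary, ∃ ν : ℕ → ℝ, Negligible ν ∧
    ∀ lam : ℕ, (cpaExperiment P A lam).prob ≤ 1 / 2 + ν lam

/-! ## Many-key security -/

/-- A quantum polynomial-time adversary in the many-key experiment. It runs `count` on `1^lam` and
outputs a number `n` in unary (the length of register `1`), which is therefore polynomial in `lam`.
After receiving `n` public keys (array `2`) it runs `choose` and outputs `n` pairs of messages
(arrays `3` and `4`); after receiving `n` ciphertexts (array `0` of quantum registers) it runs
`guess` and outputs a bit (register `5`). It keeps its memory between these phases. -/
structure MKCPAAdversary where
  count : Cmd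
  choose : Cmd
  guess : Cmd
  polyTime : ∃ p : Polynomial ℕ, ∀ (lam : ℕ) (g : QState),
    ∀ o ∈ count.exec (Store.init lam) g,
      o.1.time ≤ p.eval lam ∧
      ∀ (pks : List (List Bool)) (g' : QState),
        pks.length = (o.1.bits (1, 0)).length →
        ∀ o' ∈ choose.exec (o.1.setBitsArray 2 pks) g',
          o'.1.time ≤ p.eval (lam + (pks.map List.length).sum) ∧
          ∀ cts : List (List ℕ), cts.length = (o.1.bits (1, 0)).length →
            guess.HaltsWithin (o'.1.setQubitsArray 0 cts)
              (p.eval (lam + (pks.map List.length).sum + (cts.map List.length).sum))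

/-- The IND-MK-CPA experiment. -/
noncomputable def mkcpaExperiment (P : PKE) (A : MKCPAAdversary) (lam : ℕ) : QM Bool := do
  let s₀ ← A.count.exec (Store.init lam)
  let n := (s₀.bits (1, 0)).length
  let keys ← QM.collect (fun _ => P.runKeyGen lam) n
  let pks := keys.map Prod.snd
  let s₁ ← A.choose.exec (s₀.setBitsArray 2 pks)
  let b ← QM.coin
  let cts ← QM.collect
    (fun i => P.runEnc lam (pks.getD i [])
      (toMessage lam (if b then s₁.bits (4, i) else s₁.bits (3, i)))) n
  let s₂ ← A.guess.exec (s₁.setQubitsArray 0 cts)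
  pure (s₂.topBit 5 == b)

/-- IND-MK-CPA security. -/
def PKE.MKCPASecure (P : PKE) : Prop :=
  ∀ A : MKCPAAdversary, ∃ ν : ℕ → ℝ, Negligible ν ∧
    ∀ lam : ℕ, (mkcpaExperiment P A lam).prob ≤ 1 / 2 + ν lam

/-! The proof is a hybrid argument over the keys, carried out as an exact identity. In hybrid `i`,
key `j` encrypts the second message of its pair if `j < i` and the first one otherwise, so the
many-key experiment compares the hybrid at `0` with one whose index is at least the number `n` of
keys. The reduction draws `i` uniformly from `N` values, puts the challenger's key at position `i`,
generates all other keys itself, encrypts second messages before position `i` and first messages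
after it, and inserts the challenge ciphertext at `i`. The challenge bit then selects hybrid `i` or
hybrid `i + 1` (`threshold_true`), and the average over `i` telescopes: by `prob_reduced`, the
many-key advantage is exactly `N` times the single-key advantage. Since `N` is polynomially bounded,
negligibility survives (`negligible_mul`). An index beyond the number of keys does no harm, because
both challenge bits then give the same hybrid; so `N` may be a power of two, from which Hadamard
coins sample exactly.

The probabilistic difficulty is that the reduction performs the operations of the hybrid in a
different order: the challenger's key is made before everything else, and the challenge ciphertext
before the other ciphertexts. In a joint pure state with numbered qubits this changes the state,
though not the output distribution. The remedy is to compare states up to a renaming of qubits and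
the adjunction of a spectator system (`Bisim.qrel`). Executions respect this relation
(`Cmd.exec_lift`), hence a process on fresh qubits can be run beforehand and averaged over if its
result is classical (`ClosedClassical.accept_bind`), or exchanged with another such process if its
result is quantum (`Closed.accept_swap`). This yields `mean_embedded`, the success probability for a
fixed `i` in terms of two neighbouring hybrids.

The computational difficulty is that the reduction must be a program. It runs renamed copies of the
given programs next to its own work registers. `lift_chooseCmd` and `lift_guessCmd` match its
branches one by one with those of an abstract process and bound the time along each branch;
`cpaExperiment_adversary` concludes that the single-key experiment with this program is equal, as a
process, to `reduced`. -/

namespace QM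

variable {α β γ δ : Type}

/-! ### The monad of branching quantum processes -/

theorem bind_apply (m : QM α) (f : α → QM β) (g : QState) :
    (m >>= f) g = (m g).flatMap fun o => f o.1 o.2 := rfl

theorem pure_apply (a : α) (g : QState) : (pure a : QM α) g = [(a, g)] := rfl

/-- Branches form an ordered list that is never merged or sorted, so the laws are literal equalities
and experiments can be regrouped by rewriting. -/
instance : LawfulMonad QM := LawfulMonad.mk'
  (id_map := fun x => by
    funext g
    change ((x g).flatMap fun o => [(id o.1, o.2)]) = x g
    simp)
  (pure_bind := fun a f => by funext g; simp [bind_apply, pure_apply])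
  (bind_assoc := fun x f h => by funext g; simp [bind_apply, List.flatMap_assoc])

/-- `iter` unfolds at its first round, whereas `collect` and loop invariants proceed at the last
one. -/
theorem iter_succ_eq (f : α → QM α) (n : ℕ) (a : α) :
    iter f (n + 1) a = iter f n a >>= f := by
  induction n generalizing a with
  | zero => simp [iter]
  | succ n ih =>
    change (f a >>= fun a' => iter f (n + 1) a') = (f a >>= fun a' => iter f n a') >>= f
    simp only [ih, bind_assoc]

theorem collect_congr {f f' : ℕ → QM α} {n : ℕ} (h : ∀ j < n, f j = f' j) :
    collect f n = collect f' n := by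
  induction n with
  | zero => rfl
  | succ n ih =>
    rw [collect, collect, ih fun j hj => h j (by omega), h n (by omega)]

theorem length_of_mem_collect {f : ℕ → QM α} {n : ℕ} {g : QState} {o : List α × QState}
    (ho : o ∈ collect f n g) : o.1.length = n := by
  induction n generalizing o with
  | zero =>
    rw [collect, pure_apply, List.mem_singleton] at ho
    simp [ho]
  | succ n ih =>
    simp only [collect, bind_apply, pure_apply, List.mem_flatMap, List.mem_singleton] at ho
    obtain ⟨o₁, h₁, o₂, -, rfl⟩ := ho
    simp [ih h₁]

/-! ### Expectations -/

/-- The sum of `Φ` over all branches. -/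
def expect (m : QM α) (Φ : α → QState → ℝ) (g : QState) : ℝ :=
  ((m g).map fun o => Φ o.1 o.2).sum

theorem expect_pure (a : α) (Φ : α → QState → ℝ) (g : QState) :
    expect (pure a) Φ g = Φ a g := by simp [expect, pure_apply]

theorem expect_bind (m : QM α) (f : α → QM β) (Φ : β → QState → ℝ) (g : QState) :
    expect (m >>= f) Φ g = expect m (fun a g' => expect (f a) Φ g') g := by
  simp only [expect, bind_apply]
  induction m g with
  | nil => simp
  | cons o l ih => simp [ih]

theorem expect_congr {m : QM α} {Φ Ψ : α → QState → ℝ} {g : QState}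
    (h : ∀ o ∈ m g, Φ o.1 o.2 = Ψ o.1 o.2) : expect m Φ g = expect m Ψ g := by
  unfold expect
  congr 1
  exact List.map_congr_left h

theorem expect_add (m : QM α) (Φ Ψ : α → QState → ℝ) (g : QState) :
    expect m (fun a g' => Φ a g' + Ψ a g') g = expect m Φ g + expect m Ψ g := by
  simp [expect, List.sum_map_add]

theorem expect_mul_left (m : QM α) (c : ℝ) (Φ : α → QState → ℝ) (g : QState) :
    expect m (fun a g' => c * Φ a g') g = c * expect m Φ g := by
  simp [expect, List.sum_map_mul_left]

theorem expect_mul_right (m : QM α) (c : ℝ) (Φ : α → QState → ℝ) (g : QState) :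
    expect m (fun a g' => Φ a g' * c) g = expect m Φ g * c := by
  simp [expect, List.sum_map_mul_right]

theorem expect_zero (m : QM α) (g : QState) : expect m (fun _ _ => 0) g = 0 := by
  simp [expect]

theorem expect_finset_sum {ι : Type} (s : Finset ι) (m : QM α) (Φ : ι → α → QState → ℝ)
    (g : QState) :
    expect m (fun a g' => ∑ i ∈ s, Φ i a g') g = ∑ i ∈ s, expect m (Φ i) g := by
  classical
  induction s using Finset.induction_on with
  | empty => simp [expect_zero]
  | insert i s hi ih => simp [Finset.sum_insert hi, expect_add, ih]

/-- Fubini for finite sums. Both starting states are fixed in advance, which is the form that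
independent processes take once each is run from the vacuum. -/
theorem expect_comm (m : QM α) (m' : QM β) (Φ : α → QState → β → QState → ℝ) (g g' : QState) :
    expect m (fun a u => expect m' (fun b v => Φ a u b v) g') g =
      expect m' (fun b v => expect m (fun a u => Φ a u b v) g) g' := by
  unfold expect
  induction m g with
  | nil => simp
  | cons o l ih => simp [ih, List.sum_map_add]

/-- The weight of the branches in which the result is `true`. -/
noncomputable def accept (m : QM Bool) (g : QState) : ℝ :=
  expect m (fun b g' => if b then g'.weight else 0) g

theorem prob_eq_accept (m : QM Bool) : m.prob = accept m QState.vacuum := rfl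

theorem accept_bind (m : QM α) (f : α → QM Bool) (g : QState) :
    accept (m >>= f) g = expect m (fun a g' => accept (f a) g') g := expect_bind _ _ _ _

/-! ### Relational reasoning -/

/-- The branches of the two processes correspond to each other. -/
def Lift (Q : QState → QState → Prop) (R : α → β → Prop) (m : QM α) (m' : QM β) : Prop :=
  ∀ g g', Q g g' → List.Forall₂ (fun o o' => R o.1 o'.1 ∧ Q o.2 o'.2) (m g) (m' g')

variable {Q : QState → QState → Prop} {R : α → β → Prop} {T : γ → δ → Prop}

theorem Lift.pure {a : α} {b : β} (h : R a b) : Lift Q R (pure a) (pure b) :=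
  fun _ _ hg => List.Forall₂.cons ⟨h, hg⟩ List.Forall₂.nil

theorem Lift.bind {m : QM α} {m' : QM β} {f : α → QM γ} {f' : β → QM δ} (h : Lift Q R m m')
    (hf : ∀ a b, R a b → Lift Q T (f a) (f' b)) : Lift Q T (m >>= f) (m' >>= f') :=
  fun g g' hg => List.rel_flatMap (h g g' hg) fun o o' ho => hf o.1 o'.1 ho.1 o.2 o'.2 ho.2

theorem Lift.mono {R' : α → β → Prop} {m : QM α} {m' : QM β} (h : Lift Q R m m')
    (hR : ∀ a b, R a b → R' a b) : Lift Q R' m m' :=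
  fun g g' hg => (h g g' hg).imp fun _ _ ho => ⟨hR _ _ ho.1, ho.2⟩

/-- Imports into a simulation what is known about every branch of the simulated process, such as
time and length bounds. -/
theorem Lift.and_mem {m : QM α} {m' : QM β} {p : β → Prop} (h : Lift Q R m m')
    (hp : ∀ g, ∀ o ∈ m' g, p o.1) : Lift Q (fun a b => R a b ∧ p b) m m' := by
  intro g g' hg
  have h1 := h g g' hg
  have h2 := hp g'
  generalize m g = l at h1
  generalize m' g' = l' at h1 h2
  induction h1 with
  | nil => exact .nil
  | cons hab _ ih =>
    exact .cons ⟨⟨hab.1, h2 _ (by simp)⟩, hab.2⟩ (ih fun o ho => h2 o (by simp [ho]))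

theorem Lift.iter {R : α → β → Prop} {f : α → QM α} {f' : β → QM β}
    (hf : ∀ a b, R a b → Lift Q R (f a) (f' b)) (n : ℕ) {a : α} {b : β} (h : R a b) :
    Lift Q R (iter f n a) (iter f' n b) := by
  induction n generalizing a b with
  | zero => exact Lift.pure h
  | succ n ih => exact (hf a b h).bind fun _ _ h' => ih h'

theorem Lift.iter_le {R : ℕ → α → β → Prop} {f : α → QM α} {f' : β → QM β} (n : ℕ)
    (hf : ∀ j < n, ∀ a b, R j a b → Lift Q (R (j + 1)) (f a) (f' b)) {a : α} {b : β}
    (h : R 0 a b) : Lift Q (R n) (QM.iter f n a) (QM.iter f' n b) := by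
  induction n with
  | zero => exact Lift.pure h
  | succ n ih =>
    rw [iter_succ_eq, iter_succ_eq]
    exact (ih fun j hj => hf j (by omega)).bind fun a b hab => hf n (by omega) a b hab

/-- A program loop with a running store is matched with a list that grows by one entry per round;
the invariant sees the whole list produced so far. -/
theorem Lift.iter_collect {R : ℕ → α → List β → Prop} {f : α → QM α} {f' : ℕ → QM β} (n : ℕ)
    (hf : ∀ j < n, ∀ a l, R j a l →
      Lift Q (fun a' b => R (j + 1) a' (l ++ [b])) (f a) (f' j)) {a : α}
    (h : R 0 a []) : Lift Q (R n) (QM.iter f n a) (QM.collect f' n) := by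
  induction n with
  | zero => exact Lift.pure h
  | succ n ih =>
    rw [iter_succ_eq, collect]
    refine (ih fun j hj => hf j (by omega)).bind fun a l hal => ?_
    have := (hf n (by omega) a l hal).bind (f := Pure.pure)
      (f' := fun b => Pure.pure (l ++ [b])) (T := R (n + 1)) fun a' b h' => Lift.pure h'
    simpa using this

theorem Lift.collect {f : ℕ → QM α} {f' : ℕ → QM β} {n : ℕ}
    (hf : ∀ j < n, Lift Q R (f j) (f' j)) :
    Lift Q (List.Forall₂ R) (QM.collect f n) (QM.collect f' n) := by
  induction n with
  | zero => exact Lift.pure .nil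
  | succ n ih =>
    refine (ih fun j hj => hf j (by omega)).bind fun l l' hl => ?_
    refine (hf n (by omega)).bind fun a b hab => Lift.pure ?_
    exact List.rel_append hl (.cons hab .nil)

theorem Lift.expect_eq {m : QM α} {m' : QM β} {Φ : α → QState → ℝ} {Ψ : β → QState → ℝ}
    (h : Lift Q R m m') {g g' : QState} (hg : Q g g')
    (hΦ : ∀ o ∈ m g, ∀ o' ∈ m' g', R o.1 o'.1 → Q o.2 o'.2 → Φ o.1 o.2 = Ψ o'.1 o'.2) :
    expect m Φ g = expect m' Ψ g' := by
  have h1 := h g g' hg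
  unfold expect
  generalize m g = l at h1 hΦ
  generalize m' g' = l' at h1 hΦ
  induction h1 with
  | nil => rfl
  | @cons a b l l' hab _ ih =>
    simp only [List.map_cons, List.sum_cons]
    rw [hΦ a (by simp) b (by simp) hab.1 hab.2,
      ih fun o ho o' ho' => hΦ o (by simp [ho]) o' (by simp [ho'])]

/-- Turns a simulation whose relation contains a time bound into a bound on each branch of the
program. -/
theorem Lift.exists_of_mem {m : QM α} {m' : QM β} (h : Lift Q R m m') {g g' : QState}
    (hg : Q g g') {o : α × QState} (ho : o ∈ m g) : ∃ o' ∈ m' g', R o.1 o'.1 := by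
  have h1 := h g g' hg
  generalize m g = l at h1 ho
  generalize m' g' = l' at h1
  induction h1 with
  | nil => simp at ho
  | @cons a b l l' hab _ ih =>
    rcases List.mem_cons.1 ho with rfl | ho
    · exact ⟨b, by simp, hab.1⟩
    · obtain ⟨o', ho', hR⟩ := ih ho
      exact ⟨o', by simp [ho'], hR⟩

end QM

section

open scoped ComplexConjugate

/-! ### State vectors -/

/-- The inner product of state vectors. -/
noncomputable def ampInner (a b : Finset ℕ →₀ ℂ) : ℂ := a.sum fun S z => conj z * b S

theorem ampInner_zero_left (b : Finset ℕ →₀ ℂ) : ampInner 0 b = 0 := by simp [ampInner]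

theorem ampInner_zero_right (a : Finset ℕ →₀ ℂ) : ampInner a 0 = 0 := by simp [ampInner]

theorem ampInner_add_left (a a' b : Finset ℕ →₀ ℂ) :
    ampInner (a + a') b = ampInner a b + ampInner a' b := by
  unfold ampInner
  exact Finsupp.sum_add_index' (by simp) (by intros; simp [add_mul])

theorem ampInner_add_right (a b b' : Finset ℕ →₀ ℂ) :
    ampInner a (b + b') = ampInner a b + ampInner a b' := by
  simp [ampInner, mul_add, Finsupp.sum_add]

theorem ampInner_smul_left (c : ℂ) (a b : Finset ℕ →₀ ℂ) :
    ampInner (c • a) b = conj c * ampInner a b := by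
  unfold ampInner
  rw [Finsupp.sum_smul_index' (by simp), Finsupp.mul_sum]
  simp [mul_assoc]

theorem ampInner_smul_right (c : ℂ) (a b : Finset ℕ →₀ ℂ) :
    ampInner a (c • b) = c * ampInner a b := by
  unfold ampInner
  rw [Finsupp.mul_sum]
  simp [mul_left_comm]

theorem ampInner_single (S T : Finset ℕ) (z w : ℂ) :
    ampInner (Finsupp.single S z) (Finsupp.single T w) = if S = T then conj z * w else 0 := by
  simp only [ampInner]
  rw [Finsupp.sum_single_index (by simp), Finsupp.single_apply]
  simp only [eq_comm (a := T)]
  split <;> simp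

theorem ampInner_linearCombination (U V : Finset ℕ → (Finset ℕ →₀ ℂ)) (a b : Finset ℕ →₀ ℂ) :
    ampInner (Finsupp.linearCombination ℂ U a) (Finsupp.linearCombination ℂ V b) =
      a.sum fun S z => b.sum fun T w => conj z * w * ampInner (U S) (V T) := by
  induction a using Finsupp.induction_linear with
  | zero => simp [ampInner_zero_left]
  | add a a' h h' =>
    rw [map_add, ampInner_add_left, h, h', ← Finsupp.sum_add_index' (by simp)]
    intro S z z'
    simp [add_mul, Finsupp.sum_add]
  | single S z =>
    rw [Finsupp.sum_single_index (by simp), Finsupp.linearCombination_single, ampInner_smul_left]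
    induction b using Finsupp.induction_linear with
    | zero => simp [ampInner_zero_right]
    | add b b' h h' =>
      rw [map_add, ampInner_add_right, mul_add, h, h', ← Finsupp.sum_add_index' (by simp)]
      intro T w w'
      simp [mul_add, add_mul]
    | single T w =>
      rw [Finsupp.sum_single_index (by simp), Finsupp.linearCombination_single,
        ampInner_smul_right]
      ring

/-- A sesquilinear form whose kernel is `c` times the identity is `c` times the inner product.
Unitarity, the tensor norm and the measurement rule are all reduced to such a kernel. -/
theorem sum_sum_delta {F : Finset ℕ → Finset ℕ → ℂ} {c : ℂ}
    (hF : ∀ S T, F S T = if S = T then c else 0) (a b : Finset ℕ →₀ ℂ) :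
    (a.sum fun S z => b.sum fun T w => conj z * w * F S T) = c * ampInner a b := by
  unfold ampInner
  rw [Finsupp.mul_sum]
  refine Finsupp.sum_congr fun S _ => ?_
  simp only [hF, mul_ite, mul_zero]
  rw [Finsupp.sum_ite_eq]
  split
  · ring
  · rename_i h
    rw [Finsupp.notMem_support_iff.1 h]
    ring

theorem ampInner_linearCombination_of_isometry {U : Finset ℕ → (Finset ℕ →₀ ℂ)} {c : ℂ}
    (hU : ∀ S T, ampInner (U S) (U T) = if S = T then c else 0) (a b : Finset ℕ →₀ ℂ) :
    ampInner (Finsupp.linearCombination ℂ U a) (Finsupp.linearCombination ℂ U b) =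
      c * ampInner a b := by
  rw [ampInner_linearCombination, sum_sum_delta hU]

/-- The squared norm of a state vector. -/
noncomputable def ampWeight (a : Finset ℕ →₀ ℂ) : ℝ := a.sum fun _ z => ‖z‖ ^ 2

theorem QState.weight_eq (g : QState) : g.weight = ampWeight g.amp := rfl

theorem ampWeight_eq (a : Finset ℕ →₀ ℂ) : (ampWeight a : ℂ) = ampInner a a := by
  simp only [ampWeight, ampInner, Finsupp.sum]
  push_cast
  refine Finset.sum_congr rfl fun S _ => ?_
  rw [Complex.conj_mul']

theorem ampWeight_linearCombination {U : Finset ℕ → (Finset ℕ →₀ ℂ)}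
    (hU : ∀ S T, ampInner (U S) (U T) = if S = T then 1 else 0) (a : Finset ℕ →₀ ℂ) :
    ampWeight (Finsupp.linearCombination ℂ U a) = ampWeight a := by
  have := ampInner_linearCombination_of_isometry hU a a
  rw [← ampWeight_eq, ← ampWeight_eq, one_mul] at this
  exact_mod_cast this

theorem sqrt_two_inv_mul_self : (((Real.sqrt 2 : ℝ) : ℂ)⁻¹) * ((Real.sqrt 2 : ℝ) : ℂ)⁻¹ = 1 / 2 := by
  rw [← mul_inv, ← Complex.ofReal_mul, Real.mul_self_sqrt (by norm_num)]
  norm_num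

theorem ampInner_hadamardGate (q : ℕ) (S T : Finset ℕ) :
    ampInner (hadamardGate q S) (hadamardGate q T) = if S = T then 1 else 0 := by
  -- One side lacks `q` and the other contains it, so the mixed terms of the inner product vanish.
  have hAB : ∀ X Y : Finset ℕ, X.erase q ≠ insert q Y := fun X Y h =>
    Finset.notMem_erase q X (h ▸ Finset.mem_insert_self q Y)
  have hBA : ∀ X Y : Finset ℕ, insert q X ≠ Y.erase q := fun X Y h => hAB Y X h.symm
  have hI : S.erase q = T.erase q ↔ insert q S = insert q T := by
    constructor
    · intro h
      ext x
      have := Finset.ext_iff.1 h x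
      by_cases hx : x = q
      · simp [hx]
      · simpa [hx] using this
    · intro h
      rw [← Finset.erase_insert_eq_erase, h, Finset.erase_insert_eq_erase]
  have hE : S = T ↔ S.erase q = T.erase q ∧ (q ∈ S ↔ q ∈ T) := by
    constructor
    · rintro rfl; simp
    · rintro ⟨h, h'⟩
      ext x
      by_cases hx : x = q
      · subst hx; exact h'
      · simpa [hx] using Finset.ext_iff.1 h x
  simp only [hadamardGate, ampInner_smul_left, ampInner_smul_right, ampInner_add_left,
    ampInner_add_right, ampInner_single, hAB, hBA, ← hI, hE, if_false, map_inv₀,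
    Complex.conj_ofReal]
  rw [← mul_add, ← mul_assoc, sqrt_two_inv_mul_self]
  -- If `S` and `T` differ only at `q`, the two remaining terms have opposite signs and cancel.
  by_cases h : S.erase q = T.erase q
  · simp only [h, true_and, if_true]
    by_cases h1 : q ∈ S <;> by_cases h2 : q ∈ T <;> simp [h1, h2] <;> norm_num
  · simp only [h, false_and, if_false]
    simp

theorem ampInner_tGate (q : ℕ) (S T : Finset ℕ) :
    ampInner (tGate q S) (tGate q T) = if S = T then 1 else 0 := by
  simp only [tGate, ampInner_single]
  split
  · rename_i h
    subst h
    rw [Complex.conj_mul']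
    split
    · rw [mul_comm, Complex.norm_exp_ofReal_mul_I]; simp
    · simp
  · rfl

/-- The gate permutes the basis: since `c ≠ t`, the control survives the flip of the target, so the
map on basis states is an involution. -/
theorem ampInner_cnotGate {c t : ℕ} (h : c ≠ t) (S T : Finset ℕ) :
    ampInner (cnotGate c t S) (cnotGate c t T) = if S = T then 1 else 0 := by
  have hinv : Function.Involutive fun S : Finset ℕ =>
      if c ∈ S then (if t ∈ S then S.erase t else insert t S) else S := by
    intro S
    by_cases h1 : c ∈ S <;> by_cases h2 : t ∈ S <;> simp [h1, h2, h]
  have := hinv.injective.eq_iff (a := S) (b := T)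
  simp only [cnotGate, ampInner_single, this]
  simp

/-- Pythagoras for the two outcomes. A basis state survives exactly one projection, so the two
kernels add up to the identity. -/
theorem ampWeight_projector (q : ℕ) (a : Finset ℕ →₀ ℂ) :
    ampWeight (Finsupp.linearCombination ℂ (projector q false) a) +
      ampWeight (Finsupp.linearCombination ℂ (projector q true) a) = ampWeight a := by
  have : ((ampWeight (Finsupp.linearCombination ℂ (projector q false) a) +
      ampWeight (Finsupp.linearCombination ℂ (projector q true) a) : ℝ) : ℂ) = ampWeight a := by
    push_cast
    simp only [ampWeight_eq]
    rw [ampInner_linearCombination, ampInner_linearCombination, ← Finsupp.sum_add]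
    simp only [← Finsupp.sum_add, ← mul_add]
    rw [sum_sum_delta (c := 1), one_mul]
    intro S T
    by_cases h1 : q ∈ S <;> by_cases h2 : q ∈ T <;>
      simp [projector, h1, h2, ampInner_single, ampInner_zero_left, ampInner_zero_right]
    all_goals (rintro rfl; contradiction)
  exact_mod_cast this

theorem ampWeight_single (S : Finset ℕ) (z : ℂ) : ampWeight (Finsupp.single S z) = ‖z‖ ^ 2 := by
  simp [ampWeight]

/-! ### Tensor products -/

/-- The qubits of `a`, renamed by `ρ`, next to those of `h`. -/
noncomputable def tens (ρ : ℕ → ℕ) (h : Finset ℕ →₀ ℂ) :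
    (Finset ℕ →₀ ℂ) →ₗ[ℂ] (Finset ℕ →₀ ℂ) :=
  Finsupp.linearCombination ℂ fun S => h.mapDomain fun T => S.image ρ ∪ T

/-- `h` does not involve qubits in the range of `ρ`. -/
def Avoids (ρ : ℕ → ℕ) (h : Finset ℕ →₀ ℂ) : Prop := ∀ T ∈ h.support, ∀ q, ρ q ∉ T

theorem tens_apply (ρ : ℕ → ℕ) (h a : Finset ℕ →₀ ℂ) :
    tens ρ h a = a.sum fun S w => h.sum fun T z => Finsupp.single (S.image ρ ∪ T) (z * w) := by
  simp only [tens, Finsupp.linearCombination_apply, Finsupp.mapDomain, Finsupp.smul_sum]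
  simp [mul_comm]

theorem tens_single_right (ρ : ℕ → ℕ) (h : Finset ℕ →₀ ℂ) (S : Finset ℕ) :
    tens ρ h (Finsupp.single S 1) = h.mapDomain fun T => S.image ρ ∪ T := by
  simp [tens]

/-- The renamed part and the spectator part occupy disjoint sets of qubits, so each can be read off
the union. -/
theorem image_union_inj {ρ : ℕ → ℕ} (hρ : ρ.Injective) {S S' T T' : Finset ℕ}
    (hT : ∀ q, ρ q ∉ T) (hT' : ∀ q, ρ q ∉ T') :
    S.image ρ ∪ T = S'.image ρ ∪ T' ↔ S = S' ∧ T = T' := by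
  constructor
  · intro h
    rw [Finset.ext_iff] at h
    have hS : S = S' := by
      ext q
      simpa [hT, hT', hρ.eq_iff] using h (ρ q)
    subst hS
    refine ⟨rfl, ?_⟩
    ext x
    by_cases hx : ∃ q, ρ q = x
    · obtain ⟨q, rfl⟩ := hx
      simp [hT, hT']
    · have hx' : x ∉ S.image ρ := by
        simp only [Finset.mem_image, not_exists, not_and]
        exact fun q _ hq => hx ⟨q, hq⟩
      simpa [hx'] using h x
  · rintro ⟨rfl, rfl⟩; rfl

theorem ampInner_tens_single {ρ : ℕ → ℕ} (hρ : ρ.Injective) {h : Finset ℕ →₀ ℂ}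
    (hh : Avoids ρ h) (S S' : Finset ℕ) :
    ampInner (h.mapDomain fun T => S.image ρ ∪ T) (h.mapDomain fun T => S'.image ρ ∪ T) =
      if S = S' then (ampWeight h : ℂ) else 0 := by
  have key : ∀ S : Finset ℕ, (h.mapDomain fun T => S.image ρ ∪ T) =
      Finsupp.linearCombination ℂ (fun T => Finsupp.single (S.image ρ ∪ T) (1 : ℂ)) h := by
    intro S
    simp [Finsupp.mapDomain, Finsupp.linearCombination_apply]
  rw [key, key, ampInner_linearCombination]
  split
  · rename_i e
    subst e
    rw [ampWeight_eq, ← one_mul (ampInner h h), ← sum_sum_delta (c := 1) (fun _ _ => rfl)]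
    refine Finsupp.sum_congr fun T hT => Finsupp.sum_congr fun T' hT' => ?_
    simp only [ampInner_single, image_union_inj hρ (hh T hT) (hh T' hT')]
    simp
  · rename_i e
    refine Finset.sum_eq_zero fun T hT => Finset.sum_eq_zero fun T' hT' => ?_
    simp only [ampInner_single, image_union_inj hρ (hh T hT) (hh T' hT')]
    simp [e]

/-- Distinct basis states remain orthogonal after the adjunction of `h`, and each acquires squared
norm `ampWeight h`; thus `tens ρ h` is a scaled isometry. -/
theorem ampWeight_tens {ρ : ℕ → ℕ} (hρ : ρ.Injective) {h : Finset ℕ →₀ ℂ}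
    (hh : Avoids ρ h) (a : Finset ℕ →₀ ℂ) :
    ampWeight (tens ρ h a) = ampWeight h * ampWeight a := by
  have := ampInner_linearCombination_of_isometry (ampInner_tens_single hρ hh) a a
  rw [← ampWeight_eq a, ← Complex.ofReal_mul] at this
  have h2 : ((ampWeight (tens ρ h a) : ℝ) : ℂ) = _ := (ampWeight_eq _).trans this
  exact_mod_cast h2

/-- An operator that acts on the renamed qubits alone commutes with tensoring by a spectator.
Isometry is not required, so projections are covered too. -/
theorem tens_linearCombination {ρ : ℕ → ℕ} {h : Finset ℕ →₀ ℂ} (hh : Avoids ρ h)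
    {U V : Finset ℕ → (Finset ℕ →₀ ℂ)}
    (hUV : ∀ S T : Finset ℕ, (∀ q, ρ q ∉ T) →
      V (S.image ρ ∪ T) = (U S).mapDomain fun S' => S'.image ρ ∪ T) (a : Finset ℕ →₀ ℂ) :
    Finsupp.linearCombination ℂ V (tens ρ h a) =
      tens ρ h (Finsupp.linearCombination ℂ U a) := by
  induction a using Finsupp.induction_linear with
  | zero => simp
  | add a a' ha ha' => simp only [map_add, ha, ha']
  | single S w =>
    rw [← mul_one w, ← Finsupp.smul_single', map_smul, map_smul, map_smul, map_smul,
      tens_single_right, Finsupp.linearCombination_mapDomain, Finsupp.linearCombination_single,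
      one_smul, tens_apply, Finsupp.linearCombination_apply]
    congr 1
    rw [Finsupp.sum_comm]
    refine Finsupp.sum_congr fun T hT => ?_
    rw [Function.comp_apply, hUV S T (hh T hT), Finsupp.mapDomain, Finsupp.smul_sum]
    simp

/-- The gates on renamed qubits act in the same way. -/
theorem hadamardGate_image {ρ : ℕ → ℕ} (hρ : ρ.Injective) (q : ℕ) (S T : Finset ℕ)
    (hT : ∀ q, ρ q ∉ T) : hadamardGate (ρ q) (S.image ρ ∪ T) =
      (hadamardGate q S).mapDomain fun S' => S'.image ρ ∪ T := by
  simp only [hadamardGate, Finsupp.mapDomain_smul, Finsupp.mapDomain_add,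
    Finsupp.mapDomain_single, Finset.image_erase hρ, Finset.image_insert, Finset.insert_union,
    Finset.erase_union_distrib, Finset.erase_eq_of_notMem (hT q), Finset.mem_union,
    hρ.mem_finset_image, hT, or_false]

theorem tGate_image {ρ : ℕ → ℕ} (hρ : ρ.Injective) (q : ℕ) (S T : Finset ℕ)
    (hT : ∀ q, ρ q ∉ T) : tGate (ρ q) (S.image ρ ∪ T) =
      (tGate q S).mapDomain fun S' => S'.image ρ ∪ T := by
  simp only [tGate, Finsupp.mapDomain_single, Finset.mem_union, hρ.mem_finset_image, hT, or_false]

theorem cnotGate_image {ρ : ℕ → ℕ} (hρ : ρ.Injective) (c t : ℕ) (S T : Finset ℕ)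
    (hT : ∀ q, ρ q ∉ T) : cnotGate (ρ c) (ρ t) (S.image ρ ∪ T) =
      (cnotGate c t S).mapDomain fun S' => S'.image ρ ∪ T := by
  simp only [cnotGate, Finsupp.mapDomain_single, Finset.mem_union, hρ.mem_finset_image, hT,
    or_false]
  congr 1
  split
  · split
    · rw [Finset.image_erase hρ, Finset.erase_union_distrib, Finset.erase_eq_of_notMem (hT t)]
    · rw [Finset.image_insert, Finset.insert_union]
  · rfl

theorem projector_image {ρ : ℕ → ℕ} (hρ : ρ.Injective) (q : ℕ) (b : Bool) (S T : Finset ℕ)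
    (hT : ∀ q, ρ q ∉ T) : projector (ρ q) b (S.image ρ ∪ T) =
      (projector q b S).mapDomain fun S' => S'.image ρ ∪ T := by
  simp only [projector, Finset.mem_union, hρ.mem_finset_image, hT, or_false]
  split <;> simp

/-! ### Relabelled states -/

/-- `g` arises from `g'` when the qubits are renamed by `ρ` and `h` is adjoined. -/
def QRel (ρ : ℕ → ℕ) (h : Finset ℕ →₀ ℂ) (g g' : QState) : Prop :=
  g.amp = tens ρ h g'.amp ∧ ∀ k, ρ (g'.fresh + k) = g.fresh + k

/-- A relation between states that all operations on qubits respect, if the qubits are renamed. -/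
structure Bisim (ρ : ℕ → ℕ) (Q : QState → QState → Prop) : Prop where
  inj : ρ.Injective
  fresh : ∀ g g', Q g g' → g.fresh = ρ g'.fresh
  new : ∀ g g', Q g g' → Q ⟨g.fresh + 1, g.amp⟩ ⟨g'.fresh + 1, g'.amp⟩
  hadamard : ∀ g g' q, Q g g' → Q (g.apply (hadamardGate (ρ q))) (g'.apply (hadamardGate q))
  t : ∀ g g' q, Q g g' → Q (g.apply (tGate (ρ q))) (g'.apply (tGate q))
  cnot : ∀ g g' q r, Q g g' → Q (g.apply (cnotGate (ρ q) (ρ r))) (g'.apply (cnotGate q r))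
  proj : ∀ g g' q b, Q g g' → Q (g.apply (projector (ρ q) b)) (g'.apply (projector q b))

/-- The case without any change to the qubits, used when a program is run under renamed registers on
the same quantum state. -/
theorem Bisim.eq : Bisim id Eq where
  inj := Function.injective_id
  fresh := by rintro g _ rfl; rfl
  new := by rintro g _ rfl; rfl
  hadamard := by rintro g _ q rfl; rfl
  t := by rintro g _ q rfl; rfl
  cnot := by rintro g _ q r rfl; rfl
  proj := by rintro g _ q b rfl; rfl

/-- All gates act on renamed qubits and pass through the tensor product. The condition of `QRel` on
all later numbers keeps allocation in step: the next qubits on both sides correspond under `ρ`, now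
and after further allocations. -/
theorem Bisim.qrel {ρ : ℕ → ℕ} (hρ : ρ.Injective) {h : Finset ℕ →₀ ℂ} (hh : Avoids ρ h) :
    Bisim ρ (QRel ρ h) where
  inj := hρ
  fresh := fun g g' hg => (hg.2 0).symm
  new := fun g g' hg => ⟨hg.1, fun k => by
    change ρ (g'.fresh + 1 + k) = g.fresh + 1 + k
    rw [add_assoc, hg.2, add_assoc]⟩
  hadamard := fun g g' q hg => ⟨by
    simp only [QState.apply]
    rw [hg.1, tens_linearCombination hh (hadamardGate_image hρ q)], hg.2⟩
  t := fun g g' q hg => ⟨by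
    simp only [QState.apply]
    rw [hg.1, tens_linearCombination hh (tGate_image hρ q)], hg.2⟩
  cnot := fun g g' q r hg => ⟨by
    simp only [QState.apply]
    rw [hg.1, tens_linearCombination hh (cnotGate_image hρ q r)], hg.2⟩
  proj := fun g g' q b hg => ⟨by
    simp only [QState.apply]
    rw [hg.1, tens_linearCombination hh (projector_image hρ q b)], hg.2⟩

theorem QRel.weight {ρ : ℕ → ℕ} (hρ : ρ.Injective) {h : Finset ℕ →₀ ℂ} (hh : Avoids ρ h)
    {g g' : QState} (hg : QRel ρ h g g') : g.weight = ampWeight h * g'.weight := by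
  rw [QState.weight_eq, hg.1, ampWeight_tens hρ hh, QState.weight_eq]

/-- All qubits of the state have been allocated. -/
def QState.Valid (g : QState) : Prop :=
  g.amp ∈ Finsupp.supported ℂ ℂ {S : Finset ℕ | ∀ q ∈ S, q < g.fresh}

theorem QState.valid_vacuum : QState.vacuum.Valid := by
  simp [QState.Valid, QState.vacuum, Finsupp.single_mem_supported]

theorem QState.Valid.lt {g : QState} (hg : g.Valid) {S : Finset ℕ} (hS : S ∈ g.amp.support)
    {q : ℕ} (hq : q ∈ S) : q < g.fresh := (Finsupp.mem_supported _ _).1 hg hS q hq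

theorem QState.Valid.apply {g : QState} (hg : g.Valid) {U : Finset ℕ → (Finset ℕ →₀ ℂ)}
    (hU : ∀ S : Finset ℕ, (∀ q ∈ S, q < g.fresh) →
      U S ∈ Finsupp.supported ℂ ℂ {S : Finset ℕ | ∀ q ∈ S, q < g.fresh}) : (g.apply U).Valid := by
  simp only [QState.Valid, QState.apply, Finsupp.linearCombination_apply]
  exact Submodule.sum_mem _ fun S hS => Submodule.smul_mem _ _ (hU S fun q hq => hg.lt hS hq)

theorem QState.Valid.hadamard {g : QState} (hg : g.Valid) {q : ℕ} (hq : q < g.fresh) :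
    (g.apply (hadamardGate q)).Valid := by
  refine hg.apply fun S hS => Submodule.smul_mem _ _ (Submodule.add_mem _ ?_ ?_) <;>
    apply Finsupp.single_mem_supported
  · exact fun r hr => hS r (Finset.mem_of_mem_erase hr)
  · intro r hr
    rcases Finset.mem_insert.1 hr with rfl | hr
    exacts [hq, hS r hr]

theorem QState.Valid.tGate {g : QState} (hg : g.Valid) {q : ℕ} :
    (g.apply (tGate q)).Valid :=
  hg.apply fun _ hS => Finsupp.single_mem_supported _ _ hS

theorem QState.Valid.cnot {g : QState} (hg : g.Valid) {c t : ℕ} (ht : t < g.fresh) :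
    (g.apply (cnotGate c t)).Valid := by
  refine hg.apply fun S hS => Finsupp.single_mem_supported _ _ fun r hr => ?_
  split at hr
  · split at hr
    · exact hS r (Finset.mem_of_mem_erase hr)
    · rcases Finset.mem_insert.1 hr with rfl | hr
      exacts [ht, hS r hr]
  · exact hS r hr

theorem QState.Valid.proj {g : QState} (hg : g.Valid) {q : ℕ} {b : Bool} :
    (g.apply (projector q b)).Valid := by
  refine hg.apply fun S hS => ?_
  unfold projector
  split
  · exact Finsupp.single_mem_supported _ _ hS
  · exact Submodule.zero_mem _

end

section

/-! ### Renaming of registers -/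

def Addr.rename (f : ℕ → ℕ) : Addr → Addr
  | .scalar a => .scalar (f a)
  | .cell a i => .cell (f a) (f i)

/-- All names that occur are in `X`. -/
def Addr.Uses (X : Set ℕ) : Addr → Prop
  | .scalar a => a ∈ X
  | .cell a i => a ∈ X ∧ i ∈ X

namespace Cmd

def rename (f : ℕ → ℕ) : Cmd → Cmd
  | .push b x => .push b (x.rename f)
  | .pop x => .pop (x.rename f)
  | .copy x y => .copy (x.rename f) (y.rename f)
  | .wipe a => .wipe (f a)
  | .qnew x => .qnew (x.rename f)
  | .qshift x y => .qshift (x.rename f) (y.rename f)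
  | .qmove x y => .qmove (x.rename f) (y.rename f)
  | .had x => .had (x.rename f)
  | .tgate x => .tgate (x.rename f)
  | .cnot x y => .cnot (x.rename f) (y.rename f)
  | .meas x y => .meas (x.rename f) (y.rename f)
  | .seq c d => .seq (c.rename f) (d.rename f)
  | .ite x c d => .ite (x.rename f) (c.rename f) (d.rename f)
  | .loop x c => .loop (x.rename f) (c.rename f)
  | .qloop x c => .qloop (x.rename f) (c.rename f)

/-- All names that occur are in `X`. -/
def Uses (X : Set ℕ) : Cmd → Prop
  | .push _ x => x.Uses X
  | .pop x => x.Uses X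
  | .copy x y => x.Uses X ∧ y.Uses X
  | .wipe a => a ∈ X
  | .qnew x => x.Uses X
  | .qshift x y => x.Uses X ∧ y.Uses X
  | .qmove x y => x.Uses X ∧ y.Uses X
  | .had x => x.Uses X
  | .tgate x => x.Uses X
  | .cnot x y => x.Uses X ∧ y.Uses X
  | .meas x y => x.Uses X ∧ y.Uses X
  | .seq c d => c.Uses X ∧ d.Uses X
  | .ite x c d => x.Uses X ∧ c.Uses X ∧ d.Uses X
  | .loop x c => x.Uses X ∧ c.Uses X
  | .qloop x c => x.Uses X ∧ c.Uses X

end Cmd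

theorem Addr.Uses.mono {X Y : Set ℕ} (h : X ⊆ Y) {x : Addr} (hx : x.Uses X) : x.Uses Y := by
  cases x with
  | scalar a => exact h hx
  | cell a i => exact ⟨h hx.1, h hx.2⟩

theorem Cmd.Uses.mono {X Y : Set ℕ} (h : X ⊆ Y) {c : Cmd} (hc : c.Uses X) : c.Uses Y := by
  induction c with
  | push | pop | qnew | had | tgate => exact Addr.Uses.mono h hc
  | copy | qshift | qmove | cnot | meas => exact ⟨hc.1.mono h, hc.2.mono h⟩
  | wipe a => exact h hc
  | seq c d ihc ihd => exact ⟨ihc hc.1, ihd hc.2⟩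
  | ite x c d ihc ihd => exact ⟨hc.1.mono h, ihc hc.2.1, ihd hc.2.2⟩
  | loop x c ih => exact ⟨hc.1.mono h, ih hc.2⟩
  | qloop x c ih => exact ⟨hc.1.mono h, ih hc.2⟩

theorem Addr.uses_univ (x : Addr) : x.Uses Set.univ := by
  cases x <;> simp [Addr.Uses]

theorem Cmd.uses_univ (c : Cmd) : c.Uses Set.univ := by
  induction c <;> simp_all [Cmd.Uses, Addr.uses_univ]

theorem Addr.exists_uses (x : Addr) : ∃ k, x.Uses (Set.Iio k) := by
  cases x with
  | scalar a => exact ⟨a + 1, by simp [Addr.Uses]⟩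
  | cell a i => exact ⟨a + i + 1, by simp only [Addr.Uses, Set.mem_Iio]; omega⟩

theorem Cmd.exists_uses (c : Cmd) : ∃ k, c.Uses (Set.Iio k) := by
  have hl : ∀ a b : ℕ, Set.Iio a ⊆ Set.Iio (a + b) := fun a b => Set.Iio_subset_Iio (by omega)
  have hr : ∀ a b : ℕ, Set.Iio b ⊆ Set.Iio (a + b) := fun a b => Set.Iio_subset_Iio (by omega)
  induction c with
  | push _ x | pop x | qnew x | had x | tgate x => exact x.exists_uses
  | copy x y | qshift x y | qmove x y | cnot x y | meas x y =>
    obtain ⟨k, hk⟩ := x.exists_uses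
    obtain ⟨l, hl'⟩ := y.exists_uses
    exact ⟨k + l, hk.mono (hl _ _), hl'.mono (hr _ _)⟩
  | wipe a => exact ⟨a + 1, by simp [Cmd.Uses]⟩
  | seq c d ihc ihd =>
    obtain ⟨k, hk⟩ := ihc
    obtain ⟨l, hl'⟩ := ihd
    exact ⟨k + l, hk.mono (hl _ _), hl'.mono (hr _ _)⟩
  | ite x c d ihc ihd =>
    obtain ⟨k, hk⟩ := ihc
    obtain ⟨l, hl'⟩ := ihd
    obtain ⟨m, hm⟩ := x.exists_uses
    exact ⟨m + (k + l), hm.mono (hl _ _), (hk.mono (hl _ _)).mono (hr _ _),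
      (hl'.mono (hr _ _)).mono (hr _ _)⟩
  | loop x c ih | qloop x c ih =>
    obtain ⟨k, hk⟩ := ih
    obtain ⟨m, hm⟩ := x.exists_uses
    exact ⟨m + k, hm.mono (hl _ _), hk.mono (hr _ _)⟩

/-- The registers of `s` with names in `f '' X` are those of `t` with names in `X`, with qubits
renamed by `ρ`; the others are as in `s₀`. -/
structure StoreRel (f : ℕ → ℕ) (X : Set ℕ) (ρ : ℕ → ℕ) (s₀ : Store) (d e : ℕ) (s t : Store) :
    Prop where
  bits : ∀ a ∈ X, ∀ i, s.bits (f a, i) = t.bits (a, i)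
  qubits : ∀ a ∈ X, ∀ i, s.qubits (f a, i) = (t.qubits (a, i)).map ρ
  frame_bits : ∀ r : ℕ × ℕ, (∀ a ∈ X, f a ≠ r.1) → s.bits r = s₀.bits r
  frame_qubits : ∀ r : ℕ × ℕ, (∀ a ∈ X, f a ≠ r.1) → s.qubits r = s₀.qubits r
  time : s.time + e = t.time + d

namespace StoreRel

variable {f : ℕ → ℕ} {X : Set ℕ} {ρ : ℕ → ℕ} {s₀ s t : Store} {d e : ℕ}

/-- An indexed address depends on the length of another register; that register has a name in `X` as
well, so both sides address the same index. -/
theorem loc (h : StoreRel f X ρ s₀ d e s t) {x : Addr} (hx : x.Uses X) :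
    ∃ a ∈ X, ∃ i, t.loc x = (a, i) ∧ s.loc (x.rename f) = (f a, i) := by
  cases x with
  | scalar a => exact ⟨a, hx, 0, rfl, rfl⟩
  | cell a i => exact ⟨a, hx.1, _, rfl, by simp [Store.loc, Addr.rename, h.bits i hx.2]⟩

theorem tick (h : StoreRel f X ρ s₀ d e s t) (n : ℕ) :
    StoreRel f X ρ s₀ d e (s.tick n) (t.tick n) :=
  ⟨h.bits, h.qubits, h.frame_bits, h.frame_qubits, by
    have := h.time
    simp only [Store.tick]
    omega⟩

theorem setBits (hf : X.InjOn f) (h : StoreRel f X ρ s₀ d e s t) {a : ℕ} (ha : a ∈ X) (i : ℕ)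
    (l : List Bool) : StoreRel f X ρ s₀ d e (s.setBits (f a, i) l) (t.setBits (a, i) l) where
  bits := fun b hb j => by
    have : (f b, j) = (f a, i) ↔ (b, j) = (a, i) := by
      simp [hf.eq_iff hb ha]
    simp only [Store.setBits, Function.update_apply, this, h.bits b hb j]
  qubits := h.qubits
  frame_bits := fun r hr => by
    have : r ≠ (f a, i) := fun e => hr a ha (by rw [e])
    simp only [Store.setBits, Function.update_of_ne this, h.frame_bits r hr]
  frame_qubits := h.frame_qubits
  time := h.time

theorem setQubits (hf : X.InjOn f) (h : StoreRel f X ρ s₀ d e s t) {a : ℕ} (ha : a ∈ X) (i : ℕ)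
    (l : List ℕ) :
    StoreRel f X ρ s₀ d e (s.setQubits (f a, i) (l.map ρ)) (t.setQubits (a, i) l) where
  bits := h.bits
  qubits := fun b hb j => by
    have : (f b, j) = (f a, i) ↔ (b, j) = (a, i) := by
      simp [hf.eq_iff hb ha]
    simp only [Store.setQubits, Function.update_apply, this, h.qubits b hb j]
    split <;> rfl
  frame_bits := h.frame_bits
  frame_qubits := fun r hr => by
    have : r ≠ (f a, i) := fun e => hr a ha (by rw [e])
    simp only [Store.setQubits, Function.update_of_ne this, h.frame_qubits r hr]
  time := h.time

end StoreRel

-- The basic simulation, by induction on the program. Related stores hold equal bits, hence take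
-- equal branches and equally many loop rounds; the quantum operations are related by the `Bisim`
-- assumption. Injectivity of `f` on the names in use prevents two registers from merging, and the
-- frame clauses record that everything else is left alone.
open QM in
theorem Cmd.exec_lift {f : ℕ → ℕ} {X : Set ℕ} (hf : X.InjOn f) {ρ : ℕ → ℕ}
    {Q : QState → QState → Prop} (hQ : Bisim ρ Q) {s₀ : Store} {d e : ℕ} {c : Cmd}
    (hc : c.Uses X) {s t : Store} (h : StoreRel f X ρ s₀ d e s t) :
    Lift Q (StoreRel f X ρ s₀ d e) ((c.rename f).exec s) (c.exec t) := by
  induction c generalizing s t with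
  | push b x =>
    obtain ⟨a, ha, i, h1, h2⟩ := h.loc hc
    simp only [Cmd.rename, Cmd.exec, h1, h2, h.bits a ha]
    exact Lift.pure ((h.setBits hf ha i _).tick 1)
  | pop x =>
    obtain ⟨a, ha, i, h1, h2⟩ := h.loc hc
    simp only [Cmd.rename, Cmd.exec, h1, h2, h.bits a ha]
    exact Lift.pure ((h.setBits hf ha i _).tick 1)
  | copy x y =>
    obtain ⟨a, ha, i, h1, h2⟩ := h.loc hc.1
    obtain ⟨b, hb, j, h3, h4⟩ := h.loc hc.2
    simp only [Cmd.rename, Cmd.exec, h1, h2, h3, h4, h.bits a ha]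
    exact Lift.pure ((h.setBits hf hb j _).tick _)
  | wipe a =>
    have hc' : a ∈ X := hc
    refine Lift.pure ⟨fun b hb j => ?_, fun b hb j => ?_, fun r hr => ?_, fun r hr => ?_, ?_⟩
    · simp only [hf.eq_iff hb hc', h.bits b hb j]
    · simp only [hf.eq_iff hb hc', h.qubits b hb j]
      split <;> rfl
    · simp only [if_neg (Ne.symm (hr a hc')), h.frame_bits r hr]
    · simp only [if_neg (Ne.symm (hr a hc')), h.frame_qubits r hr]
    · have := h.time
      simp only
      omega
  | qnew x =>
    obtain ⟨a, ha, i, h1, h2⟩ := h.loc hc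
    simp only [Cmd.rename, Cmd.exec, h1, h2, h.qubits a ha]
    intro g g' hg
    simp only [newQubit, bind_apply, pure_apply, List.flatMap_cons, List.flatMap_nil,
      List.append_nil]
    refine .cons ⟨?_, hQ.new _ _ hg⟩ .nil
    rw [hQ.fresh _ _ hg, ← List.map_cons]
    exact (h.setQubits hf ha i _).tick 1
  | qshift x y =>
    obtain ⟨a, ha, i, h1, h2⟩ := h.loc hc.1
    obtain ⟨b, hb, j, h3, h4⟩ := h.loc hc.2
    simp only [Cmd.rename, Cmd.exec, h1, h2, h3, h4, h.qubits a ha]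
    cases hq : t.qubits (a, i) with
    | nil => exact Lift.pure (h.tick 1)
    | cons q l =>
      have h' := h.setQubits hf ha i l
      simp only [List.map_cons, h'.qubits b hb]
      rw [← List.map_cons]
      exact Lift.pure ((h'.setQubits hf hb j _).tick 1)
  | qmove x y =>
    obtain ⟨a, ha, i, h1, h2⟩ := h.loc hc.1
    obtain ⟨b, hb, j, h3, h4⟩ := h.loc hc.2
    simp only [Cmd.rename, Cmd.exec, h1, h2, h3, h4, h.qubits a ha, List.length_map]
    exact Lift.pure (((h.setQubits hf ha i []).setQubits hf hb j _).tick _)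
  | had x =>
    obtain ⟨a, ha, i, h1, h2⟩ := h.loc hc
    simp only [Cmd.rename, Cmd.exec, h1, h2, h.qubits a ha]
    cases hq : t.qubits (a, i) with
    | nil => exact Lift.pure (h.tick 1)
    | cons q l =>
      exact Lift.bind (R := fun _ _ => True)
        (fun g g' hg => .cons ⟨trivial, hQ.hadamard _ _ q hg⟩ .nil)
        fun _ _ _ => Lift.pure (h.tick 1)
  | tgate x =>
    obtain ⟨a, ha, i, h1, h2⟩ := h.loc hc
    simp only [Cmd.rename, Cmd.exec, h1, h2, h.qubits a ha]
    cases hq : t.qubits (a, i) with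
    | nil => exact Lift.pure (h.tick 1)
    | cons q l =>
      exact Lift.bind (R := fun _ _ => True)
        (fun g g' hg => .cons ⟨trivial, hQ.t _ _ q hg⟩ .nil)
        fun _ _ _ => Lift.pure (h.tick 1)
  | cnot x y =>
    obtain ⟨a, ha, i, h1, h2⟩ := h.loc hc.1
    obtain ⟨b, hb, j, h3, h4⟩ := h.loc hc.2
    simp only [Cmd.rename, Cmd.exec, h1, h2, h3, h4, h.qubits a ha, h.qubits b hb]
    cases hq : t.qubits (a, i) with
    | nil => exact Lift.pure (h.tick 1)
    | cons q l =>
      cases hr : t.qubits (b, j) with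
      | nil => exact Lift.pure (h.tick 1)
      | cons r l' =>
        -- The gate tests whether control and target coincide; an injective renaming does not change
        -- the answer.
        simp only [List.map_cons, hQ.inj.eq_iff]
        split
        · exact Lift.pure (h.tick 1)
        · exact Lift.bind (R := fun _ _ => True)
            (fun g g' hg => .cons ⟨trivial, hQ.cnot _ _ q r hg⟩ .nil)
            fun _ _ _ => Lift.pure (h.tick 1)
  | meas x y =>
    obtain ⟨a, ha, i, h1, h2⟩ := h.loc hc.1
    obtain ⟨b, hb, j, h3, h4⟩ := h.loc hc.2
    simp only [Cmd.rename, Cmd.exec, h1, h2, h3, h4, h.qubits a ha]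
    cases hq : t.qubits (a, i) with
    | nil => exact Lift.pure (h.tick 1)
    | cons q l =>
      refine Lift.bind (R := fun b b' => b = b')
        (fun g g' hg => .cons ⟨rfl, hQ.proj _ _ q _ hg⟩ (.cons ⟨rfl, hQ.proj _ _ q _ hg⟩ .nil)) ?_
      rintro v _ rfl
      have h' := h.setQubits hf ha i l
      simp only [h.bits b hb]
      exact Lift.pure ((h'.setBits hf hb j _).tick 1)
  | seq c c' ih ih' => exact (ih hc.1 h).bind fun _ _ h' => ih' hc.2 h'
  | ite x c c' ih ih' =>
    obtain ⟨a, ha, i, h1, h2⟩ := h.loc hc.1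
    simp only [Cmd.rename, Cmd.exec, h1, h2, h.bits a ha]
    split
    · exact ih hc.2.1 (h.tick 1)
    · exact ih' hc.2.2 (h.tick 1)
  | loop x c ih =>
    obtain ⟨a, ha, i, h1, h2⟩ := h.loc hc.1
    simp only [Cmd.rename, Cmd.exec, h1, h2, h.bits a ha]
    exact Lift.iter (fun _ _ h' => ih hc.2 (h'.tick 1)) _ (h.tick 1)
  | qloop x c ih =>
    obtain ⟨a, ha, i, h1, h2⟩ := h.loc hc.1
    simp only [Cmd.rename, Cmd.exec, h1, h2, h.qubits a ha, List.length_map]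
    exact Lift.iter (fun _ _ h' => ih hc.2 (h'.tick 1)) _ (h.tick 1)

/-- Rename the qubits. -/
def Store.relabel (ρ : ℕ → ℕ) (s : Store) : Store := ⟨s.bits, fun r => (s.qubits r).map ρ, s.time⟩

theorem Cmd.rename_id (c : Cmd) : c.rename id = c := by
  have h : ∀ x : Addr, x.rename id = x := fun x => by cases x <;> rfl
  induction c <;> simp_all [Cmd.rename]

open QM in
theorem Cmd.exec_relabel {ρ : ℕ → ℕ} {Q : QState → QState → Prop} (hQ : Bisim ρ Q) (c : Cmd)
    (s : Store) : Lift Q (fun s' t' => s' = t'.relabel ρ) (c.exec (s.relabel ρ)) (c.exec s) := by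
  -- With every name in use the frame conditions are vacuous, and with zero offsets the times are
  -- equal.
  have h : StoreRel id Set.univ ρ s 0 0 (s.relabel ρ) s :=
    ⟨fun _ _ _ => rfl, fun _ _ _ => rfl, fun r hr => absurd rfl (hr r.1 trivial),
      fun r hr => absurd rfl (hr r.1 trivial), rfl⟩
  have := Cmd.exec_lift (Set.injOn_id _) hQ c.uses_univ h
  rw [Cmd.rename_id] at this
  refine this.mono fun s' t' h' => ?_
  obtain ⟨b, q, t⟩ := s'
  have hb : b = t'.bits := funext fun r => h'.bits r.1 trivial r.2
  have hq : q = fun r => (t'.qubits r).map ρ := funext fun r => h'.qubits r.1 trivial r.2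
  have ht : t = t'.time := h'.time
  simp only [Store.relabel, hb, hq, ht]

/-! ### Invariants of executions -/

/-- Commands without control flow. -/
def Cmd.Atomic : Cmd → Prop
  | .seq _ _ => False
  | .ite _ _ _ => False
  | .loop _ _ => False
  | .qloop _ _ => False
  | _ => True

theorem QM.iter_invariant {α : Type} {f : α → QM α} {I : α → QState → Prop}
    (hf : ∀ a g, I a g → ∀ o ∈ f a g, I o.1 o.2) (n : ℕ) {a : α} {g : QState} (h : I a g) :
    ∀ o ∈ QM.iter f n a g, I o.1 o.2 := by
  induction n generalizing a g with
  | zero =>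
    intro o ho
    simp only [QM.iter, QM.pure_apply, List.mem_singleton] at ho
    subst ho
    exact h
  | succ n ih =>
    intro o ho
    simp only [QM.iter, QM.bind_apply, List.mem_flatMap] at ho
    obtain ⟨o', ho', ho⟩ := ho
    exact ih (hf a g h o' ho') o ho

/-- Control flow only adds ticks, so an invariant that tolerates ticks has to be checked on
elementary commands only. -/
theorem Cmd.exec_invariant {I : Store → QState → Prop}
    (htick : ∀ s g n, I s g → I (s.tick n) g)
    (hatom : ∀ c : Cmd, c.Atomic → ∀ s g, I s g → ∀ o ∈ c.exec s g, I o.1 o.2)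
    (c : Cmd) {s : Store} {g : QState} (h : I s g) : ∀ o ∈ c.exec s g, I o.1 o.2 := by
  induction c generalizing s g with
  | seq c d ihc ihd =>
    intro o ho
    simp only [Cmd.exec, QM.bind_apply, List.mem_flatMap] at ho
    obtain ⟨o', ho', ho⟩ := ho
    exact ihd (ihc h o' ho') o ho
  | ite x c d ihc ihd =>
    intro o ho
    simp only [Cmd.exec] at ho
    split at ho
    · exact ihc (htick _ _ _ h) o ho
    · exact ihd (htick _ _ _ h) o ho
  | loop x c ih =>
    exact QM.iter_invariant (fun a g ha o ho => ih (htick _ _ _ ha) o ho) _ (htick _ _ _ h)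
  | qloop x c ih =>
    exact QM.iter_invariant (fun a g ha o ho => ih (htick _ _ _ ha) o ho) _ (htick _ _ _ h)
  | push b x => exact hatom (.push b x) trivial _ _ h
  | pop x => exact hatom (.pop x) trivial _ _ h
  | copy x y => exact hatom (.copy x y) trivial _ _ h
  | wipe a => exact hatom (.wipe a) trivial _ _ h
  | qnew x => exact hatom (.qnew x) trivial _ _ h
  | qshift x y => exact hatom (.qshift x y) trivial _ _ h
  | qmove x y => exact hatom (.qmove x y) trivial _ _ h
  | had x => exact hatom (.had x) trivial _ _ h
  | tgate x => exact hatom (.tgate x) trivial _ _ h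
  | cnot x y => exact hatom (.cnot x y) trivial _ _ h
  | meas x y => exact hatom (.meas x y) trivial _ _ h

namespace Cmd

/-! ### Possible outcomes of the quantum commands -/

variable {s : Store} {g : QState} {x y : Addr} {o : Store × QState}

theorem mem_exec_qnew (ho : o ∈ (qnew x).exec s g) :
    o = ((s.setQubits (s.loc x) (g.fresh :: s.qubits (s.loc x))).tick 1,
      ⟨g.fresh + 1, g.amp⟩) := by
  simpa [exec, QM.bind_apply, QM.newQubit, QM.pure_apply] using ho

theorem mem_exec_qshift (ho : o ∈ (qshift x y).exec s g) :
    o = (s.tick 1, g) ∨ ∃ q l, s.qubits (s.loc x) = q :: l ∧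
      o = (((s.setQubits (s.loc x) l).setQubits ((s.setQubits (s.loc x) l).loc y)
        (q :: (s.setQubits (s.loc x) l).qubits ((s.setQubits (s.loc x) l).loc y))).tick 1, g) := by
  cases e : s.qubits (s.loc x) with
  | nil => exact Or.inl (by simpa [exec, e, QM.pure_apply] using ho)
  | cons q l =>
    simp only [exec, e, QM.pure_apply, List.mem_singleton] at ho
    exact Or.inr ⟨q, l, rfl, ho⟩

theorem mem_exec_had (ho : o ∈ (had x).exec s g) :
    o = (s.tick 1, g) ∨ ∃ q l, s.qubits (s.loc x) = q :: l ∧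
      o = (s.tick 1, g.apply (hadamardGate q)) := by
  cases e : s.qubits (s.loc x) with
  | nil => exact Or.inl (by simpa [exec, e, QM.pure_apply] using ho)
  | cons q l =>
    exact Or.inr ⟨q, l, rfl, by simpa [exec, e, QM.bind_apply, QM.gate, QM.pure_apply] using ho⟩

theorem mem_exec_tgate (ho : o ∈ (tgate x).exec s g) :
    o = (s.tick 1, g) ∨ ∃ q, o = (s.tick 1, g.apply (tGate q)) := by
  cases e : s.qubits (s.loc x) with
  | nil => exact Or.inl (by simpa [exec, e, QM.pure_apply] using ho)
  | cons q l => exact Or.inr ⟨q, by simpa [exec, e, QM.bind_apply, QM.gate, QM.pure_apply] using ho⟩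

theorem mem_exec_cnot (ho : o ∈ (cnot x y).exec s g) :
    o = (s.tick 1, g) ∨ ∃ q r, r ∈ s.qubits (s.loc y) ∧
      o = (s.tick 1, g.apply (cnotGate q r)) := by
  cases e : s.qubits (s.loc x) with
  | nil => exact Or.inl (by simpa [exec, e, QM.pure_apply] using ho)
  | cons q l =>
    cases e' : s.qubits (s.loc y) with
    | nil => exact Or.inl (by simpa [exec, e, e', QM.pure_apply] using ho)
    | cons r l' =>
      by_cases h : q = r
      · exact Or.inl (by simpa [exec, e, e', h, QM.pure_apply] using ho)
      · exact Or.inr ⟨q, r, by simp,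
          by simpa [exec, e, e', h, QM.bind_apply, QM.gate, QM.pure_apply] using ho⟩

theorem mem_exec_meas (ho : o ∈ (meas x y).exec s g) :
    o = (s.tick 1, g) ∨ ∃ q l b, s.qubits (s.loc x) = q :: l ∧
      o = (((s.setQubits (s.loc x) l).setBits (s.loc y) (b :: s.bits (s.loc y))).tick 1,
        g.apply (projector q b)) := by
  cases e : s.qubits (s.loc x) with
  | nil => exact Or.inl (by simpa [exec, e, QM.pure_apply] using ho)
  | cons q l =>
    have : o = (((s.setQubits (s.loc x) l).setBits (s.loc y) (false :: s.bits (s.loc y))).tick 1,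
          g.apply (projector q false)) ∨
        o = (((s.setQubits (s.loc x) l).setBits (s.loc y) (true :: s.bits (s.loc y))).tick 1,
          g.apply (projector q true)) := by
      simpa [exec, e, QM.bind_apply, QM.measure, QM.pure_apply] using ho
    rcases this with h | h
    · exact Or.inr ⟨q, l, false, rfl, h⟩
    · exact Or.inr ⟨q, l, true, rfl, h⟩

end Cmd

/-- The lengths of the registers. -/
def Store.LengthLE (s : Store) (n : ℕ) : Prop :=
  ∀ r, (s.bits r).length ≤ n ∧ (s.qubits r).length ≤ n

theorem Store.LengthLE.mono {s : Store} {m n : ℕ} (h : s.LengthLE m) (hmn : m ≤ n) :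
    s.LengthLE n := fun r => ⟨(h r).1.trans hmn, (h r).2.trans hmn⟩

theorem Store.LengthLE.setBits {s : Store} {n : ℕ} (h : s.LengthLE n) (r : ℕ × ℕ) {l : List Bool}
    (hl : l.length ≤ n) : (s.setBits r l).LengthLE n := by
  intro r'
  refine ⟨?_, (h r').2⟩
  simp only [Store.setBits, Function.update_apply]
  split
  exacts [hl, (h r').1]

theorem Store.LengthLE.setQubits {s : Store} {n : ℕ} (h : s.LengthLE n) (r : ℕ × ℕ) {l : List ℕ}
    (hl : l.length ≤ n) : (s.setQubits r l).LengthLE n := by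
  intro r'
  refine ⟨(h r').1, ?_⟩
  simp only [Store.setQubits, Function.update_apply]
  split
  exacts [hl, (h r').2]

theorem Store.LengthLE.wipe {s : Store} {n : ℕ} (h : s.LengthLE n) (a t : ℕ) :
    Store.LengthLE ⟨fun r => if r.1 = a then [] else s.bits r,
      fun r => if r.1 = a then [] else s.qubits r, t⟩ n := by
  intro r
  constructor
  · dsimp only
    split
    exacts [Nat.zero_le _, (h r).1]
  · dsimp only
    split
    exacts [Nat.zero_le _, (h r).2]

/-- The maximal register length grows by at most one per step. Thus running times bound the number
of keys and the lengths of keys, messages and ciphertexts. -/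
theorem Cmd.lengthLE {c : Cmd} {s : Store} {g : QState} {o : Store × QState}
    (ho : o ∈ c.exec s g) {n : ℕ} (h : s.LengthLE n) : o.1.LengthLE (n + o.1.time) := by
  refine Cmd.exec_invariant (I := fun s' _ => s'.LengthLE (n + s'.time)) ?_ ?_ c
    (h.mono (by omega)) o ho
  · intro s' g k h
    exact h.mono (by simp only [Store.tick]; omega)
  · intro c hc s' g h o ho
    have h1 : s'.LengthLE (n + (s'.time + 1)) := h.mono (by omega)
    have hb := fun r => (h r).1
    have hq := fun r => (h r).2
    cases c with
    | seq | ite | loop | qloop => exact hc.elim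
    | push b x =>
      simp only [Cmd.exec, QM.pure_apply, List.mem_singleton] at ho
      subst ho
      refine h1.setBits _ ?_
      have := hb (s'.loc x)
      simp only [List.length_cons]
      omega
    | pop x =>
      simp only [Cmd.exec, QM.pure_apply, List.mem_singleton] at ho
      subst ho
      refine h1.setBits _ ?_
      have := hb (s'.loc x)
      simp only [List.length_tail]
      omega
    | copy x y =>
      simp only [Cmd.exec, QM.pure_apply, List.mem_singleton] at ho
      subst ho
      have := hb (s'.loc x)
      exact Store.LengthLE.setBits (h.mono (by simp only [Store.tick, Store.setBits]; omega)) _ (by simp only [Store.tick, Store.setBits]; omega)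
    | wipe a =>
      simp only [Cmd.exec, QM.pure_apply, List.mem_singleton] at ho
      subst ho
      exact h1.wipe _ _
    | qnew x =>
      obtain rfl := Cmd.mem_exec_qnew ho
      refine h1.setQubits _ ?_
      have := hq (s'.loc x)
      simp only [List.length_cons]
      omega
    | qshift x y =>
      rcases Cmd.mem_exec_qshift ho with rfl | ⟨q, l, e, rfl⟩
      · exact h1
      · have h0 := hq (s'.loc x)
        rw [e, List.length_cons] at h0
        have h2 := h.setQubits (s'.loc x) (l := l) (by omega)
        refine Store.LengthLE.setQubits
          (h2.mono (by simp only [Store.tick, Store.setQubits]; omega)) _ ?_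
        exact Nat.succ_le_succ (h2 ((s'.setQubits (s'.loc x) l).loc y)).2
    | qmove x y =>
      simp only [Cmd.exec, QM.pure_apply, List.mem_singleton] at ho
      subst ho
      have := hq (s'.loc x)
      exact Store.LengthLE.setQubits (Store.LengthLE.setQubits
        (h.mono (by simp only [Store.tick, Store.setQubits]; omega)) _ (Nat.zero_le _)) _
        (by simp only [Store.tick, Store.setQubits]; omega)
    | had => rcases Cmd.mem_exec_had ho with rfl | ⟨q, l, -, rfl⟩ <;> exact h1
    | tgate => rcases Cmd.mem_exec_tgate ho with rfl | ⟨q, rfl⟩ <;> exact h1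
    | cnot => rcases Cmd.mem_exec_cnot ho with rfl | ⟨q, r, -, rfl⟩ <;> exact h1
    | meas x y =>
      rcases Cmd.mem_exec_meas ho with rfl | ⟨q, l, b, e, rfl⟩
      · exact h1
      · have h0 := hq (s'.loc x)
        rw [e, List.length_cons] at h0
        have h2 := hb (s'.loc y)
        refine (h1.setQubits _ ?_).setBits _ ?_
        · omega
        · simp only [List.length_cons]
          omega

/-- The store refers only to qubits that have been allocated. -/
def Store.Allocated (s : Store) (n : ℕ) : Prop := ∀ r, ∀ q ∈ s.qubits r, q < n

theorem Store.Allocated.mono {s : Store} {m n : ℕ} (h : s.Allocated m) (hmn : m ≤ n) :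
    s.Allocated n := fun r q hq => (h r q hq).trans_le hmn

theorem Store.Allocated.setQubits {s : Store} {n : ℕ} (h : s.Allocated n) (r : ℕ × ℕ) {l : List ℕ}
    (hl : ∀ q ∈ l, q < n) : (s.setQubits r l).Allocated n := by
  intro r' q hq
  simp only [Store.setQubits, Function.update_apply] at hq
  split at hq
  exacts [hl q hq, h r' q hq]

theorem Store.Allocated.relabel {s : Store} {n : ℕ} (h : s.Allocated n) {ρ : ℕ → ℕ}
    (hρ : ∀ q < n, ρ q = q) : s.relabel ρ = s := by
  have : (fun r => (s.qubits r).map ρ) = s.qubits := by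
    funext r
    refine (List.map_congr_left (g := id) fun q hq => ?_).trans (List.map_id _)
    exact hρ q (h r q hq)
  simp [Store.relabel, this]

/-- All qubits that are referred to have been allocated; there are at least `n`. -/
structure Sound (n : ℕ) (s : Store) (g : QState) : Prop where
  valid : g.Valid
  le : n ≤ g.fresh
  alloc : s.Allocated g.fresh

/-- Guarantees that all numbers from `fresh` on are really free, so that another system can be
placed there or the later qubits renumbered. -/
theorem Cmd.sound {c : Cmd} {s : Store} {g : QState} {n : ℕ} (h : Sound n s g)
    {o : Store × QState} (ho : o ∈ c.exec s g) : Sound n o.1 o.2 := by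
  refine Cmd.exec_invariant (I := fun s' g' => Sound n s' g') ?_ ?_ c h o ho
  · exact fun s' g k h => ⟨h.valid, h.le, h.alloc⟩
  · intro c hc s' g ⟨hv, hle, hal⟩ o ho
    cases c with
    | seq | ite | loop | qloop => exact hc.elim
    | push | pop | copy =>
      simp only [Cmd.exec, QM.pure_apply, List.mem_singleton] at ho
      subst ho
      exact ⟨hv, hle, hal⟩
    | wipe a =>
      simp only [Cmd.exec, QM.pure_apply, List.mem_singleton] at ho
      subst ho
      refine ⟨hv, hle, fun r q hq => ?_⟩
      dsimp only at hq
      split at hq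
      · simp at hq
      · exact hal r q hq
    | qnew x =>
      obtain rfl := Cmd.mem_exec_qnew ho
      refine ⟨?_, Nat.le_succ_of_le hle, Store.Allocated.setQubits (hal.mono (Nat.le_succ _)) _ ?_⟩
      · exact Finsupp.supported_mono (fun S hS q hq => (hS q hq).trans (Nat.lt_succ_self _)) hv
      · intro q hq
        rcases List.mem_cons.1 hq with rfl | hq
        · exact Nat.lt_succ_self _
        · exact (hal _ q hq).trans (Nat.lt_succ_self _)
    | qshift x y =>
      rcases Cmd.mem_exec_qshift ho with rfl | ⟨q, l, e, rfl⟩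
      · exact ⟨hv, hle, hal⟩
      · have h2 := hal.setQubits (s'.loc x) (l := l) fun r hr => hal (s'.loc x) r (by simp [e, hr])
        refine ⟨hv, hle, Store.Allocated.setQubits h2 _ fun r hr => ?_⟩
        rcases List.mem_cons.1 hr with rfl | hr
        · exact hal (s'.loc x) r (by simp [e])
        · exact h2 _ r hr
    | qmove x y =>
      simp only [Cmd.exec, QM.pure_apply, List.mem_singleton] at ho
      subst ho
      exact ⟨hv, hle, Store.Allocated.setQubits (Store.Allocated.setQubits hal _ (by simp)) _
        (hal _)⟩
    | had x =>
      rcases Cmd.mem_exec_had ho with rfl | ⟨q, l, e, rfl⟩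
      · exact ⟨hv, hle, hal⟩
      · exact ⟨hv.hadamard (hal (s'.loc x) q (by simp [e])), hle, hal⟩
    | tgate x =>
      rcases Cmd.mem_exec_tgate ho with rfl | ⟨q, rfl⟩
      · exact ⟨hv, hle, hal⟩
      · exact ⟨hv.tGate, hle, hal⟩
    | cnot x y =>
      rcases Cmd.mem_exec_cnot ho with rfl | ⟨q, r, hr, rfl⟩
      · exact ⟨hv, hle, hal⟩
      · exact ⟨hv.cnot (hal (s'.loc y) r hr), hle, hal⟩
    | meas x y =>
      rcases Cmd.mem_exec_meas ho with rfl | ⟨q, l, b, e, rfl⟩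
      · exact ⟨hv, hle, hal⟩
      · exact ⟨hv.proj, hle,
          hal.setQubits (s'.loc x) (l := l) fun r hr => hal (s'.loc x) r (by simp [e, hr])⟩

/-! ### Conservation of probability -/

namespace QM

variable {α β : Type}

/-- The total weight of the branches is the weight of the initial state. -/
def Conserves (m : QM α) : Prop := ∀ g, expect m (fun _ g' => g'.weight) g = g.weight

theorem Conserves.pure (a : α) : Conserves (pure a : QM α) := fun g => expect_pure _ _ g

theorem Conserves.bind {m : QM α} {f : α → QM β} (hm : Conserves m) (hf : ∀ a, Conserves (f a)) :
    Conserves (m >>= f) := fun g => by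
  rw [expect_bind, expect_congr (Ψ := fun _ g' => g'.weight) fun o _ => hf o.1 o.2, hm g]

theorem Conserves.iter {f : α → QM α} (hf : ∀ a, Conserves (f a)) (n : ℕ) (a : α) :
    Conserves (iter f n a) := by
  induction n generalizing a with
  | zero => exact Conserves.pure a
  | succ n ih => exact (hf a).bind ih

theorem Conserves.collect {f : ℕ → QM α} (hf : ∀ j, Conserves (f j)) (n : ℕ) :
    Conserves (collect f n) := by
  induction n with
  | zero => exact Conserves.pure _
  | succ n ih => exact ih.bind fun l => (hf n).bind fun a => Conserves.pure _

theorem Conserves.gate {U : Finset ℕ → (Finset ℕ →₀ ℂ)}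
    (hU : ∀ S T, ampInner (U S) (U T) = if S = T then 1 else 0) : Conserves (gate U) := fun g => by
  simp only [expect, QM.gate, List.map_cons, List.map_nil, List.sum_cons, List.sum_nil, add_zero]
  exact ampWeight_linearCombination hU _

theorem Conserves.newQubit : Conserves newQubit := fun g => by
  simp [expect, QM.newQubit, QState.weight]

theorem Conserves.measure (q : ℕ) : Conserves (measure q) := fun g => by
  simp only [expect, QM.measure, List.map_cons, List.map_nil, List.sum_cons, List.sum_nil, add_zero]
  exact ampWeight_projector q _

end QM

-- Gates are isometries and the two projections of a measurement share out the weight. This is what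
-- allows a process with an unused result to be dropped.
open QM in
theorem Cmd.conserves (c : Cmd) (s : Store) : Conserves (c.exec s) := by
  induction c generalizing s with
  | push | pop | copy | wipe | qmove => exact Conserves.pure _
  | qnew x => exact Conserves.newQubit.bind fun _ => Conserves.pure _
  | qshift x y =>
    simp only [Cmd.exec]
    split <;> exact Conserves.pure _
  | had x =>
    simp only [Cmd.exec]
    split
    · exact Conserves.pure _
    · exact (Conserves.gate (ampInner_hadamardGate _)).bind fun _ => Conserves.pure _
  | tgate x =>
    simp only [Cmd.exec]
    split
    · exact Conserves.pure _
    · exact (Conserves.gate (ampInner_tGate _)).bind fun _ => Conserves.pure _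
  | cnot x y =>
    simp only [Cmd.exec]
    split
    · split
      · exact Conserves.pure _
      · rename_i h
        exact (Conserves.gate (ampInner_cnotGate h)).bind fun _ => Conserves.pure _
    · exact Conserves.pure _
  | meas x y =>
    simp only [Cmd.exec]
    split
    · exact Conserves.pure _
    · exact (Conserves.measure _).bind fun _ => Conserves.pure _
  | seq c d ihc ihd => exact (ihc s).bind ihd
  | ite x c d ihc ihd =>
    simp only [Cmd.exec]
    split
    exacts [ihc _, ihd _]
  | loop x c ih => exact Conserves.iter (fun s' => ih _) _ _
  | qloop x c ih => exact Conserves.iter (fun s' => ih _) _ _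

end

section

/-! ### Adjoining independent systems -/

theorem tens_single_empty (ρ : ℕ → ℕ) (a : Finset ℕ →₀ ℂ) (c : ℂ) :
    tens ρ (Finsupp.single ∅ c) a = c • a.mapDomain (Finset.image ρ) := by
  rw [tens_apply, Finsupp.mapDomain, Finsupp.smul_sum]
  refine Finsupp.sum_congr fun S _ => ?_
  rw [Finsupp.sum_single_index (by simp)]
  simp

theorem tens_tens (ρ ρ' : ℕ → ℕ) (h a b : Finset ℕ →₀ ℂ) :
    tens ρ (tens ρ' h a) b = b.sum fun R w => a.sum fun S y => h.sum fun T z =>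
      Finsupp.single (R.image ρ ∪ (S.image ρ' ∪ T)) (z * y * w) := by
  rw [tens_apply]
  refine Finsupp.sum_congr fun R _ => ?_
  have h0 : ∀ T : Finset ℕ, Finsupp.single (R.image ρ ∪ T) ((0 : ℂ) * b R) = 0 := by simp
  have h1 : ∀ (T : Finset ℕ) (z z' : ℂ), Finsupp.single (R.image ρ ∪ T) ((z + z') * b R) =
      Finsupp.single (R.image ρ ∪ T) (z * b R) + Finsupp.single (R.image ρ ∪ T) (z' * b R) := by
    intro T z z'
    rw [add_mul, Finsupp.single_add]
  rw [tens_apply, Finsupp.sum_sum_index h0 h1]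
  refine Finsupp.sum_congr fun S _ => ?_
  rw [Finsupp.sum_sum_index h0 h1]
  refine Finsupp.sum_congr fun T _ => ?_
  rw [Finsupp.sum_single_index (h0 _)]

namespace QState

/-- The qubits of `u` are appended to those of `g`. -/
noncomputable def adjoin (g u : QState) : QState :=
  ⟨g.fresh + u.fresh, tens (g.fresh + ·) g.amp u.amp⟩

variable {g u v : QState}

theorem Valid.avoids (hg : g.Valid) : Avoids (g.fresh + ·) g.amp := fun T hT q hq => by
  have := hg.lt hT hq
  dsimp only at this
  omega

/-- Every state is the vacuum with the state itself as spectator. A process on new qubits can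
therefore be analysed from the vacuum and transported to `g` by a shift. -/
theorem qrel_vacuum (g : QState) : QRel (g.fresh + ·) g.amp g vacuum := by
  refine ⟨?_, fun k => by simp [vacuum]⟩
  rw [vacuum, tens_single_right]
  simp only [Finset.image_empty, Finset.empty_union]
  exact Finsupp.mapDomain_id.symm

theorem eq_adjoin (h : QRel (g.fresh + ·) g.amp v u) : v = g.adjoin u := by
  obtain ⟨n, a⟩ := v
  obtain ⟨h1, h2⟩ := h
  have := h2 0
  simp only [add_zero] at this h1
  simp [adjoin, this, h1]

theorem Valid.adjoin (hg : g.Valid) (hu : u.Valid) : (g.adjoin u).Valid := by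
  unfold Valid QState.adjoin
  simp only [tens_apply]
  refine Submodule.sum_mem _ fun S hS => Submodule.sum_mem _ fun T hT =>
    Finsupp.single_mem_supported _ _ fun q hq => ?_
  rcases Finset.mem_union.1 hq with hq | hq
  · obtain ⟨r, hr, rfl⟩ := Finset.mem_image.1 hq
    have := hu.lt hS hr
    omega
  · have := hg.lt hT hq
    omega

theorem image_congr_of_lt {S : Finset ℕ} {n : ℕ} (hS : ∀ q ∈ S, q < n) {ρ ρ' : ℕ → ℕ}
    (h : ∀ q < n, ρ q = ρ' q) : S.image ρ = S.image ρ' :=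
  Finset.image_congr fun q hq => h q (hS q hq)

theorem image_eq_self_of_lt {S : Finset ℕ} {n : ℕ} (hS : ∀ q ∈ S, q < n) {ρ : ℕ → ℕ}
    (h : ∀ q < n, ρ q = q) : S.image ρ = S :=
  (image_congr_of_lt hS (ρ' := id) h).trans Finset.image_id

/-- The renaming that makes room for `m` qubits after the first `n`. -/
def skip (n m q : ℕ) : ℕ := if q < n then q else q + m

theorem skip_injective (n m : ℕ) : (skip n m).Injective := fun a b h => by
  unfold skip at h
  split at h <;> split at h <;> omega

/-- Here `u` is the spectator and `g` the active system. The old qubits of `g` keep their numbers;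
those allocated later must jump over the block of `u`, which is what `skip` does. -/
theorem qrel_adjoin_left (hg : g.Valid) :
    QRel (skip g.fresh u.fresh) (u.amp.mapDomain (Finset.image (g.fresh + ·)))
      (g.adjoin u) g := by
  constructor
  · rw [adjoin, tens_apply, tens_apply]
    rw [Finsupp.sum_comm]
    refine Finset.sum_congr rfl fun T hT => ?_
    dsimp only
    rw [Finsupp.sum_mapDomain_index (M := ℂ) (N := Finset ℕ →₀ ℂ)]
    · refine Finsupp.sum_congr fun S hS => ?_
      rw [image_eq_self_of_lt (fun q hq => hg.lt hT hq) fun q hq => by simp [skip, hq],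
        Finset.union_comm, mul_comm]
    · simp
    · intros
      rw [add_mul, Finsupp.single_add]
  · intro k
    simp only [skip, adjoin]
    rw [if_neg (by omega)]
    omega

theorem avoids_skip (hu : u.Valid) :
    Avoids (skip g.fresh u.fresh) (u.amp.mapDomain (Finset.image (g.fresh + ·))) := by
  classical
  intro T hT q hq
  have := Finsupp.mapDomain_support hT
  obtain ⟨S, hS, rfl⟩ := Finset.mem_image.1 this
  obtain ⟨r, hr, h⟩ := Finset.mem_image.1 hq
  have := hu.lt hS hr
  unfold skip at h
  split at h <;> omega

theorem ampWeight_image {ρ : ℕ → ℕ} (hρ : ρ.Injective) (a : Finset ℕ →₀ ℂ) :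
    ampWeight (a.mapDomain (Finset.image ρ)) = ampWeight a := by
  have h := tens_single_empty ρ a 1
  rw [one_smul] at h
  have hav : Avoids ρ (Finsupp.single ∅ 1) := fun T hT q hq => by
    have : T = ∅ := by simpa using Finsupp.support_single_subset hT
    simp [this] at hq
  rw [← h, ampWeight_tens hρ hav, ampWeight_single]
  simp

/-- Exchange the blocks of length `m` and `k` that follow the first `n` qubits. -/
def exchange (n m k q : ℕ) : ℕ :=
  if q < n then q else if q < n + m then q + k else if q < n + m + k then q - m else q

theorem exchange_injective (n m k : ℕ) : (exchange n m k).Injective := fun a b h => by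
  unfold exchange at h
  split_ifs at h <;> omega

/-- The two orders of adjoining differ by a permutation of two adjacent blocks. It fixes the qubits
of `g` and all unallocated ones, so the spectator is trivial. -/
theorem qrel_exchange (hg : g.Valid) (hu : u.Valid) (hv : v.Valid) :
    QRel (exchange g.fresh v.fresh u.fresh) (Finsupp.single ∅ 1)
      ((g.adjoin u).adjoin v) ((g.adjoin v).adjoin u) := by
  constructor
  · simp only [adjoin]
    rw [tens_tens, tens_tens, map_finsuppSum]
    simp only [map_finsuppSum]
    rw [Finsupp.sum_comm]
    refine Finsupp.sum_congr fun S hS => Finsupp.sum_congr fun R hR =>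
      Finsupp.sum_congr fun T hT => ?_
    have hS' := fun q hq => hu.lt hS (q := q) hq
    have hR' := fun q hq => hv.lt hR (q := q) hq
    have hT' := fun q hq => hg.lt hT (q := q) hq
    rw [tens_single_empty, one_smul, Finsupp.mapDomain_single, Finset.image_union,
      Finset.image_union, Finset.image_image, Finset.image_image,
      image_eq_self_of_lt hT' fun q hq => by simp [exchange, hq],
      image_congr_of_lt hS' (ρ := _ ∘ _) (ρ' := (g.fresh + ·)), image_congr_of_lt hR' (ρ := _ ∘ _)
        (ρ' := (g.fresh + u.fresh + ·))]
    · congr 1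
      · rw [← Finset.union_assoc, ← Finset.union_assoc, Finset.union_comm (R.image _)]
      · ring
    · intro q hq
      simp only [exchange, Function.comp_apply]
      split_ifs <;> omega
    · intro q hq
      simp only [exchange, Function.comp_apply]
      split_ifs <;> omega
  · intro k
    change exchange g.fresh v.fresh u.fresh (g.fresh + v.fresh + u.fresh + k) =
      g.fresh + u.fresh + v.fresh + k
    unfold exchange
    rw [if_neg (by omega), if_neg (by omega), if_neg (by omega)]
    omega

theorem avoids_single_empty (ρ : ℕ → ℕ) (c : ℂ) : Avoids ρ (Finsupp.single ∅ c) :=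
  fun T hT q hq => by
    have : T = ∅ := by simpa using Finsupp.support_single_subset hT
    simp [this] at hq

/-- A scalar factor is a spectator without qubits; this lets the coin's rescaling be handled by the
same relation. -/
theorem qrel_smul (g : QState) (c : ℂ) :
    QRel id (Finsupp.single ∅ c) ⟨g.fresh, c • g.amp⟩ g := by
  refine ⟨?_, fun k => rfl⟩
  have : Finset.image (id : ℕ → ℕ) = id := funext fun S => Finset.image_id
  rw [tens_single_empty, this, Finsupp.mapDomain_id]

end QState

namespace QM

variable {α β : Type}

/-- The process commutes with renamings of the qubits `n`, `n + 1`, …, and does not depend on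
other systems. -/
def Stable (n : ℕ) (K : QM Bool) : Prop :=
  ∀ ρ : ℕ → ℕ, ρ.Injective → (∀ q < n, ρ q = q) → ∀ h, Avoids ρ h → Lift (QRel ρ h) Eq K K

theorem Stable.mono {m n : ℕ} (hmn : m ≤ n) {K : QM Bool} (h : Stable m K) : Stable n K :=
  fun ρ hρ hn => h ρ hρ fun q hq => hn q (hq.trans_le hmn)

theorem accept_eq_of_lift {ρ : ℕ → ℕ} (hρ : ρ.Injective) {h : Finset ℕ →₀ ℂ} (hh : Avoids ρ h)
    {K K' : QM Bool} (hK : Lift (QRel ρ h) Eq K K') {g g' : QState} (hg : QRel ρ h g g') :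
    accept K g = ampWeight h * accept K' g' := by
  rw [accept, accept, ← expect_mul_left]
  refine hK.expect_eq hg fun o _ o' _ h1 h2 => ?_
  rw [h1]
  split
  · exact h2.weight hρ hh
  · simp

/-- Qubits that the rest of the experiment never touches contribute only the factor `u.weight`, the
probability of the branch that left them behind. -/
theorem Stable.accept_adjoin {g u : QState} {K : QM Bool} (hK : Stable g.fresh K) (hg : g.Valid)
    (hu : u.Valid) : accept K (g.adjoin u) = u.weight * accept K g := by
  rw [accept_eq_of_lift (QState.skip_injective g.fresh u.fresh) (QState.avoids_skip hu)
    (hK _ (QState.skip_injective _ _) (fun q hq => by simp [QState.skip, hq]) _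
      (QState.avoids_skip hu)) (QState.qrel_adjoin_left hg),
    QState.ampWeight_image (add_right_injective _), QState.weight_eq]

/-- A process that acts only on qubits that it creates itself. Its result may contain such qubits;
`r` renames them, and `A n` says that they have numbers below `n`. -/
structure Closed (r : (ℕ → ℕ) → α → α) (A : ℕ → α → Prop) (m : QM α) : Prop where
  lift : ∀ ρ : ℕ → ℕ, ρ.Injective → ∀ h, Avoids ρ h →
    Lift (QRel ρ h) (fun a b => a = r ρ b) m m
  safe : ∀ g : QState, g.Valid → ∀ o ∈ m g,
    o.2.Valid ∧ g.fresh ≤ o.2.fresh ∧ A o.2.fresh o.1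
  conserves : Conserves m

/-- A closed process with a classical result. -/
abbrev ClosedClassical (m : QM α) : Prop := Closed (fun _ a => a) (fun _ _ => True) m

variable {r : (ℕ → ℕ) → α → α} {A : ℕ → α → Prop} {r' : (ℕ → ℕ) → β → β} {B : ℕ → β → Prop}

theorem Closed.valid {m : QM α} (hm : Closed r A m) {u : α × QState}
    (hu : u ∈ m QState.vacuum) : u.2.Valid ∧ A u.2.fresh u.1 :=
  have h := hm.safe _ QState.valid_vacuum u hu
  ⟨h.1, h.2.2⟩

/-- Separates the process from the state in which it starts: its branches are those from the vacuum,
shifted behind `g`. -/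
theorem Closed.expect_eq {m : QM α} (hm : Closed r A m) {g : QState} (hg : g.Valid)
    (Φ : α → QState → ℝ) :
    expect m Φ g = expect m (fun a u => Φ (r (g.fresh + ·) a) (g.adjoin u)) QState.vacuum := by
  refine (hm.lift _ (add_right_injective _) _ hg.avoids).expect_eq g.qrel_vacuum
    fun o _ u _ h1 h2 => ?_
  rw [h1, QState.eq_adjoin h2]

theorem weight_vacuum : QState.vacuum.weight = 1 := by
  simp [QState.weight_eq, QState.vacuum, ampWeight_single]

/-- The expectation of a function of the classical result of a process. -/
noncomputable def mean (m : QM α) (φ : α → ℝ) : ℝ :=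
  expect m (fun a u => u.weight * φ a) QState.vacuum

theorem mean_const {m : QM α} (hm : Conserves m) (c : ℝ) : mean m (fun _ => c) = c := by
  rw [mean, expect_mul_right, hm, weight_vacuum, one_mul]

theorem mean_expect_comm (m : QM α) (m' : QM β) (Φ : α → β → QState → ℝ) (g : QState) :
    mean m (fun a => expect m' (Φ a) g) = expect m' (fun b v => mean m fun a => Φ a b v) g := by
  unfold mean
  rw [← expect_comm]
  simp only [expect_mul_left]

theorem mean_congr {m : QM α} {φ ψ : α → ℝ} (h : ∀ a, φ a = ψ a) : mean m φ = mean m ψ := by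
  rw [funext h]

/-- After a classical result, the leftover qubits are spectators of the continuation, so the process
amounts to sampling from a classical distribution. -/
theorem ClosedClassical.accept_bind {m : QM α} (hm : ClosedClassical m) {K : α → QM Bool}
    {g : QState} (hK : ∀ a, Stable g.fresh (K a)) (hg : g.Valid) :
    accept (m >>= K) g = mean m fun a => accept (K a) g := by
  rw [QM.accept_bind, hm.expect_eq hg, mean]
  exact expect_congr fun u hu => (hK _).accept_adjoin hg (hm.valid hu).1

theorem Closed.accept_discard {m : QM α} (hm : Closed r A m) {K : QM Bool}
    {g : QState} (hK : Stable g.fresh K) (hg : g.Valid) :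
    accept (m >>= fun _ => K) g = accept K g := by
  rw [QM.accept_bind, hm.expect_eq hg,
    expect_congr (Ψ := fun a u => u.weight * accept K g) fun u hu =>
      hK.accept_adjoin hg (hm.valid hu).1]
  exact mean_const hm.conserves _

/-- Both orders are expanded into double sums over branches from the vacuum. Fubini aligns the sums,
and the states in matching terms differ by a block exchange, which `K` does not notice provided that
the qubits handed to it are renamed as well. -/
theorem Closed.accept_swap {m : QM α} {m' : QM β} (hm : Closed r A m) (hm' : Closed r' B m')
    (hr : ∀ ρ ρ' n a, A n a → (∀ q < n, ρ q = ρ' q) → r ρ a = r ρ' a)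
    (hr' : ∀ ρ ρ' n a, B n a → (∀ q < n, ρ q = ρ' q) → r' ρ a = r' ρ' a)
    (hc : ∀ ρ ρ' a, r (ρ ∘ ρ') a = r ρ (r ρ' a)) (hc' : ∀ ρ ρ' a, r' (ρ ∘ ρ') a = r' ρ (r' ρ' a))
    {g : QState} (hg : g.Valid) {K : α → β → QM Bool}
    (hK : ∀ ρ : ℕ → ℕ, ρ.Injective → (∀ q < g.fresh, ρ q = q) → ∀ h, Avoids ρ h → ∀ a b,
      Lift (QRel ρ h) Eq (K (r ρ a) (r' ρ b)) (K a b)) :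
    accept (m >>= fun a => m' >>= fun b => K a b) g =
      accept (m' >>= fun b => m >>= fun a => K a b) g := by
  have h1 : accept (m >>= fun a => m' >>= fun b => K a b) g =
      expect m (fun a u => expect m' (fun b v => accept (K (r (g.fresh + ·) a)
        (r' ((g.adjoin u).fresh + ·) b)) ((g.adjoin u).adjoin v)) QState.vacuum)
        QState.vacuum := by
    simp only [QM.accept_bind]
    rw [hm.expect_eq hg]
    exact expect_congr fun u hu => hm'.expect_eq (hg.adjoin (hm.valid hu).1) _
  have h2 : accept (m' >>= fun b => m >>= fun a => K a b) g =
      expect m' (fun b v => expect m (fun a u => accept (K (r ((g.adjoin v).fresh + ·) a)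
        (r' (g.fresh + ·) b)) ((g.adjoin v).adjoin u)) QState.vacuum) QState.vacuum := by
    simp only [QM.accept_bind]
    rw [hm'.expect_eq hg]
    exact expect_congr fun v hv => hm.expect_eq (hg.adjoin (hm'.valid hv).1) _
  rw [h1, h2, expect_comm]
  refine expect_congr fun v hv => expect_congr fun u hu => ?_
  obtain ⟨hv1, hv2⟩ := hm'.valid hv
  obtain ⟨hu1, hu2⟩ := hm.valid hu
  have hπ := QState.exchange_injective g.fresh v.2.fresh u.2.fresh
  have hav := QState.avoids_single_empty (QState.exchange g.fresh v.2.fresh u.2.fresh) 1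
  have key := accept_eq_of_lift hπ hav
    (hK _ hπ (fun q hq => by simp [QState.exchange, hq]) _ hav
      (r ((g.adjoin v.2).fresh + ·) u.1) (r' (g.fresh + ·) v.1))
    (QState.qrel_exchange hg hu1 hv1)
  rw [ampWeight_single, norm_one, one_pow, one_mul, ← hc, ← hc'] at key
  rw [← key, hr (g.fresh + ·) _ _ _ hu2, hr' ((g.adjoin u.2).fresh + ·) _ _ _ hv2]
  · intro q hq
    simp only [QState.exchange, QState.adjoin, Function.comp_apply]
    split_ifs <;> omega
  · intro q hq
    simp only [QState.exchange, QState.adjoin, Function.comp_apply]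
    split_ifs <;> omega

/-- The coin multiplies amplitudes by `1 / √2`, hence weights by `1 / 2`. -/
theorem accept_coin_bind {K : Bool → QM Bool} {g : QState} (hK : ∀ b, Stable g.fresh (K b)) :
    accept (coin >>= K) g = 1 / 2 * (accept (K false) g + accept (K true) g) := by
  have h : ∀ b, accept (K b) ⟨g.fresh, ((Real.sqrt 2 : ℝ) : ℂ)⁻¹ • g.amp⟩ =
      1 / 2 * accept (K b) g := by
    intro b
    rw [accept_eq_of_lift Function.injective_id (QState.avoids_single_empty _ _)
      (hK b _ Function.injective_id (fun _ _ => rfl) _ (QState.avoids_single_empty _ _))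
      (QState.qrel_smul g _), ampWeight_single]
    congr 1
    rw [norm_inv, Complex.norm_real, Real.norm_eq_abs, abs_of_nonneg (Real.sqrt_nonneg 2), inv_pow,
      Real.sq_sqrt (by norm_num)]
    norm_num
  rw [QM.accept_bind]
  simp only [expect, coin, List.map_cons, List.map_nil, List.sum_cons, List.sum_nil, add_zero, h]
  ring

theorem accept_add_accept_not {m : QM Bool} (hm : Conserves m) (g : QState) :
    accept (m >>= fun b => pure (b == true)) g + accept (m >>= fun b => pure (b == false)) g =
      g.weight := by
  rw [← hm g, QM.accept_bind, QM.accept_bind, ← expect_add]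
  refine expect_congr fun o _ => ?_
  simp only [accept, expect_pure]
  cases o.1 <;> simp

end QM

end

section

namespace QM

variable {α β : Type}

/-! ### Collections of independent processes -/

theorem collect_bind_pure_comp (f : ℕ → QM α) (φ : α → β) (n : ℕ) {γ : Type}
    (K : List β → QM γ) :
    (collect f n >>= fun l => K (l.map φ)) =
      collect (fun j => f j >>= fun a => pure (φ a)) n >>= K := by
  induction n generalizing K with
  | zero => simp [collect]
  | succ n ih =>
    simp only [collect, bind_assoc, pure_bind, List.map_append, List.map_cons, List.map_nil]
    exact ih fun l => f n >>= fun a => K (l ++ [φ a])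

theorem mem_collect_getD {f : ℕ → QM α} {n : ℕ} {g : QState} {o : List α × QState}
    (ho : o ∈ collect f n g) {j : ℕ} (hj : j < n) (d : α) :
    ∃ g', ∃ o' ∈ f j g', o.1.getD j d = o'.1 := by
  induction n generalizing o with
  | zero => omega
  | succ n ih =>
    simp only [collect, bind_apply, pure_apply, List.mem_flatMap, List.mem_singleton] at ho
    obtain ⟨o₁, h₁, o₂, h₂, rfl⟩ := ho
    have hl := length_of_mem_collect h₁
    rcases Nat.lt_succ_iff_lt_or_eq.1 hj with h | rfl
    · obtain ⟨g', o', ho', e⟩ := ih h₁ h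
      exact ⟨g', o', ho', by rw [← e, List.getD_append _ _ _ _ (by omega)]⟩
    · exact ⟨o₁.2, o₂, h₂, by rw [List.getD_append_right _ _ _ _ (by omega), hl]; simp⟩

theorem safe_collect {A : ℕ → α → Prop} (hA : ∀ a m n, m ≤ n → A m a → A n a) {f : ℕ → QM α}
    (hf : ∀ j, ∀ g : QState, g.Valid → ∀ o ∈ f j g,
      o.2.Valid ∧ g.fresh ≤ o.2.fresh ∧ A o.2.fresh o.1) (n : ℕ) :
    ∀ g : QState, g.Valid → ∀ o ∈ collect f n g,
      o.2.Valid ∧ g.fresh ≤ o.2.fresh ∧ ∀ a ∈ o.1, A o.2.fresh a := by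
  intro g hg
  induction n with
  | zero =>
    intro o ho
    simp only [collect, pure_apply, List.mem_singleton] at ho
    subst ho
    exact ⟨hg, le_rfl, by simp⟩
  | succ n ih =>
    intro o ho
    simp only [collect, bind_apply, pure_apply, List.mem_flatMap, List.mem_singleton] at ho
    obtain ⟨o₁, h₁, o₂, h₂, rfl⟩ := ho
    obtain ⟨v1, l1, a1⟩ := ih o₁ h₁
    obtain ⟨v2, l2, a2⟩ := hf n _ v1 o₂ h₂
    refine ⟨v2, l1.trans l2, fun a ha => ?_⟩
    rcases List.mem_append.1 ha with ha | ha
    · exact hA _ _ _ l2 (a1 a ha)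
    · rw [List.mem_singleton.1 ha]
      exact a2

theorem Closed.collect {r : (ℕ → ℕ) → α → α} {A : ℕ → α → Prop}
    (hA : ∀ a m n, m ≤ n → A m a → A n a) {f : ℕ → QM α} (hf : ∀ j, Closed r A (f j)) (n : ℕ) :
    Closed (fun ρ l => l.map (r ρ)) (fun n l => ∀ a ∈ l, A n a) (collect f n) where
  lift := fun ρ hρ h hh => (Lift.collect fun j _ => (hf j).lift ρ hρ h hh).mono fun l l' hl => by
    induction hl with
    | nil => rfl
    | cons h _ ih => rw [List.map_cons, h, ih]
  safe := safe_collect hA (fun j => (hf j).safe) n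
  conserves := Conserves.collect (fun j => (hf j).conserves) n

theorem ClosedClassical.collect {f : ℕ → QM α} (hf : ∀ j, ClosedClassical (f j)) (n : ℕ) :
    ClosedClassical (collect f n) where
  lift := fun ρ hρ h hh => ((Closed.collect (fun _ _ _ _ _ => trivial) hf n).lift ρ hρ h hh).mono
    fun l l' hl => by simpa using hl
  safe := fun g hg o ho =>
    have h := (Closed.collect (fun _ _ _ _ _ => trivial) hf n).safe g hg o ho
    ⟨h.1, h.2.1, trivial⟩
  conserves := Conserves.collect (fun j => (hf j).conserves) n

theorem ClosedClassical.bind_pure {m : QM α} (hm : ClosedClassical m) (φ : α → β) :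
    ClosedClassical (m >>= fun a => pure (φ a)) where
  lift := fun ρ hρ h hh => (hm.lift ρ hρ h hh).bind fun a b hab => Lift.pure (by rw [hab])
  safe := fun g hg o ho => by
    simp only [bind_apply, pure_apply, List.mem_flatMap, List.mem_singleton] at ho
    obtain ⟨o', ho', rfl⟩ := ho
    exact hm.safe g hg o' ho'
  conserves := hm.conserves.bind fun _ => Conserves.pure _

theorem ClosedClassical.stable_bind {m : QM α} (hm : ClosedClassical m) {K : α → QM Bool} {n : ℕ}
    (hK : ∀ a, Stable n (K a)) : Stable n (m >>= K) :=
  fun ρ hρ hn h hh => (hm.lift ρ hρ h hh).bind fun a b hab => by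
    rw [show a = b from hab]
    exact hK b ρ hρ hn h hh

/-- A process that yields a tuple of qubits which it has created. -/
abbrev ClosedQubits (m : QM (List ℕ)) : Prop :=
  Closed (fun ρ l => l.map ρ) (fun n l => ∀ q ∈ l, q < n) m

/-- A sample from which one entry of a list of samples is taken may be drawn beforehand. -/
theorem mean_accept_collect {κ : Type} {key : QM κ} (hkey : ClosedClassical key) (φ : κ → α)
    {D : List α → QM Bool} {g : QState} (hD : ∀ l, Stable g.fresh (D l)) (hg : g.Valid)
    (i n : ℕ) :
    (mean key fun k => accept (collect (fun j => if j = i then pure (φ k) else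
      key >>= fun k' => pure (φ k')) n >>= D) g) =
      accept (collect (fun _ => key >>= fun k' => pure (φ k')) n >>= D) g := by
  have hpub := hkey.bind_pure φ
  have hcongr : ∀ n ≤ i, ∀ k, collect (fun j => if j = i then pure (φ k) else
      key >>= fun k' => pure (φ k')) n = collect (fun _ => key >>= fun k' => pure (φ k')) n :=
    fun n hn k => collect_congr fun j hj => by rw [if_neg (by omega)]
  induction n generalizing D with
  | zero =>
    simp only [collect]
    exact mean_const hkey.conserves _
  | succ n ih =>
    rcases lt_trichotomy n i with h | rfl | h
    · simp only [hcongr (n + 1) h]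
      exact mean_const hkey.conserves _
    -- The special entry comes last. The average over the sample is moved past the earlier entries,
    -- where it becomes an actual run of the process.
    · simp only [collect, hcongr n le_rfl, if_true, pure_bind, bind_assoc]
      simp only [QM.accept_bind (collect _ _)]
      rw [mean_expect_comm]
      refine expect_congr fun o ho => ?_
      have hs := (ClosedClassical.collect (fun _ => hpub) n).safe g hg o ho
      exact (hkey.accept_bind (fun k => (hD _).mono hs.2.1) hs.1).symm
    · simp only [collect, bind_assoc, if_neg h.ne', pure_bind]
      have := ih (D := fun l => key >>= fun k' => D (l ++ [φ k']))
        fun l => hkey.stable_bind fun k' => hD _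
      simpa only [bind_assoc, pure_bind] using this

/-- Quantum counterpart of `mean_accept_collect`, for the challenge ciphertext. Entry `i` is moved
to the front by exchanging it with the block of earlier entries, while later entries are absorbed
into the continuation. If `i` is not below `n`, the ciphertext is made and ignored, which changes no
probability. -/
theorem accept_collect_hoist {e : ℕ → QM (List ℕ)} (he : ∀ j, ClosedQubits (e j))
    {K : List (List ℕ) → QM Bool} {g : QState}
    (hK : ∀ ρ : ℕ → ℕ, ρ.Injective → (∀ q < g.fresh, ρ q = q) → ∀ h, Avoids ρ h → ∀ l,
      Lift (QRel ρ h) Eq (K (l.map (List.map ρ))) (K l)) (hg : g.Valid) (i n : ℕ) :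
    accept (e i >>= fun ct => collect (fun j => if j = i then pure ct else e j) n >>= K) g =
      accept (collect e n >>= K) g := by
  have hcoll := Closed.collect (fun a m n hmn h q hq => (h q hq).trans_le hmn) he
  have hcongr : ∀ n ≤ i, ∀ ct, collect (fun j => if j = i then pure ct else e j) n = collect e n :=
    fun n hn k => collect_congr fun j hj => by rw [if_neg (by omega)]
  have hst : ∀ n, Stable g.fresh (collect e n >>= K) := fun n ρ hρ hn h hh =>
    ((hcoll n).lift ρ hρ h hh).bind fun a b hab => by
      rw [hab]
      exact hK ρ hρ hn h hh b
  induction n generalizing K with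
  | zero =>
    simp only [collect]
    exact (he i).accept_discard (hst 0) hg
  | succ n ih =>
    rcases lt_trichotomy n i with h | rfl | h
    · simp only [hcongr (n + 1) h]
      exact (he i).accept_discard (hst _) hg
    · simp only [collect, hcongr n le_rfl, if_true, pure_bind, bind_assoc]
      refine (he n).accept_swap (hcoll n) ?_ ?_ ?_ ?_ hg
        (K := fun ct l => K (l ++ [ct])) ?_
      · exact fun ρ ρ' n a ha h => List.map_congr_left fun q hq => h q (ha q hq)
      · exact fun ρ ρ' n a ha h => List.map_congr_left fun l hl =>
          List.map_congr_left fun q hq => h q (ha l hl q hq)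
      · simp
      · simp
      · intro ρ hρ hn h hh a b
        have := hK ρ hρ hn h hh (b ++ [a])
        simpa using this
    · simp only [collect, bind_assoc, if_neg h.ne', pure_bind]
      have hK' : ∀ ρ : ℕ → ℕ, ρ.Injective → (∀ q < g.fresh, ρ q = q) → ∀ h, Avoids ρ h → ∀ l,
          Lift (QRel ρ h) Eq (e n >>= fun a => K (l.map (List.map ρ) ++ [a]))
            (e n >>= fun a => K (l ++ [a])) := by
        intro ρ hρ hn h hh l
        refine ((he n).lift ρ hρ h hh).bind fun a b hab => ?_
        rw [hab]
        have := hK ρ hρ hn h hh (l ++ [b])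
        simpa using this
      exact ih (K := fun l => e n >>= fun a => K (l ++ [a])) hK' fun n ρ hρ hn h hh =>
        ((hcoll n).lift ρ hρ h hh).bind fun a b hab => by
          rw [hab]
          exact hK' ρ hρ hn h hh b

/-! ### Random numbers -/

/-- A uniformly random bit, made with a qubit. -/
noncomputable def flip : QM Bool := do
  let q ← newQubit
  gate (hadamardGate q)
  measure q

theorem flip_apply (g : QState) : flip g =
    [(false, ((⟨g.fresh + 1, g.amp⟩ : QState).apply (hadamardGate g.fresh)).apply
        (projector g.fresh false)),
      (true, ((⟨g.fresh + 1, g.amp⟩ : QState).apply (hadamardGate g.fresh)).apply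
        (projector g.fresh true))] := by
  simp [flip, bind_apply, newQubit, gate, measure]

/-- Programs have no primitive coin, so the reduction measures a Hadamard-rotated fresh qubit. That
qubit stays in the joint state and must be treated as a spectator. -/
theorem closedClassical_flip : ClosedClassical flip where
  lift := fun ρ hρ h hh g g' hg => by
    have hQ := Bisim.qrel hρ hh
    rw [flip_apply, flip_apply, hQ.fresh g g' hg]
    have h1 : QRel ρ h ⟨ρ g'.fresh + 1, g.amp⟩ ⟨g'.fresh + 1, g'.amp⟩ := by
      rw [← hQ.fresh g g' hg]
      exact hQ.new _ _ hg
    have h2 := hQ.hadamard _ _ g'.fresh h1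
    exact .cons ⟨rfl, hQ.proj _ _ _ _ h2⟩ (.cons ⟨rfl, hQ.proj _ _ _ _ h2⟩ .nil)
  safe := fun g hg o ho => by
    have h1 : (⟨g.fresh + 1, g.amp⟩ : QState).Valid :=
      Finsupp.supported_mono (fun S hS q hq => (hS q hq).trans (Nat.lt_succ_self _)) hg
    have h2 := h1.hadamard (q := g.fresh) (Nat.lt_succ_self _)
    rw [flip_apply] at ho
    simp only [List.mem_cons, List.not_mem_nil, or_false] at ho
    rcases ho with rfl | rfl
    all_goals exact ⟨h2.proj, Nat.le_succ _, trivial⟩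
  conserves := Conserves.newQubit.bind fun q =>
    (Conserves.gate (ampInner_hadamardGate q)).bind fun _ => Conserves.measure q

theorem mean_flip (φ : Bool → ℝ) : mean flip φ = 1 / 2 * (φ false + φ true) := by
  simp only [mean, expect, flip_apply, List.map_cons, List.map_nil, List.sum_cons, List.sum_nil,
    add_zero, QState.weight_eq]
  simp [QState.apply, QState.vacuum, hadamardGate, projector, ampWeight_single]
  ring

theorem accept_flip_bind {K : Bool → QM Bool} {g : QState} (hK : ∀ b, Stable g.fresh (K b))
    (hg : g.Valid) : accept (flip >>= K) g = 1 / 2 * (accept (K false) g + accept (K true) g) := by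
  rw [closedClassical_flip.accept_bind hK hg, mean_flip]

/-- One round of sampling: append a random bit to the number `p.2` in `{0, …, p.1 - 1}`, unless
`p.1` has reached `r`. -/
noncomputable def sampleRound (r : ℕ) (p : ℕ × ℕ) : QM (ℕ × ℕ) :=
  if p.1 < r then do
    let b ← flip
    pure (2 * p.1, 2 * p.2 + b.toNat)
  else pure p

/-- The size of the range after `m` rounds. -/
def sampleSize (r : ℕ) : ℕ → ℕ
  | 0 => 1
  | m + 1 => if sampleSize r m < r then 2 * sampleSize r m else sampleSize r m

theorem sampleSize_pos (r m : ℕ) : 0 < sampleSize r m := by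
  induction m with
  | zero => simp [sampleSize]
  | succ m ih =>
    rw [sampleSize]
    split <;> omega

/-- Doubling a positive number adds at least one, so `r` rounds certainly reach `r`. -/
theorem le_sampleSize (r m : ℕ) : min r (m + 1) ≤ sampleSize r m := by
  induction m with
  | zero => simp [sampleSize]
  | succ m ih =>
    have := sampleSize_pos r m
    rw [sampleSize]
    split <;> omega

/-- Only numbers below `r` are doubled; the extra one covers `r = 0`, where the size stays `1`. -/
theorem sampleSize_le (r m : ℕ) : sampleSize r m ≤ 2 * r + 1 := by
  induction m with
  | zero => simp [sampleSize]
  | succ m ih =>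
    rw [sampleSize]
    split <;> omega

theorem sum_range_two_mul (f : ℕ → ℝ) (n : ℕ) :
    ∑ i ∈ Finset.range (2 * n), f i = ∑ i ∈ Finset.range n, (f (2 * i) + f (2 * i + 1)) := by
  induction n with
  | zero => simp
  | succ n ih =>
    rw [Nat.mul_succ, Finset.sum_range_succ, Finset.sum_range_succ, ih, Finset.sum_range_succ]
    ring

theorem accept_sample {r : ℕ} (m : ℕ) {K : ℕ → QM Bool} {g : QState}
    (hK : ∀ i, Stable g.fresh (K i)) (hg : g.Valid) :
    accept (iter (sampleRound r) m (1, 0) >>= fun p => K p.2) g =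
      1 / (sampleSize r m : ℝ) * ∑ i ∈ Finset.range (sampleSize r m), accept (K i) g := by
  -- For the induction the continuation must also see the size of the range, because the next round
  -- branches on it.
  suffices H : ∀ K : ℕ × ℕ → QM Bool, (∀ p, Stable g.fresh (K p)) →
      accept (iter (sampleRound r) m (1, 0) >>= K) g = 1 / (sampleSize r m : ℝ) *
        ∑ i ∈ Finset.range (sampleSize r m), accept (K (sampleSize r m, i)) g from
    H (fun p => K p.2) fun p => hK p.2
  intro K hK
  induction m generalizing K with
  | zero => simp [iter, sampleSize]
  | succ m ih =>
    rw [iter_succ_eq, bind_assoc, ih fun p => sampleRound r p >>= K]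
    · by_cases h : sampleSize r m < r
      · simp only [sampleRound, h, if_true, bind_assoc, pure_bind, sampleSize]
        -- The numbers `2 * i` and `2 * i + 1` are the two extensions of `i` by a random bit.
        rw [sum_range_two_mul, Finset.mul_sum, Finset.mul_sum]
        refine Finset.sum_congr rfl fun i _ => ?_
        rw [accept_flip_bind (fun b => hK _) hg]
        push_cast
        have : (sampleSize r m : ℝ) ≠ 0 := by exact_mod_cast (sampleSize_pos r m).ne'
        simp only [Bool.toNat_false, Bool.toNat_true, add_zero]
        field_simp
      · simp only [sampleRound, h, if_false, pure_bind, sampleSize]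
    · intro p
      unfold sampleRound
      split
      · rw [bind_assoc]
        exact closedClassical_flip.stable_bind fun b => by rw [pure_bind]; exact hK _
      · rw [pure_bind]
        exact hK p

end QM

end

/-! ### The hybrid argument -/

section

open QM

/-! ### The algorithms as closed processes -/

theorem Store.init_allocated (lam n : ℕ) : (Store.init lam).Allocated n := fun r q hq => by
  simp [Store.init, Store.blank, Store.setBits] at hq

theorem encInput_allocated (lam : ℕ) (pk m : List Bool) (n : ℕ) :
    (encInput lam pk m).Allocated n := Store.init_allocated lam n

theorem Store.relabel_setQubitsArray (ρ : ℕ → ℕ) (s : Store) (a : ℕ) (l : List (List ℕ)) :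
    (s.relabel ρ).setQubitsArray a (l.map (List.map ρ)) = (s.setQubitsArray a l).relabel ρ := by
  simp only [Store.setQubitsArray, Store.relabel, Store.mk.injEq, and_true, true_and,
    List.length_map]
  funext r
  split
  · rename_i h
    rw [List.getD_eq_getElem _ _ (by simpa using h.2), List.getD_eq_getElem _ _ h.2,
      List.getElem_map]
  · rfl

theorem Store.relabel_setBitsArray (ρ : ℕ → ℕ) (s : Store) (a : ℕ) (l : List (List Bool)) :
    (s.relabel ρ).setBitsArray a l = (s.setBitsArray a l).relabel ρ := rfl

variable (P : PKE) (A : MKCPAAdversary) (lam : ℕ)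

theorem PKE.closed_runKeyGen : ClosedClassical (P.runKeyGen lam) where
  lift := fun ρ hρ h hh => by
    have := Cmd.exec_relabel (Bisim.qrel hρ hh) P.keyGen (Store.init lam)
    exact this.bind fun s t hst => Lift.pure (by rw [hst]; rfl)
  safe := fun g hg o ho => by
    simp only [PKE.runKeyGen, bind_apply, pure_apply, List.mem_flatMap, List.mem_singleton] at ho
    obtain ⟨o', ho', rfl⟩ := ho
    have := Cmd.sound ⟨hg, le_rfl, Store.init_allocated _ _⟩ ho'
    exact ⟨this.valid, this.le, trivial⟩
  conserves := (Cmd.conserves _ _).bind fun _ => Conserves.pure _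

theorem PKE.closed_runEnc (pk m : List Bool) : ClosedQubits (P.runEnc lam pk m) where
  lift := fun ρ hρ h hh => by
    have := Cmd.exec_relabel (Bisim.qrel hρ hh) P.enc (encInput lam pk m)
    exact this.bind fun s t hst => Lift.pure (by rw [hst]; rfl)
  safe := fun g hg o ho => by
    simp only [PKE.runEnc, bind_apply, pure_apply, List.mem_flatMap, List.mem_singleton] at ho
    obtain ⟨o', ho', rfl⟩ := ho
    have := Cmd.sound ⟨hg, le_rfl, encInput_allocated _ _ _ _⟩ ho'
    exact ⟨this.valid, this.le, this.alloc _⟩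
  conserves := (Cmd.conserves _ _).bind fun _ => Conserves.pure _

/-- The public key of a new key pair. -/
noncomputable def PKE.pubKey : QM (List Bool) := P.runKeyGen lam >>= fun key => pure key.2

theorem PKE.closed_pubKey : ClosedClassical (P.pubKey lam) :=
  (P.closed_runKeyGen lam).bind_pure _

/-! ### Hybrid experiments -/

/-- Encrypt, for each `j`, the message with index `σ j` of the `j`-th pair. -/
noncomputable def encAll (pks : List (List Bool)) (σ : ℕ → Bool) (s : Store) (n : ℕ) :
    QM (List (List ℕ)) :=
  QM.collect (fun j => P.runEnc lam (pks.getD j [])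
    (toMessage lam (if σ j then s.bits (4, j) else s.bits (3, j)))) n

/-- The last phase of the adversary. -/
noncomputable def MKCPAAdversary.finish (s : Store) (cts : List (List ℕ)) : QM Bool := do
  let s' ← A.guess.exec (s.setQubitsArray 0 cts)
  pure (s'.topBit 5)

/-- The output of the adversary if the message with index `σ j` is encrypted under key `j`. -/
noncomputable def hybrid (σ : ℕ → Bool) : QM Bool := do
  let s₀ ← A.count.exec (Store.init lam)
  let n := (s₀.bits (1, 0)).length
  let pks ← QM.collect (fun _ => P.pubKey lam) n
  let s₁ ← A.choose.exec (s₀.setBitsArray 2 pks)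
  let cts ← encAll P lam pks σ s₁ n
  A.finish s₁ cts

/-- The phases of the hybrid experiment after the choice of the messages. -/
noncomputable def hybridTail (pks : List (List Bool)) (n : ℕ) (s : Store) (σ : ℕ → Bool)
    (b : Bool) : QM Bool := do
  let cts ← encAll P lam pks σ s n
  let c ← A.finish s cts
  pure (c == b)

theorem MKCPAAdversary.lift_finish {ρ : ℕ → ℕ} {Q : QState → QState → Prop} (hQ : Bisim ρ Q)
    (s : Store) (cts : List (List ℕ)) :
    Lift Q Eq (A.finish (s.relabel ρ) (cts.map (List.map ρ))) (A.finish s cts) := by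
  unfold MKCPAAdversary.finish
  rw [Store.relabel_setQubitsArray]
  exact (Cmd.exec_relabel hQ _ _).bind fun s t hst => Lift.pure (by rw [hst]; rfl)

theorem closed_encAll (pks : List (List Bool)) (σ : ℕ → Bool) (s : Store) (n : ℕ) :
    Closed (fun ρ l => l.map (List.map ρ)) (fun n l => ∀ a ∈ l, ∀ q ∈ a, q < n)
      (encAll P lam pks σ s n) :=
  Closed.collect (fun _ _ _ hmn h q hq => (h q hq).trans_le hmn)
    (fun _ => P.closed_runEnc lam _ _) n

theorem lift_hybridTail {ρ : ℕ → ℕ} (hρ : ρ.Injective) {h : Finset ℕ →₀ ℂ} (hh : Avoids ρ h)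
    (pks : List (List Bool)) (n : ℕ) (s : Store) (σ : ℕ → Bool) (b : Bool) :
    Lift (QRel ρ h) Eq (hybridTail P A lam pks n (s.relabel ρ) σ b)
      (hybridTail P A lam pks n s σ b) :=
  ((closed_encAll P lam pks σ s n).lift ρ hρ h hh).bind fun l l' hl => by
    rw [hl]
    exact (A.lift_finish (Bisim.qrel hρ hh) s l').bind fun c c' hc => Lift.pure (by rw [hc])

theorem stable_hybridTail (pks : List (List Bool)) (n : ℕ) {s : Store} {k : ℕ}
    (hs : s.Allocated k) (σ : ℕ → Bool) (b : Bool) :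
    Stable k (hybridTail P A lam pks n s σ b) := fun ρ hρ hn h hh => by
  have := lift_hybridTail P A lam hρ hh pks n s σ b
  rwa [hs.relabel hn] at this

theorem hybrid_bind (σ : ℕ → Bool) (b : Bool) :
    (hybrid P A lam σ >>= fun c => pure (c == b)) = (do
      let s₀ ← A.count.exec (Store.init lam)
      let n := (s₀.bits (1, 0)).length
      let pks ← QM.collect (fun _ => P.pubKey lam) n
      let s₁ ← A.choose.exec (s₀.setBitsArray 2 pks)
      hybridTail P A lam pks n s₁ σ b) := by
  simp only [hybrid, hybridTail, bind_assoc]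

theorem conserves_hybrid (σ : ℕ → Bool) : Conserves (hybrid P A lam σ) :=
  (Cmd.conserves _ _).bind fun _ =>
    (Conserves.collect (fun _ => (P.closed_pubKey lam).conserves) _).bind fun _ =>
      (Cmd.conserves _ _).bind fun _ => (closed_encAll P lam _ σ _ _).conserves.bind fun _ =>
        (Cmd.conserves _ _).bind fun _ => Conserves.pure _

/-- The probability that the adversary outputs `b` in the hybrid experiment. -/
noncomputable def hybridProb (σ : ℕ → Bool) (b : Bool) : ℝ :=
  accept (hybrid P A lam σ >>= fun c => pure (c == b)) QState.vacuum

/-- Complementation turns the outputs `0` and `1` that count as wins into differences of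
probabilities of a single output, which is what telescopes later. -/
theorem hybridProb_add (σ : ℕ → Bool) :
    hybridProb P A lam σ true + hybridProb P A lam σ false = 1 :=
  (accept_add_accept_not (conserves_hybrid P A lam σ) _).trans weight_vacuum

theorem hybridProb_congr {σ τ : ℕ → Bool} {k : ℕ}
    (hk : ∀ g, ∀ o ∈ A.count.exec (Store.init lam) g, (o.1.bits (1, 0)).length ≤ k)
    (h : ∀ j < k, σ j = τ j) (b : Bool) : hybridProb P A lam σ b = hybridProb P A lam τ b := by
  unfold hybridProb
  rw [hybrid_bind, hybrid_bind, accept_bind, accept_bind]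
  refine expect_congr fun o ho => ?_
  congr 1
  have hn := hk _ o ho
  have : ∀ pks s, hybridTail P A lam pks (o.1.bits (1, 0)).length s σ b =
      hybridTail P A lam pks (o.1.bits (1, 0)).length s τ b := by
    intro pks s
    unfold hybridTail encAll
    rw [collect_congr fun j hj => by rw [h j (by omega)]]
  simp only [this]

/-- The secret keys are never used, so key generation may be replaced by sampling public keys. The
coin then selects one of the two constant hybrids, with a common prefix before it. -/
theorem prob_mkcpaExperiment :
    (mkcpaExperiment P A lam).prob =
      1 / 2 * (hybridProb P A lam (fun _ => false) false +
        hybridProb P A lam (fun _ => true) true) := by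
  have h0 : mkcpaExperiment P A lam = (do
      let s₀ ← A.count.exec (Store.init lam)
      let n := (s₀.bits (1, 0)).length
      let pks ← QM.collect (fun _ => P.pubKey lam) n
      let s₁ ← A.choose.exec (s₀.setBitsArray 2 pks)
      let b ← QM.coin
      hybridTail P A lam pks n s₁ (fun _ => b) b) := by
    unfold mkcpaExperiment
    congr 1
    funext s₀
    have := collect_bind_pure_comp (fun _ => P.runKeyGen lam) Prod.snd (s₀.bits (1, 0)).length
      fun pks => (do
        let s₁ ← A.choose.exec (s₀.setBitsArray 2 pks)
        let b ← QM.coin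
        hybridTail P A lam pks (s₀.bits (1, 0)).length s₁ (fun _ => b) b)
    refine Eq.trans ?_ this
    simp only [hybridTail, encAll, MKCPAAdversary.finish, bind_assoc, pure_bind]
  rw [prob_eq_accept, h0]
  unfold hybridProb
  rw [hybrid_bind, hybrid_bind]
  simp only [accept_bind _ (fun s₀ => _ >>= _), accept_bind (A.choose.exec _)]
  rw [← expect_add, ← expect_mul_left]
  refine expect_congr fun o₀ ho₀ => ?_
  rw [← expect_add, ← expect_mul_left]
  refine expect_congr fun o₁ ho₁ => ?_
  rw [← expect_add, ← expect_mul_left]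
  refine expect_congr fun o₂ ho₂ => ?_
  have v0 := Cmd.sound ⟨QState.valid_vacuum, le_rfl, Store.init_allocated _ _⟩ ho₀
  have v1 := (ClosedClassical.collect (fun _ => P.closed_pubKey lam) _).safe _ v0.valid o₁ ho₁
  have v2 := Cmd.sound (n := 0) (s := o₀.1.setBitsArray 2 o₁.1)
      ⟨v1.1, Nat.zero_le _, v0.alloc.mono v1.2.1⟩ ho₂
  exact accept_coin_bind fun b => stable_hybridTail P A lam _ _ v2.alloc _ _

/-! ### The experiment with the reduction -/

/-- The messages are chosen by `σ j = (j < i ∨ j = i ∧ b)`. -/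
def threshold (i : ℕ) (b : Bool) (j : ℕ) : Bool := decide (j < i) || (decide (j = i) && b)

theorem threshold_true (i : ℕ) : threshold i true = threshold (i + 1) false := by
  funext j
  simp only [threshold, Bool.and_true, Bool.and_false, Bool.or_false]
  rw [← Bool.decide_or, decide_eq_decide]
  omega

/-- The keys in the reduction: the key with index `i` is replaced by `pk`. -/
noncomputable def keyAt (pk : List Bool) (i j : ℕ) : QM (List Bool) :=
  if j = i then pure pk else P.pubKey lam

/-- The ciphertexts in the reduction: the one with index `i` is `ct`. -/
noncomputable def encAt (pks : List (List Bool)) (s : Store) (ct : List ℕ) (i j : ℕ) :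
    QM (List ℕ) :=
  if j < i then P.runEnc lam (pks.getD j []) (toMessage lam (s.bits (4, j)))
  else if j = i then pure ct
  else P.runEnc lam (pks.getD j []) (toMessage lam (s.bits (3, j)))

/-- The single-key experiment after the choice of the index `i`. -/
noncomputable def embedded (pk : List Bool) (i : ℕ) : QM Bool := do
  let s₀ ← A.count.exec (Store.init lam)
  let n := (s₀.bits (1, 0)).length
  let pks ← QM.collect (keyAt P lam pk i) n
  let s₁ ← A.choose.exec (s₀.setBitsArray 2 pks)
  let b ← QM.coin
  let ct ← P.runEnc lam pk (toMessage lam (if b then s₁.bits (4, i) else s₁.bits (3, i)))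
  let cts ← QM.collect (encAt P lam pks s₁ ct i) n
  let c ← A.finish s₁ cts
  pure (c == b)

theorem lift_keyAt {ρ : ℕ → ℕ} (hρ : ρ.Injective) {h : Finset ℕ →₀ ℂ} (hh : Avoids ρ h)
    (pk : List Bool) (i j : ℕ) :
    Lift (QRel ρ h) Eq (keyAt P lam pk i j) (keyAt P lam pk i j) := by
  unfold keyAt
  split
  · exact Lift.pure rfl
  · exact (P.closed_pubKey lam).lift ρ hρ h hh

theorem safe_keyAt (pk : List Bool) (i j : ℕ) (g : QState) (hg : g.Valid) :
    ∀ o ∈ keyAt P lam pk i j g, o.2.Valid ∧ g.fresh ≤ o.2.fresh ∧ True := by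
  unfold keyAt
  split
  · intro o ho
    simp only [pure_apply, List.mem_singleton] at ho
    subst ho
    exact ⟨hg, le_rfl, trivial⟩
  · exact (P.closed_pubKey lam).safe g hg

/-- The phases of `embedded` that follow the coin. -/
noncomputable def embeddedTail (pk : List Bool) (i n : ℕ) (pks : List (List Bool)) (s : Store)
    (b : Bool) : QM Bool := do
  let ct ← P.runEnc lam pk (toMessage lam (if b then s.bits (4, i) else s.bits (3, i)))
  let cts ← QM.collect (encAt P lam pks s ct i) n
  let c ← A.finish s cts
  pure (c == b)

theorem lift_embeddedTail {ρ : ℕ → ℕ} (hρ : ρ.Injective) {h : Finset ℕ →₀ ℂ} (hh : Avoids ρ h)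
    (pk : List Bool) (i n : ℕ) (pks : List (List Bool)) (s : Store) (b : Bool) :
    Lift (QRel ρ h) Eq (embeddedTail P A lam pk i n pks (s.relabel ρ) b)
      (embeddedTail P A lam pk i n pks s b) := by
  refine ((P.closed_runEnc lam _ _).lift ρ hρ h hh).bind fun ct ct' hct => ?_
  have h1 : ∀ j < n, Lift (QRel ρ h) (fun l l' => l = l'.map ρ)
      (encAt P lam pks (s.relabel ρ) ct i j) (encAt P lam pks s ct' i j) := by
    intro j _
    unfold encAt
    split
    · exact (P.closed_runEnc lam _ _).lift ρ hρ h hh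
    · split
      · exact Lift.pure hct
      · exact (P.closed_runEnc lam _ _).lift ρ hρ h hh
  refine (Lift.collect h1).bind fun l l' hl => ?_
  have hl' : l = l'.map (List.map ρ) := by
    induction hl with
    | nil => rfl
    | cons h _ ih => rw [List.map_cons, h, ih]
  rw [hl']
  exact (A.lift_finish (Bisim.qrel hρ hh) s l').bind fun c c' hc => Lift.pure (by rw [hc])

theorem stable_embeddedTail (pk : List Bool) (i n : ℕ) (pks : List (List Bool)) {s : Store}
    {k : ℕ} (hs : s.Allocated k) (b : Bool) :
    Stable k (embeddedTail P A lam pk i n pks s b) := fun ρ hρ hn h hh => by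
  have := lift_embeddedTail P A lam hρ hh pk i n pks s b
  rwa [hs.relabel hn] at this

theorem lift_coin {ρ : ℕ → ℕ} (h : Finset ℕ →₀ ℂ) : Lift (QRel ρ h) Eq coin coin := by
  intro g g' hg
  have : QRel ρ h ⟨g.fresh, ((Real.sqrt 2 : ℝ) : ℂ)⁻¹ • g.amp⟩
      ⟨g'.fresh, ((Real.sqrt 2 : ℝ) : ℂ)⁻¹ • g'.amp⟩ :=
    ⟨by rw [hg.1, map_smul], hg.2⟩
  exact .cons ⟨rfl, this⟩ (.cons ⟨rfl, this⟩ .nil)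

/-- The public key is classical and everything else starts afresh, so no earlier qubit is referred
to; hence the bound `0`. -/
theorem stable_embedded (pk : List Bool) (i : ℕ) : Stable 0 (embedded P A lam pk i) := by
  intro ρ hρ _ h hh
  have hQ := Bisim.qrel hρ hh
  refine (Cmd.exec_relabel hQ A.count (Store.init lam)).bind fun s₀ t₀ h₀ => ?_
  subst h₀
  refine (Lift.collect fun j _ => lift_keyAt P lam hρ hh pk i j).bind fun l l' hl => ?_
  rw [List.forall₂_eq_eq_eq] at hl
  subst hl
  refine (Cmd.exec_relabel hQ A.choose (t₀.setBitsArray 2 l)).bind fun s₁ t₁ h₁ => ?_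
  subst h₁
  refine (lift_coin h).bind fun b b' hb => ?_
  subst hb
  exact lift_embeddedTail P A lam hρ hh pk i _ l t₁ b

/-- The challenge ciphertext, made first, is moved back to its position by `accept_collect_hoist`.
The key is constrained only for `i < n`; otherwise the ciphertext is discarded. -/
theorem accept_embeddedTail {g : QState} (hg : g.Valid) {s : Store} (hs : s.Allocated g.fresh)
    {pk : List Bool} {i n : ℕ} {pks : List (List Bool)} (hpk : i < n → pks.getD i [] = pk)
    (b : Bool) :
    accept (embeddedTail P A lam pk i n pks s b) g =
      accept (hybridTail P A lam pks n s (threshold i b) b) g := by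
  -- The key at `i` is forced to be `pk` even if `i` is out of range, so that `e i` is always the
  -- challenge encryption.
  let e : ℕ → QM (List ℕ) := fun j =>
    P.runEnc lam (if j = i then pk else pks.getD j [])
      (toMessage lam (if threshold i b j then s.bits (4, j) else s.bits (3, j)))
  have h := accept_collect_hoist (e := e) (fun j => P.closed_runEnc lam _ _)
    (K := fun cts => A.finish s cts >>= fun c => pure (c == b)) (g := g) ?_ hg i n
  · refine Eq.trans ?_ (h.trans ?_)
    · unfold embeddedTail
      congr 1
      have he : e i = P.runEnc lam pk
          (toMessage lam (if b then s.bits (4, i) else s.bits (3, i))) := by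
        simp [e, threshold]
      rw [he]
      congr 1
      funext ct
      congr 1
      refine collect_congr fun j _ => ?_
      unfold encAt
      rcases lt_trichotomy j i with h | rfl | h
      · simp [e, h, h.ne, threshold]
      · simp
      · simp [e, h.ne', h.not_gt, threshold]
    · unfold hybridTail encAll
      congr 2
      refine collect_congr fun j hj => ?_
      by_cases hji : j = i
      · subst hji
        simp only [e, if_true, hpk hj]
      · simp only [e, if_neg hji]
  · intro ρ hρ hn h hh l
    have := A.lift_finish (Bisim.qrel hρ hh) s l
    rw [hs.relabel hn] at this
    exact this.bind fun c c' hc => Lift.pure (by rw [hc])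

/-- For a fixed run of `count`, the challenger's key drawn in advance has the same effect as a key
drawn at position `i`. Replacing it, after the challenge ciphertext has been put in place, leaves
exactly the two hybrids around `i`. -/
theorem mean_embedded (i : ℕ) :
    (mean (P.runKeyGen lam) fun key => accept (embedded P A lam key.2 i) QState.vacuum) =
      1 / 2 * (hybridProb P A lam (threshold i false) false +
        hybridProb P A lam (threshold i true) true) := by
  let D : Store → Bool → List (List Bool) → QM Bool := fun s₀ b pks => do
    let s₁ ← A.choose.exec (s₀.setBitsArray 2 pks)
    hybridTail P A lam pks (s₀.bits (1, 0)).length s₁ (threshold i b) b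
  have h1 : ∀ pk, accept (embedded P A lam pk i) QState.vacuum =
      expect (A.count.exec (Store.init lam)) (fun s₀ g => 1 / 2 *
        (accept (QM.collect (keyAt P lam pk i) (s₀.bits (1, 0)).length >>= D s₀ false) g +
        accept (QM.collect (keyAt P lam pk i) (s₀.bits (1, 0)).length >>= D s₀ true) g))
        QState.vacuum := by
    intro pk
    unfold embedded
    rw [accept_bind]
    refine expect_congr fun o₀ ho₀ => ?_
    simp only [D]
    rw [accept_bind, accept_bind (m := QM.collect _ _), accept_bind (m := QM.collect _ _),
      ← expect_add, ← expect_mul_left]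
    refine expect_congr fun o₁ ho₁ => ?_
    rw [accept_bind, accept_bind (m := A.choose.exec _), accept_bind (m := A.choose.exec _),
      ← expect_add, ← expect_mul_left]
    refine expect_congr fun o₂ ho₂ => ?_
    have v0 := Cmd.sound ⟨QState.valid_vacuum, le_rfl, Store.init_allocated _ _⟩ ho₀
    have v1 := safe_collect (A := fun _ _ => True) (fun _ _ _ _ _ => trivial)
      (fun j g hg => safe_keyAt P lam pk i j g hg) _ _ v0.valid o₁ ho₁
    have v2 := Cmd.sound (n := 0) (s := o₀.1.setBitsArray 2 o₁.1)
      ⟨v1.1, Nat.zero_le _, v0.alloc.mono v1.2.1⟩ ho₂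
    have hpk : i < (o₀.1.bits (1, 0)).length → o₁.1.getD i [] = pk := by
      intro hi
      obtain ⟨g', o', ho', e⟩ := mem_collect_getD ho₁ hi []
      rw [keyAt, if_pos rfl, pure_apply, List.mem_singleton] at ho'
      rw [e, ho']
    refine (accept_coin_bind fun b => stable_embeddedTail P A lam pk i _ o₁.1 v2.alloc b).trans ?_
    rw [accept_embeddedTail P A lam v2.valid v2.alloc hpk,
      accept_embeddedTail P A lam v2.valid v2.alloc hpk]
  simp only [h1]
  -- The key does not influence `count`, so the average over keys can be taken inside its branches.
  rw [mean_expect_comm]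
  unfold hybridProb
  rw [hybrid_bind, hybrid_bind, accept_bind, accept_bind, ← expect_add, ← expect_mul_left]
  refine expect_congr fun o₀ ho₀ => ?_
  have v0 := Cmd.sound ⟨QState.valid_vacuum, le_rfl, Store.init_allocated _ _⟩ ho₀
  have hD : ∀ b l, Stable o₀.2.fresh (D o₀.1 b l) := by
    intro b l ρ hρ hn h hh
    have := Cmd.exec_relabel (Bisim.qrel hρ hh) A.choose (o₀.1.setBitsArray 2 l)
    rw [← Store.relabel_setBitsArray, v0.alloc.relabel hn] at this
    refine this.bind fun s t hst => ?_
    rw [hst]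
    exact lift_hybridTail P A lam hρ hh _ _ t _ b
  -- The key at position `i` becomes an independent sample like all others.
  have key := fun b => mean_accept_collect (P.closed_runKeyGen lam) Prod.snd (hD b) v0.valid i
    (o₀.1.bits (1, 0)).length
  have hmean : ∀ φ ψ : List Bool × List Bool → ℝ,
      (mean (P.runKeyGen lam) fun k => 1 / 2 * (φ k + ψ k)) =
        1 / 2 * (mean (P.runKeyGen lam) φ + mean (P.runKeyGen lam) ψ) := by
    intro φ ψ
    unfold mean
    rw [← expect_add, ← expect_mul_left]
    refine expect_congr fun _ _ => ?_
    ring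
  rw [hmean]
  congr 2
  · exact key false
  · exact key true

/-- The single-key experiment with the reduction, which guesses an index among `r` or more. -/
noncomputable def reduced (r : ℕ) : QM Bool := do
  let key ← P.runKeyGen lam
  let p ← QM.iter (sampleRound r) r (1, 0)
  embedded P A lam key.2 p.2

/-- Each index contributes `1 / 2` plus half the difference of neighbouring hybrids. The sum over
the sampling range telescopes, and its endpoints are the constant hybrids since that range covers
every possible number of keys. -/
theorem prob_reduced {r : ℕ}
    (hr : ∀ g, ∀ o ∈ A.count.exec (Store.init lam) g, (o.1.bits (1, 0)).length ≤ r) :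
    (mkcpaExperiment P A lam).prob =
      1 / 2 + (sampleSize r r : ℝ) * ((reduced P A lam r).prob - 1 / 2) := by
  have hpos : (sampleSize r r : ℝ) ≠ 0 := by exact_mod_cast (sampleSize_pos r r).ne'
  have h1 : (reduced P A lam r).prob = 1 / (sampleSize r r : ℝ) *
      ∑ i ∈ Finset.range (sampleSize r r), 1 / 2 *
        (hybridProb P A lam (threshold i false) false +
          hybridProb P A lam (threshold i true) true) := by
    have hst : ∀ k i, Stable QState.vacuum.fresh (embedded P A lam k i) :=
      fun k i => stable_embedded P A lam k i
    simp only [← mean_embedded]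
    have hsample : ∀ k : List Bool × List Bool,
        accept (QM.iter (sampleRound r) r (1, 0) >>= fun p => embedded P A lam k.2 p.2)
          QState.vacuum = 1 / (sampleSize r r : ℝ) * ∑ i ∈ Finset.range (sampleSize r r),
            accept (embedded P A lam k.2 i) QState.vacuum :=
      fun k => accept_sample (K := fun i => embedded P A lam k.2 i) r (fun i => hst k.2 i)
        QState.valid_vacuum
    rw [prob_eq_accept, reduced, (P.closed_runKeyGen lam).accept_bind ?_ QState.valid_vacuum]
    · rw [mean_congr hsample]
      unfold mean
      rw [← expect_finset_sum, ← expect_mul_left]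
      refine expect_congr fun o _ => ?_
      rw [← Finset.mul_sum]
      ring
    · intro k
      refine Stable.mono (Nat.zero_le _) fun ρ hρ hn h hh => Lift.bind (R := Eq) (Lift.iter ?_ _ rfl) ?_
      · rintro p _ rfl
        unfold sampleRound
        split
        · refine (closedClassical_flip.lift ρ hρ h hh).bind fun a b hab => Lift.pure ?_
          rw [show a = b from hab]
        · exact Lift.pure rfl
      · rintro p _ rfl
        exact stable_embedded P A lam _ _ ρ hρ hn h hh
  -- Needed so that the last hybrid uses the second message under every key; exceeding `r` only adds
  -- zero terms.
  have hle : r ≤ sampleSize r r := (by omega : r = min r (r + 1)).le.trans (le_sampleSize r r)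
  have e0 : hybridProb P A lam (threshold 0 false) true = hybridProb P A lam (fun _ => false) true :=
    hybridProb_congr P A lam hr (fun j _ => by simp [threshold]) _
  have e1 : hybridProb P A lam (threshold (sampleSize r r) false) true =
      hybridProb P A lam (fun _ => true) true :=
    hybridProb_congr P A lam hr (fun j hj => by simp [threshold]; omega) _
  have hterm : ∀ i, 1 / 2 * (hybridProb P A lam (threshold i false) false +
      hybridProb P A lam (threshold i true) true) = 1 / 2 + 1 / 2 *
        (hybridProb P A lam (threshold (i + 1) false) true -
          hybridProb P A lam (threshold i false) true) := by
    intro i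
    have := hybridProb_add P A lam (threshold i false)
    rw [threshold_true]
    linarith
  have h0 := hybridProb_add P A lam fun _ => false
  rw [prob_mkcpaExperiment, h1]
  simp only [hterm]
  rw [Finset.sum_add_distrib, ← Finset.mul_sum, Finset.sum_range_sub
    (fun i => hybridProb P A lam (threshold i false) true), e0, e1, Finset.sum_const,
    Finset.card_range, nsmul_eq_mul]
  field_simp
  linarith

end

/-! ### Implementation of the reduction as a program -/

section

open QM

/-! ### Elementary programs -/

section simpLemmas

variable (s : Store) (r r' : ℕ × ℕ) (l : List Bool) (q : List ℕ) (n : ℕ)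

@[simp] theorem Store.bits_setBits :
    (s.setBits r l).bits r' = if r' = r then l else s.bits r' := Function.update_apply _ _ _ _

@[simp] theorem Store.qubits_setBits : (s.setBits r l).qubits = s.qubits := rfl

@[simp] theorem Store.time_setBits : (s.setBits r l).time = s.time := rfl

@[simp] theorem Store.bits_setQubits : (s.setQubits r q).bits = s.bits := rfl

@[simp] theorem Store.qubits_setQubits :
    (s.setQubits r q).qubits r' = if r' = r then q else s.qubits r' := Function.update_apply _ _ _ _

@[simp] theorem Store.time_setQubits : (s.setQubits r q).time = s.time := rfl

@[simp] theorem Store.bits_tick : (s.tick n).bits = s.bits := rfl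

@[simp] theorem Store.qubits_tick : (s.tick n).qubits = s.qubits := rfl

@[simp] theorem Store.time_tick : (s.tick n).time = s.time + n := rfl

@[simp] theorem Store.loc_scalar (a : ℕ) : s.loc (.scalar a) = (a, 0) := rfl

theorem Store.loc_cell (a i : ℕ) : s.loc (.cell a i) = (a, (s.bits (i, 0)).length) := rfl

theorem Cmd.exec_seq (c d : Cmd) : (c.seq d).exec s = c.exec s >>= d.exec := rfl

theorem Cmd.exec_ite (x : Addr) (c d : Cmd) : (Cmd.ite x c d).exec s =
    if (s.bits (s.loc x)).headD false then c.exec (s.tick 1) else d.exec (s.tick 1) := rfl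

theorem Cmd.exec_loop (x : Addr) (c : Cmd) : (Cmd.loop x c).exec s =
    QM.iter (fun s' => c.exec (s'.tick 1)) (s.bits (s.loc x)).length (s.tick 1) := rfl

end simpLemmas

/-- Only registers with names in `X` have changed. -/
def Frame (X : Set ℕ) (s s' : Store) : Prop :=
  ∀ r : ℕ × ℕ, r.1 ∉ X → s'.bits r = s.bits r ∧ s'.qubits r = s.qubits r

theorem Frame.refl (X : Set ℕ) (s : Store) : Frame X s s := fun _ _ => ⟨rfl, rfl⟩

theorem Frame.trans {X Y Z : Set ℕ} {s t u : Store} (h : Frame X s t) (h' : Frame Y t u)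
    (hX : X ⊆ Z) (hY : Y ⊆ Z) : Frame Z s u := fun r hr =>
  have h1 := h r fun h => hr (hX h)
  have h2 := h' r fun h => hr (hY h)
  ⟨h2.1.trans h1.1, h2.2.trans h1.2⟩

theorem Frame.mono {X Y : Set ℕ} {s t : Store} (h : Frame X s t) (hXY : X ⊆ Y) : Frame Y s t :=
  fun r hr => h r fun h => hr (hXY h)

theorem Frame.bits {X : Set ℕ} {s t : Store} (h : Frame X s t) {a : ℕ} (ha : a ∉ X) (i : ℕ) :
    t.bits (a, i) = s.bits (a, i) := (h (a, i) ha).1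

theorem Frame.qubits {X : Set ℕ} {s t : Store} (h : Frame X s t) {a : ℕ} (ha : a ∉ X) (i : ℕ) :
    t.qubits (a, i) = s.qubits (a, i) := (h (a, i) ha).2

theorem Frame.setBits {X : Set ℕ} {s t : Store} (h : Frame X s t) {a : ℕ} (ha : a ∈ X) (i : ℕ)
    (l : List Bool) : Frame X s (t.setBits (a, i) l) := fun r hr => by
  have : r ≠ (a, i) := fun e => hr (by rw [e]; exact ha)
  simpa [this] using h r hr

theorem Frame.setQubits {X : Set ℕ} {s t : Store} (h : Frame X s t) {a : ℕ} (ha : a ∈ X) (i : ℕ)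
    (l : List ℕ) : Frame X s (t.setQubits (a, i) l) := fun r hr => by
  have : r ≠ (a, i) := fun e => hr (by rw [e]; exact ha)
  simpa [this] using h r hr

theorem Frame.tick {X : Set ℕ} {s t : Store} (h : Frame X s t) (n : ℕ) :
    Frame X s (t.tick n) := h

/-- The program is deterministic, and ends in a store that satisfies `R`. -/
def Runs (c : Cmd) (s : Store) (R : Store → Prop) : Prop := ∃ s', c.exec s = pure s' ∧ R s'

theorem Runs.mono {c : Cmd} {s : Store} {R R' : Store → Prop} (h : Runs c s R)
    (hR : ∀ s', R s' → R' s') : Runs c s R' :=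
  let ⟨s', h1, h2⟩ := h
  ⟨s', h1, hR s' h2⟩

theorem Runs.seq {c d : Cmd} {s : Store} {R R' : Store → Prop} (hc : Runs c s R)
    (hd : ∀ s', R s' → Runs d s' R') : Runs (.seq c d) s R' := by
  obtain ⟨s', h1, h2⟩ := hc
  obtain ⟨s'', h3, h4⟩ := hd s' h2
  exact ⟨s'', by rw [Cmd.exec_seq, h1, pure_bind, h3], h4⟩

/-- Deterministic bookkeeping has a single branch and leaves the quantum state alone, so it is
invisible to the simulated process. -/
theorem Runs.lift_seq {α : Type} {Q : QState → QState → Prop} {T : Store → α → Prop} {c d : Cmd}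
    {s : Store} {R : Store → Prop} {m : QM α} (hc : Runs c s R)
    (hd : ∀ s', R s' → Lift Q T (d.exec s') m) : Lift Q T ((Cmd.seq c d).exec s) m := by
  obtain ⟨s', h1, h2⟩ := hc
  rw [Cmd.exec_seq, h1, pure_bind]
  exact hd s' h2

theorem lift_seq {α β : Type} {Q : QState → QState → Prop} {R : Store → α → Prop}
    {T : Store → β → Prop} {c d : Cmd} {s : Store} {m : QM α} {f : α → QM β}
    (hc : Lift Q R (c.exec s) m) (hd : ∀ s' a, R s' a → Lift Q T (d.exec s') (f a)) :
    Lift Q T ((Cmd.seq c d).exec s) (m >>= f) := hc.bind hd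

/-- A final deterministic command. -/
theorem lift_seq_runs {α : Type} {Q : QState → QState → Prop} {R T : Store → α → Prop}
    {c d : Cmd} {s : Store} {m : QM α} (hc : Lift Q R (c.exec s) m)
    (hd : ∀ s' a, R s' a → Runs d s' (fun s'' => T s'' a)) :
    Lift Q T ((Cmd.seq c d).exec s) m := by
  rw [← bind_pure m]
  refine hc.bind fun s' a h => ?_
  obtain ⟨s'', h1, h2⟩ := hd s' a h
  rw [h1]
  exact Lift.pure h2

theorem Runs.iter {α : Type} {f : α → QM α} (R : ℕ → α → Prop) (n : ℕ)
    (hf : ∀ j < n, ∀ s, R j s → ∃ s', f s = pure s' ∧ R (j + 1) s') {s : α} (h : R 0 s) :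
    ∃ s', QM.iter f n s = pure s' ∧ R n s' := by
  induction n with
  | zero => exact ⟨s, rfl, h⟩
  | succ n ih =>
    obtain ⟨s', h1, h2⟩ := ih fun j hj => hf j (by omega)
    obtain ⟨s'', h3, h4⟩ := hf n (by omega) s' h2
    exact ⟨s'', by rw [iter_succ_eq, h1, pure_bind, h3], h4⟩

theorem Runs.loop {x : Addr} {c : Cmd} {s : Store} (R : ℕ → Store → Prop)
    (hf : ∀ j < (s.bits (s.loc x)).length, ∀ s', R j s' → Runs c (s'.tick 1) (R (j + 1)))
    (h : R 0 (s.tick 1)) : Runs (.loop x c) s (R (s.bits (s.loc x)).length) :=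
  Runs.iter R _ hf h

theorem runs_push (b : Bool) (a : ℕ) (s : Store) {R : Store → Prop}
    (h : R ((s.setBits (a, 0) (b :: s.bits (a, 0))).tick 1)) : Runs (.push b (.scalar a)) s R :=
  ⟨_, rfl, h⟩

theorem runs_pop (a : ℕ) (s : Store) {R : Store → Prop}
    (h : R ((s.setBits (a, 0) (s.bits (a, 0)).tail).tick 1)) : Runs (.pop (.scalar a)) s R :=
  ⟨_, rfl, h⟩

theorem runs_copy (x y : Addr) (s : Store) {R : Store → Prop}
    (h : R ((s.setBits (s.loc y) (s.bits (s.loc x))).tick (1 + (s.bits (s.loc x)).length))) :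
    Runs (.copy x y) s R := ⟨_, rfl, h⟩

theorem runs_qmove (x y : Addr) (s : Store) {R : Store → Prop}
    (h : R (((s.setQubits (s.loc x) []).setQubits (s.loc y) (s.qubits (s.loc x))).tick
      (1 + (s.qubits (s.loc x)).length))) : Runs (.qmove x y) s R := ⟨_, rfl, h⟩

theorem runs_wipe (a : ℕ) (s : Store) {R : Store → Prop}
    (h : ∀ s', (∀ i, s'.bits (a, i) = [] ∧ s'.qubits (a, i) = []) → Frame {a} s s' →
      s'.time = s.time + 1 → R s') : Runs (.wipe a) s R :=
  ⟨_, rfl, h _ (fun i => by simp) (fun r hr => by simp_all) rfl⟩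

theorem runs_ite {x : Addr} {c d : Cmd} {s : Store} {R : Store → Prop}
    (h1 : (s.bits (s.loc x)).headD false = true → Runs c (s.tick 1) R)
    (h2 : (s.bits (s.loc x)).headD false = false → Runs d (s.tick 1) R) :
    Runs (.ite x c d) s R := by
  unfold Runs
  rw [Cmd.exec_ite]
  split
  · rename_i h
    exact h1 h
  · rename_i h
    exact h2 (by simpa using h)

/-- A register that is read as a number. -/
def Store.Unary (s : Store) (a n : ℕ) : Prop := s.bits (a, 0) = List.replicate n true

theorem Store.Unary.length {s : Store} {a n : ℕ} (h : s.Unary a n) :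
    (s.bits (a, 0)).length = n := by rw [h, List.length_replicate]

theorem headD_replicate (n : ℕ) : (List.replicate n true).headD false = decide (0 < n) := by
  cases n <;> simp [List.replicate_succ]

theorem Store.Unary.push {s : Store} {a n : ℕ} (h : s.Unary a n) (k : ℕ) :
    ((s.setBits (a, 0) (true :: s.bits (a, 0))).tick k).Unary a (n + 1) := by
  simp only [Unary, bits_tick, bits_setBits, if_true]
  rw [h, List.replicate_succ]

theorem Store.Unary.frame {X : Set ℕ} {s t : Store} {a n : ℕ} (h : s.Unary a n)
    (hf : Frame X s t) (ha : a ∉ X) : t.Unary a n := (hf.bits ha 0).trans h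

/-- Add the length of `x` to the number `b`. -/
theorem runs_addLoop {x : Addr} {b m : ℕ} {s : Store} (hb : s.Unary b m) :
    Runs (.loop x (.push true (.scalar b))) s fun s' =>
      s'.Unary b (m + (s.bits (s.loc x)).length) ∧ Frame {b} s s' ∧
        s'.time = s.time + 1 + 2 * (s.bits (s.loc x)).length := by
  refine Runs.loop (fun j s' => s'.Unary b (m + j) ∧ Frame {b} s s' ∧
    s'.time = s.time + 1 + 2 * j) ?_ ⟨hb, Frame.refl _ _, rfl⟩
  rintro j - s' ⟨h1, h2, h3⟩
  refine runs_push _ _ _ ⟨?_, ?_, ?_⟩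
  · exact (show (s'.tick 1).Unary b (m + j) from h1).push 1
  · exact (Frame.setBits (h2.tick 1) (Set.mem_singleton b) 0 _).tick 1
  · simp only [Store.time_tick, Store.time_setBits, h3]
    omega

/-- Subtract the length of `x` from the number `b`. -/
theorem runs_subLoop {x : Addr} {b m : ℕ} {s : Store} (hb : s.Unary b m) :
    Runs (.loop x (.pop (.scalar b))) s fun s' =>
      s'.Unary b (m - (s.bits (s.loc x)).length) ∧ Frame {b} s s' ∧
        s'.time = s.time + 1 + 2 * (s.bits (s.loc x)).length := by
  refine Runs.loop (fun j s' => s'.Unary b (m - j) ∧ Frame {b} s s' ∧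
    s'.time = s.time + 1 + 2 * j) ?_ ⟨hb, Frame.refl _ _, rfl⟩
  rintro j - s' ⟨h1, h2, h3⟩
  refine runs_pop _ _ ⟨?_, ?_, ?_⟩
  · simp only [Store.Unary, Store.bits_tick, Store.bits_setBits, if_true]
    rw [h1, List.tail_replicate]
    rfl
  · exact (Frame.setBits (h2.tick 1) (Set.mem_singleton b) 0 _).tick 1
  · simp only [Store.time_tick, Store.time_setBits, h3]
    omega

/-- Move the top bit of `a` (or `0` if there is none) to `b`. -/
def transferCmd (a b : ℕ) : Cmd :=
  .seq (.ite (.scalar a) (.push true (.scalar b)) (.push false (.scalar b))) (.pop (.scalar a))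

theorem runs_transfer {a b : ℕ} (hab : a ≠ b) (s : Store) :
    Runs (transferCmd a b) s fun s' =>
      s'.bits (a, 0) = (s.bits (a, 0)).tail ∧
      s'.bits (b, 0) = (s.bits (a, 0)).headD false :: s.bits (b, 0) ∧ Frame {a, b} s s' ∧
      s'.time = s.time + 3 := by
  have key : ∀ v, (s.bits (a, 0)).headD false = v →
      Runs (.push v (.scalar b)) (s.tick 1) fun s' =>
        s'.bits (a, 0) = s.bits (a, 0) ∧ s'.bits (b, 0) =
          (s.bits (a, 0)).headD false :: s.bits (b, 0) ∧ Frame {a, b} s s' ∧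
        s'.time = s.time + 2 := by
    rintro v rfl
    refine runs_push _ _ _ ⟨by simp [hab], by simp, ?_, by simp⟩
    exact (Frame.setBits ((Frame.refl _ s).tick 1) (by simp) 0 _).tick 1
  refine Runs.seq (runs_ite (key true) (key false)) ?_
  rintro s' ⟨h1, h2, h3, h4⟩
  refine runs_pop _ _ ⟨by simp [h1], by simp [hab.symm, h2], ?_, by simp [h4]⟩
  exact (h3.setBits (by simp) 0 _).tick 1

theorem runs_transferLoop {x : Addr} {a b : ℕ} (hab : a ≠ b) (s : Store) :
    Runs (.loop x (transferCmd a b)) s fun s' =>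
      s'.bits (b, 0) = ((s.bits (a, 0)).takeD (s.bits (s.loc x)).length false).reverse ++
        s.bits (b, 0) ∧ Frame {a, b} s s' ∧ s'.time = s.time + 1 + 4 * (s.bits (s.loc x)).length := by
  -- The loop moves one bit per round, so the padded prefix has to be extended at its end, with `0`
  -- once the string is exhausted.
  have htake : ∀ (l : List Bool) (j : ℕ),
      l.takeD (j + 1) false = l.takeD j false ++ [(l.drop j).headD false] := by
    intro l j
    induction j generalizing l with
    | zero => cases l <;> simp
    | succ j ih =>
      cases l with
      | nil => rw [List.takeD_succ, List.tail_nil, ih]; simp [← List.replicate_succ', ← List.replicate_succ]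
      | cons v l => rw [List.takeD_succ, List.tail_cons, ih]; simp
  refine Runs.mono (Runs.loop (fun j s' => s'.bits (a, 0) = (s.bits (a, 0)).drop j ∧
    s'.bits (b, 0) = ((s.bits (a, 0)).takeD j false).reverse ++ s.bits (b, 0) ∧
    Frame {a, b} s s' ∧ s'.time = s.time + 1 + 4 * j) ?_ ⟨rfl, by simp, Frame.refl _ _, rfl⟩) ?_
  · rintro j - s' ⟨h1, h2, h3, h4⟩
    refine (runs_transfer hab _).mono ?_
    rintro s'' ⟨e1, e2, e3, e4⟩
    refine ⟨?_, ?_, h3.trans (e3 : Frame _ s' s'') subset_rfl subset_rfl, ?_⟩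
    · rw [e1, Store.bits_tick, h1, List.tail_drop]
    · rw [e2, Store.bits_tick, h1, h2, htake]
      simp
    · rw [e4, Store.time_tick, h4]
      omega
  · rintro s' ⟨-, h⟩
    exact h

/-- Two transfers restore the order, and pad or cut off the string. -/
theorem takeD_reverse_takeD (l : List Bool) (n : ℕ) :
    ((l.takeD n false).reverse.takeD n false).reverse = l.takeD n false := by
  have : (l.takeD n false).reverse.length = n := by simp
  conv_lhs => rw [List.takeD_eq_take _ this.ge, List.take_of_length_le this.le,
    List.reverse_reverse]

/-! ### Random numbers -/

/-- Push a random bit on register `9`. -/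
def coinCmd : Cmd :=
  .seq (.qnew (.scalar 9)) (.seq (.had (.scalar 9)) (.meas (.scalar 9) (.scalar 9)))

/-- The new qubit is pushed and then removed by the measurement, so only the classical stack `9` and
the clock change. Old coin bits pile up below and are never read. -/
theorem exec_coinCmd (s : Store) :
    coinCmd.exec s = QM.flip >>= fun b => pure ((s.setBits (9, 0) (b :: s.bits (9, 0))).tick 3) := by
  have hs : ∀ (q : ℕ) (b : Bool),
      (((((s.setQubits (9, 0) (q :: s.qubits (9, 0))).tick 1).tick 1).setQubits
      (9, 0) (s.qubits (9, 0))).setBits (9, 0) (b :: s.bits (9, 0))).tick 1 =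
      (s.setBits (9, 0) (b :: s.bits (9, 0))).tick 3 := by
    intro q b
    simp [Store.setQubits, Store.setBits, Store.tick]
  simp only [coinCmd, Cmd.exec, QM.flip, bind_assoc, pure_bind, Store.loc, Store.qubits_tick,
    Store.qubits_setQubits, if_true, Store.bits_tick, Store.bits_setQubits, hs]

/-- One round of sampling. Register `5` holds the bound, `7` the size of the range, and `8` the
number. -/
def sampleRoundCmd : Cmd :=
  .seq (.copy (.scalar 5) (.scalar 6)) (.seq (.loop (.scalar 7) (.pop (.scalar 6)))
    (.ite (.scalar 6)
      (.seq coinCmd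
        (.seq (.copy (.scalar 8) (.scalar 6)) (.seq (.loop (.scalar 6) (.push true (.scalar 8)))
          (.seq (.ite (.scalar 9) (.push true (.scalar 8)) (.pop (.scalar 6)))
            (.seq (.copy (.scalar 7) (.scalar 6)) (.loop (.scalar 6) (.push true (.scalar 7))))))))
      (.pop (.scalar 6))))

/-- The state of the sampling program. -/
structure SampleInv (s₀ : Store) (r j : ℕ) (s : Store) (p : ℕ × ℕ) : Prop where
  bound : s.Unary 5 r
  range : s.Unary 7 p.1
  value : s.Unary 8 p.2
  lt : p.2 < p.1
  le : p.1 ≤ 2 * r + 1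
  frame : Frame {6, 7, 8, 9} s₀ s
  time : s.time ≤ s₀.time + 2 + j * (18 * r + 36)

theorem lift_sampleRound {s₀ s : Store} {r j : ℕ} {p : ℕ × ℕ} (h : SampleInv s₀ r j s p) :
    Lift Eq (SampleInv s₀ r (j + 1)) (sampleRoundCmd.exec (s.tick 1)) (sampleRound r p) := by
  obtain ⟨h5, h7, h8, hlt, hle, hfr, ht⟩ := h
  refine Runs.lift_seq (R := fun t => t.Unary 5 r ∧ t.Unary 6 r ∧ t.Unary 7 p.1 ∧ t.Unary 8 p.2 ∧
    Frame {6, 7, 8, 9} s₀ t ∧ t.time ≤ s.time + 2 + r) (runs_copy _ _ _ ⟨?_, ?_, ?_, ?_, ?_, ?_⟩) ?_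
  · simpa [Store.Unary, Store.loc] using h5
  · simpa [Store.Unary, Store.loc] using h5
  · simpa [Store.Unary, Store.loc] using h7
  · simpa [Store.Unary, Store.loc] using h8
  · exact (Frame.setBits (hfr.tick 1) (by simp) 0 _).tick _
  · have := h5.length
    simp [Store.loc, this]
    omega
  rintro t ⟨a5, a6, a7, a8, afr, at'⟩
  refine Runs.lift_seq (runs_subLoop a6) ?_
  rintro t₁ ⟨b6, bfr, bt⟩
  replace bt : t₁.time = t.time + 1 + 2 * p.1 := by rw [bt, Store.loc, a7.length]
  replace b6 : t₁.Unary 6 (r - p.1) := by rwa [Store.loc, a7.length] at b6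
  have b5 := a5.frame bfr (by simp)
  have b7 := a7.frame bfr (by simp)
  have b8 := a8.frame bfr (by simp)
  have bfr' : Frame {6, 7, 8, 9} s₀ t₁ := afr.trans bfr subset_rfl (by simp)
  -- Comparison by truncated subtraction: a bit is left in register `6` exactly if the range is
  -- still smaller than the bound.
  have hcond : (t₁.bits (t₁.loc (.scalar 6))).headD false = decide (p.1 < r) := by
    rw [Store.loc, b6, headD_replicate, decide_eq_decide]
    omega
  rw [Cmd.exec_ite, hcond, sampleRound]
  by_cases hr : p.1 < r
  · simp only [hr, decide_true, if_true]
    rw [Cmd.exec_seq, exec_coinCmd, bind_assoc]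
    simp only [pure_bind]
    refine Lift.bind (R := Eq) ?_ ?_
    · rintro g _ rfl
      rw [List.forall₂_same]
      exact fun o _ => ⟨rfl, rfl⟩
    rintro b _ rfl
    set t₂ := ((t₁.tick 1).setBits (9, 0) (b :: (t₁.tick 1).bits (9, 0))).tick 3 with ht₂
    have c5 : t₂.Unary 5 r := by simpa [ht₂, Store.Unary] using b5
    have c7 : t₂.Unary 7 p.1 := by simpa [ht₂, Store.Unary] using b7
    have c8 : t₂.Unary 8 p.2 := by simpa [ht₂, Store.Unary] using b8
    have c9 : (t₂.bits (9, 0)).headD false = b := by simp [ht₂]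
    have cfr : Frame {6, 7, 8, 9} s₀ t₂ :=
      (Frame.setBits (bfr'.tick 1) (by simp) 0 _).tick _
    have ct : t₂.time = t₁.time + 4 := by simp [ht₂]
    clear_value t₂
    -- Once the coin has been thrown, the update of the two numbers is deterministic.
    suffices H : Runs (.seq (.copy (.scalar 8) (.scalar 6))
        (.seq (.loop (.scalar 6) (.push true (.scalar 8)))
          (.seq (.ite (.scalar 9) (.push true (.scalar 8)) (.pop (.scalar 6)))
            (.seq (.copy (.scalar 7) (.scalar 6)) (.loop (.scalar 6) (.push true (.scalar 7)))))))
        t₂ (fun t => SampleInv s₀ r (j + 1) t (2 * p.1, 2 * p.2 + b.toNat)) by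
      obtain ⟨t', e, h⟩ := H
      rw [e]
      exact Lift.pure h
    refine Runs.seq (R := fun t => t.Unary 5 r ∧ t.Unary 6 p.2 ∧ t.Unary 7 p.1 ∧ t.Unary 8 p.2 ∧
      (t.bits (9, 0)).headD false = b ∧ Frame {6, 7, 8, 9} s₀ t ∧ t.time = t₂.time + 1 + p.2)
      (runs_copy _ _ _ ⟨?_, ?_, ?_, ?_, ?_, ?_, ?_⟩) ?_
    · simpa [Store.Unary, Store.loc] using c5
    · simpa [Store.Unary, Store.loc] using c8
    · simpa [Store.Unary, Store.loc] using c7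
    · simpa [Store.Unary, Store.loc] using c8
    · simpa [Store.loc] using c9
    · exact (Frame.setBits cfr (by simp) 0 _).tick _
    · have := c8.length
      simp [Store.loc, this]
      omega
    rintro t₃ ⟨d5, d6, d7, d8, d9, dfr, dt⟩
    refine Runs.seq (runs_addLoop d8) ?_
    rintro t₄ ⟨e8, efr, et⟩
    rw [Store.loc, d6.length] at e8 et
    have e5 := d5.frame efr (by simp)
    have e7 := d7.frame efr (by simp)
    have e9 : (t₄.bits (9, 0)).headD false = b := by rw [efr.bits (by simp), d9]
    have efr' : Frame {6, 7, 8, 9} s₀ t₄ := dfr.trans efr subset_rfl (by simp)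
    refine Runs.seq (R := fun t => t.Unary 5 r ∧ t.Unary 7 p.1 ∧ t.Unary 8 (2 * p.2 + b.toNat) ∧
      Frame {6, 7, 8, 9} s₀ t ∧ t.time = t₄.time + 2)
      (runs_ite (fun hb => ?_) (fun hb => ?_)) ?_
    · have hb' : b = true := by rw [← e9]; exact hb
      refine runs_push _ _ _ ⟨?_, ?_, ?_, ?_, ?_⟩
      · simpa [Store.Unary] using e5
      · simpa [Store.Unary] using e7
      · have := (show (t₄.tick 1).Unary 8 _ from e8).push 1
        rwa [show p.2 + p.2 + 1 = 2 * p.2 + b.toNat by rw [hb', Bool.toNat_true]; omega] at this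
      · exact (Frame.setBits (efr'.tick 1) (by simp) 0 _).tick _
      · simp
    -- The `pop` of the scratch register `6` is merely a filler for an empty branch.
    · have hb' : b = false := by rw [← e9]; exact hb
      refine runs_pop _ _ ⟨?_, ?_, ?_, ?_, ?_⟩
      · simpa [Store.Unary] using e5
      · simpa [Store.Unary] using e7
      · rw [hb', Bool.toNat_false, add_zero, two_mul]
        simpa [Store.Unary] using e8
      · exact (Frame.setBits (efr'.tick 1) (by simp) 0 _).tick _
      · simp
    rintro t₅ ⟨f5, f7, f8, ffr, ft⟩
    refine Runs.seq (R := fun t => t.Unary 5 r ∧ t.Unary 6 p.1 ∧ t.Unary 7 p.1 ∧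
      t.Unary 8 (2 * p.2 + b.toNat) ∧ Frame {6, 7, 8, 9} s₀ t ∧ t.time = t₅.time + 1 + p.1)
      (runs_copy _ _ _ ⟨?_, ?_, ?_, ?_, ?_, ?_⟩) ?_
    · simpa [Store.Unary, Store.loc] using f5
    · simpa [Store.Unary, Store.loc] using f7
    · simpa [Store.Unary, Store.loc] using f7
    · simpa [Store.Unary, Store.loc] using f8
    · exact (Frame.setBits ffr (by simp) 0 _).tick _
    · have := f7.length
      simp [Store.loc, this]
      omega
    rintro t₆ ⟨g5, g6, g7, g8, gfr, gt⟩
    refine (runs_addLoop g7).mono ?_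
    rintro t₇ ⟨k7, kfr, kt⟩
    rw [Store.loc, g6.length] at k7 kt
    have hb : b.toNat ≤ 1 := Bool.toNat_le b
    exact ⟨g5.frame kfr (by simp), by rwa [two_mul], g8.frame kfr (by simp), by
      simp only
      omega, by
      simp only
      omega, gfr.trans kfr subset_rfl (by simp), by
      rw [add_mul, one_mul]
      omega⟩
  · simp only [hr, decide_false, Bool.false_eq_true, if_false]
    refine Lift.pure ⟨?_, ?_, ?_, hlt, hle, ?_, ?_⟩
    · simpa [Store.Unary, Store.loc] using b5
    · simpa [Store.Unary, Store.loc] using b7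
    · simpa [Store.Unary, Store.loc] using b8
    · exact (Frame.setBits (bfr'.tick 1) (by simp) 0 _).tick _
    · rw [add_mul, one_mul]
      simp only [Store.time_tick, Store.time_setBits]
      omega

/-- Sample a number. -/
def sampleCmd : Cmd := .seq (.push true (.scalar 7)) (.loop (.scalar 5) sampleRoundCmd)

theorem lift_sample {s : Store} {r : ℕ} (h5 : s.Unary 5 r) (h7 : s.bits (7, 0) = [])
    (h8 : s.bits (8, 0) = []) :
    Lift Eq (SampleInv s r r) (sampleCmd.exec s) (QM.iter (sampleRound r) r (1, 0)) := by
  refine Runs.lift_seq (R := fun t => SampleInv s r 0 (t.tick 1) (1, 0))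
    (runs_push _ _ _ (SampleInv.mk ?_ ?_ ?_ (by simp) (by simp) ?_ (by simp))) ?_
  · simpa [Store.Unary] using h5
  · simp [Store.Unary, h7]
  · simp [Store.Unary, h8]
  · exact Frame.tick ((Frame.setBits (Frame.refl _ s) (by simp) 0 _).tick 1) 1
  · intro t ht
    rw [Cmd.exec_loop, Store.loc_scalar, show (t.bits (5, 0)).length = r from ht.bound.length]
    exact Lift.iter_le r (fun j _ a b hab => lift_sampleRound hab) ht

/-! ### The bound -/

/-- Push `n` bits on register `5`. -/
def onesCmd : ℕ → Cmd
  | 0 => .wipe 5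
  | n + 1 => .seq (onesCmd n) (.push true (.scalar 5))

/-- Multiply register `5` by the length of register `0` plus one. -/
def mulCmd : Cmd :=
  .seq (.copy (.scalar 5) (.scalar 6)) (.loop (.scalar 0) (.loop (.scalar 6) (.push true (.scalar 5))))

/-- Write `c * (lam + 1) ^ d` to register `5`. -/
def boundCmd (c : ℕ) : ℕ → Cmd
  | 0 => onesCmd c
  | d + 1 => .seq (boundCmd c d) mulCmd

theorem runs_onesCmd (n : ℕ) (s : Store) :
    Runs (onesCmd n) s fun t => t.Unary 5 n ∧ Frame {5, 6} s t ∧ t.time = s.time + 1 + n := by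
  induction n with
  | zero =>
    refine runs_wipe _ _ fun t h1 h2 h3 => ⟨?_, h2.mono (by simp), h3⟩
    exact (h1 0).1
  | succ n ih =>
    refine ih.seq ?_
    rintro t ⟨h1, h2, h3⟩
    refine runs_push _ _ _ ⟨h1.push 1, (h2.setBits (by simp) 0 _).tick _, ?_⟩
    simp only [Store.time_tick, Store.time_setBits]
    omega

theorem runs_mulCmd {s : Store} {lam m : ℕ} (h0 : s.Unary 0 lam) (h5 : s.Unary 5 m) :
    Runs mulCmd s fun t => t.Unary 5 (m * (lam + 1)) ∧ Frame {5, 6} s t ∧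
      t.time = s.time + 2 + m + lam * (2 + 2 * m) := by
  refine Runs.seq (R := fun t => t.Unary 0 lam ∧ t.Unary 5 m ∧ t.Unary 6 m ∧ Frame {5, 6} s t ∧
    t.time = s.time + 1 + m) (runs_copy _ _ _ ⟨?_, ?_, ?_, ?_, ?_⟩) ?_
  · simpa [Store.Unary, Store.loc] using h0
  · simpa [Store.Unary, Store.loc] using h5
  · simpa [Store.Unary, Store.loc] using h5
  · exact (Frame.setBits (Frame.refl _ s) (by simp) 0 _).tick _
  · have := h5.length
    simp [Store.loc, this]
    omega
  rintro t ⟨a0, a5, a6, afr, at'⟩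
  have := Runs.loop (x := .scalar 0) (c := .loop (.scalar 6) (.push true (.scalar 5))) (s := t)
    (fun j t' => t'.Unary 5 (m * (j + 1)) ∧ t'.Unary 6 m ∧ Frame {5, 6} s t' ∧
      t'.time = s.time + 2 + m + j * (2 + 2 * m)) ?_ ⟨?_, a6, afr, ?_⟩
  · rw [Store.loc, a0.length] at this
    exact this.mono fun t' ⟨h1, _, h3, h4⟩ => ⟨h1, h3, h4⟩
  · rintro j - t' ⟨b5, b6, bfr, bt⟩
    refine (runs_addLoop (show (t'.tick 1).Unary 5 _ from b5)).mono ?_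
    rintro t'' ⟨c5, cfr, ct⟩
    rw [Store.loc, (show (t'.tick 1).Unary 6 _ from b6).length] at c5 ct
    refine ⟨by rwa [mul_add, mul_one], ?_, ?_, ?_⟩
    · exact (show (t'.tick 1).Unary 6 _ from b6).frame cfr (by simp)
    · exact Frame.trans (bfr.tick 1) cfr subset_rfl (by simp)
    · rw [ct, Store.time_tick, bt, add_mul, one_mul]
      omega
  · simpa [Store.Unary] using a5
  · simp only [Store.time_tick]
    omega

theorem runs_boundCmd {s : Store} {lam : ℕ} (h0 : s.Unary 0 lam) (c d : ℕ) :
    Runs (boundCmd c d) s fun t => t.Unary 5 (c * (lam + 1) ^ d) ∧ Frame {5, 6} s t ∧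
      t.time ≤ s.time + 1 + c + d * (2 + 3 * (c * (lam + 1) ^ d + 1) * (lam + 1)) := by
  induction d with
  | zero =>
    refine (runs_onesCmd c s).mono ?_
    rintro t ⟨h1, h2, h3⟩
    exact ⟨by simpa using h1, h2, by omega⟩
  | succ d ih =>
    refine ih.seq ?_
    rintro t ⟨h1, h2, h3⟩
    refine (runs_mulCmd (h0.frame h2 (by simp)) h1).mono ?_
    rintro t' ⟨e1, e2, e3⟩
    refine ⟨by rwa [pow_succ, ← mul_assoc], h2.trans e2 subset_rfl subset_rfl, ?_⟩
    -- All earlier multiplications are charged at the size of the latest product, which keeps the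
    -- time bound in closed form.
    have hle : c * (lam + 1) ^ d ≤ c * (lam + 1) ^ (d + 1) :=
      Nat.mul_le_mul_left _ (Nat.pow_le_pow_right (by omega) (by omega))
    set u := c * (lam + 1) ^ d
    set v := c * (lam + 1) ^ (d + 1)
    have h4 : d * (2 + 3 * (u + 1) * (lam + 1)) ≤ d * (2 + 3 * (v + 1) * (lam + 1)) := by gcongr
    have h5 : 2 + u + lam * (2 + 2 * u) ≤ 2 + 3 * (v + 1) * (lam + 1) := by nlinarith
    rw [e3, add_mul, one_mul]
    omega

end

section

open QM

theorem QM.Lift.bind_pure_right {α β γ : Type} {Q : QState → QState → Prop} {R : α → β → Prop}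
    {T : α → γ → Prop} {m : QM α} {m' : QM β} {φ : β → γ} (h : Lift Q R m m')
    (hφ : ∀ a b, R a b → T a (φ b)) : Lift Q T m (m' >>= fun b => Pure.pure (φ b)) := by
  rw [← bind_pure m]
  exact h.bind fun a b hab => Lift.pure (hφ a b hab)

/-! ### Simulation of programs -/

/-- The registers of `s` with names `f 0`, …, `f (k - 1)` are those of `t` with names below `k`. -/
def Agree (f : ℕ → ℕ) (k : ℕ) (s t : Store) : Prop :=
  ∀ a < k, ∀ i, s.bits (f a, i) = t.bits (a, i) ∧ s.qubits (f a, i) = t.qubits (a, i)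

namespace Agree

variable {f : ℕ → ℕ} {k : ℕ} {s t : Store}

theorem frame (h : Agree f k s t) {X : Set ℕ} {s' : Store} (hf : Frame X s s')
    (hX : ∀ a, f a ∉ X) : Agree f k s' t := fun a ha i =>
  ⟨(hf.bits (hX a) i).trans (h a ha i).1, (hf.qubits (hX a) i).trans (h a ha i).2⟩

theorem setBits (h : Agree f k s t) (hf : f.Injective) (a i : ℕ) (l : List Bool) :
    Agree f k (s.setBits (f a, i) l) (t.setBits (a, i) l) := fun b hb j => by
  have : (f b, j) = (f a, i) ↔ (b, j) = (a, i) := by simp [hf.eq_iff]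
  simp only [Store.bits_setBits, Store.qubits_setBits, this, (h b hb j).1, (h b hb j).2, and_self]

theorem setQubits (h : Agree f k s t) (hf : f.Injective) (a i : ℕ) (l : List ℕ) :
    Agree f k (s.setQubits (f a, i) l) (t.setQubits (a, i) l) := fun b hb j => by
  have : (f b, j) = (f a, i) ↔ (b, j) = (a, i) := by simp [hf.eq_iff]
  simp only [Store.bits_setQubits, Store.qubits_setQubits, this, (h b hb j).1, (h b hb j).2,
    and_self]

theorem tick (h : Agree f k s t) (n : ℕ) : Agree f k (s.tick n) t := h

/-- Running a renamed program inside a larger machine. The quantum state is the same on both sides,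
and the time statement is written with sums to avoid subtraction of natural numbers. -/
theorem lift_exec (h : Agree f k s t) (hf : f.Injective) {c : Cmd} (hc : c.Uses (Set.Iio k)) :
    Lift Eq (fun s' t' => Agree f k s' t' ∧ Frame (Set.range f) s s' ∧
      s'.time + t.time = t'.time + s.time) ((c.rename f).exec s) (c.exec t) := by
  have hr : StoreRel f (Set.Iio k) id s s.time t.time s t :=
    ⟨fun a ha i => (h a ha i).1, fun a ha i => by rw [List.map_id, (h a ha i).2],
      fun _ _ => rfl, fun _ _ => rfl, by omega⟩
  refine (Cmd.exec_lift hf.injOn Bisim.eq hc hr).mono fun s' t' h' => ⟨?_, ?_, h'.time⟩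
  · exact fun a ha i => ⟨h'.bits a ha i, by rw [h'.qubits a ha i, List.map_id]⟩
  · exact fun r hr => ⟨h'.frame_bits r fun a _ e => hr ⟨a, e⟩,
      h'.frame_qubits r fun a _ e => hr ⟨a, e⟩⟩

end Agree

theorem Store.setBitsArray_nil (s : Store) (a : ℕ) : s.setBitsArray a [] = s := by
  simp [Store.setBitsArray]

theorem Store.setQubitsArray_nil (s : Store) (a : ℕ) : s.setQubitsArray a [] = s := by
  simp [Store.setQubitsArray]

theorem Store.setBitsArray_append (s : Store) (a : ℕ) (l : List (List Bool)) (v : List Bool) :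
    s.setBitsArray a (l ++ [v]) = (s.setBitsArray a l).setBits (a, l.length) v := by
  simp only [Store.setBitsArray, Store.setBits, Store.mk.injEq, and_true]
  funext ⟨b, i⟩
  simp only [Function.update_apply, Prod.mk.injEq, List.length_append, List.length_singleton]
  by_cases hb : b = a
  · rcases lt_trichotomy i l.length with h | rfl | h
    · simp only [hb, true_and, h.ne, if_false, h, if_true, h.trans (Nat.lt_succ_self _)]
      rw [List.getD_append _ _ _ _ h]
    · simp [hb]
    · simp [hb, h.ne', h.not_gt, (Nat.succ_le_of_lt h).not_gt]
  · simp [hb]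

theorem Store.setQubitsArray_append (s : Store) (a : ℕ) (l : List (List ℕ)) (v : List ℕ) :
    s.setQubitsArray a (l ++ [v]) = (s.setQubitsArray a l).setQubits (a, l.length) v := by
  simp only [Store.setQubitsArray, Store.setQubits, Store.mk.injEq, and_true, true_and]
  funext ⟨b, i⟩
  simp only [Function.update_apply, Prod.mk.injEq, List.length_append, List.length_singleton]
  by_cases hb : b = a
  · rcases lt_trichotomy i l.length with h | rfl | h
    · simp only [hb, true_and, h.ne, if_false, h, if_true, h.trans (Nat.lt_succ_self _)]
      rw [List.getD_append _ _ _ _ h]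
    · simp [hb]
    · simp [hb, h.ne', h.not_gt, (Nat.succ_le_of_lt h).not_gt]
  · simp [hb]

/-- The names of the registers of the simulated adversary. -/
def advName (a : ℕ) : ℕ := 2 * a + 20

/-- The names of the registers of the simulated encryption scheme. -/
def encName (a : ℕ) : ℕ := 2 * a + 21

theorem advName_injective : advName.Injective := fun a b h => by
  unfold advName at h
  omega

theorem encName_injective : encName.Injective := fun a b h => by
  unfold encName at h
  omega

theorem notMem_range_encName {a : ℕ} (h : a < 20) : a ∉ Set.range encName := by
  rintro ⟨b, rfl⟩
  unfold encName at h
  omega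

theorem notMem_range_advName {a : ℕ} (h : a < 20) : a ∉ Set.range advName := by
  rintro ⟨b, rfl⟩
  unfold advName at h
  omega

theorem advName_notMem_range (a : ℕ) : advName a ∉ Set.range encName := by
  rintro ⟨b, h⟩
  unfold advName encName at h
  omega

theorem advName_ne {a b : ℕ} (h : b < 20) : advName a ≠ b := by
  unfold advName
  omega

/-- Empty the registers with names `encName 0`, …, `encName (k - 1)`. -/
def wipeAllCmd : ℕ → Cmd
  | 0 => .wipe (encName 0)
  | k + 1 => .seq (wipeAllCmd k) (.wipe (encName k))

/-- Each call of `KeyGen` or `Enc` must start from empty memory although earlier calls used the same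
registers. Wiped qubits stay in the joint state, just as after an honest run. -/
theorem runs_wipeAllCmd (k : ℕ) (s : Store) :
    Runs (wipeAllCmd k) s fun t => Agree encName k t Store.blank ∧
      Frame (Set.range encName) s t ∧ t.time = s.time + 1 + k := by
  have hsub : ∀ a, {encName a} ⊆ Set.range encName := fun a => by simp
  induction k with
  | zero => exact runs_wipe _ _ fun t _ h2 h3 => ⟨fun a ha => by omega, h2.mono (hsub 0), h3⟩
  | succ k ih =>
    refine ih.seq ?_
    rintro t ⟨h1, h2, h3⟩
    refine runs_wipe _ _ fun t' e1 e2 e3 =>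
      ⟨fun a ha i => ?_, h2.trans e2 subset_rfl (hsub k), by omega⟩
    by_cases hak : a = k
    · subst hak
      exact e1 i
    · have hne : encName a ∉ ({encName k} : Set ℕ) := by simpa [encName_injective.eq_iff] using hak
      rw [e2.bits hne, e2.qubits hne]
      exact h1 a (by omega) i

theorem Polynomial.eval_mono_nat (p : Polynomial ℕ) {a b : ℕ} (h : a ≤ b) : p.eval a ≤ p.eval b := by
  rw [Polynomial.eval_eq_sum_range, Polynomial.eval_eq_sum_range]
  gcongr

theorem Polynomial.exists_eval_le_pow (p : Polynomial ℕ) :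
    ∃ c d : ℕ, ∀ n, p.eval n ≤ c * (n + 1) ^ d := by
  induction p using Polynomial.induction_on' with
  | add p q hp hq =>
    obtain ⟨c, d, h⟩ := hp
    obtain ⟨c', d', h'⟩ := hq
    refine ⟨c + c', d + d', fun n => ?_⟩
    have h1 : (n + 1) ^ d ≤ (n + 1) ^ (d + d') := Nat.pow_le_pow_right (by omega) (by omega)
    have h2 : (n + 1) ^ d' ≤ (n + 1) ^ (d + d') := Nat.pow_le_pow_right (by omega) (by omega)
    rw [Polynomial.eval_add, add_mul]
    exact add_le_add ((h n).trans (Nat.mul_le_mul_left _ h1))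
      ((h' n).trans (Nat.mul_le_mul_left _ h2))
  | monomial k a =>
    refine ⟨a, k, fun n => ?_⟩
    rw [Polynomial.eval_monomial]
    gcongr
    omega

/-! ### The reduction -/

/-- Bounds for the names and the running times of the programs that the reduction simulates. -/
structure Reduction (P : PKE) (A : MKCPAAdversary) where
  names : ℕ
  lt_names : 5 < names
  uses_keyGen : P.keyGen.Uses (Set.Iio names)
  uses_enc : P.enc.Uses (Set.Iio names)
  uses_count : A.count.Uses (Set.Iio names)
  uses_choose : A.choose.Uses (Set.Iio names)
  uses_guess : A.guess.Uses (Set.Iio names)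
  keyTime : Polynomial ℕ
  keyGen_halts : ∀ lam, P.keyGen.HaltsWithin (Store.init lam) (keyTime.eval lam)
  encTime : Polynomial ℕ
  enc_halts : ∀ (lam : ℕ) (pk m : List Bool),
    P.enc.HaltsWithin (encInput lam pk m) (encTime.eval (lam + pk.length + m.length))
  advTime : Polynomial ℕ
  adv_halts : ∀ (lam : ℕ) (g : QState), ∀ o ∈ A.count.exec (Store.init lam) g,
    o.1.time ≤ advTime.eval lam ∧
    ∀ (pks : List (List Bool)) (g' : QState), pks.length = (o.1.bits (1, 0)).length →
      ∀ o' ∈ A.choose.exec (o.1.setBitsArray 2 pks) g',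
        o'.1.time ≤ advTime.eval (lam + (pks.map List.length).sum) ∧
        ∀ cts : List (List ℕ), cts.length = (o.1.bits (1, 0)).length →
          A.guess.HaltsWithin (o'.1.setQubitsArray 0 cts)
            (advTime.eval (lam + (pks.map List.length).sum + (cts.map List.length).sum))
  coeff : ℕ
  deg : ℕ
  le_bound : ∀ lam, lam + advTime.eval lam ≤ coeff * (lam + 1) ^ deg

theorem Reduction.exists (P : PKE) (A : MKCPAAdversary) : Nonempty (Reduction P A) := by
  obtain ⟨k₁, h₁⟩ := P.keyGen.exists_uses
  obtain ⟨k₂, h₂⟩ := P.enc.exists_uses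
  obtain ⟨k₃, h₃⟩ := A.count.exists_uses
  obtain ⟨k₄, h₄⟩ := A.choose.exists_uses
  obtain ⟨k₅, h₅⟩ := A.guess.exists_uses
  obtain ⟨p, hp⟩ := P.keyGen_polyTime
  obtain ⟨q, hq⟩ := P.enc_polyTime
  obtain ⟨t, ht⟩ := A.polyTime
  -- The number of keys is the length of a register, which is bounded by the input length plus the
  -- running time; hence the summand `X`.
  obtain ⟨c, d, hcd⟩ := Polynomial.exists_eval_le_pow (Polynomial.X + t)
  have hsub : ∀ k ≤ k₁ + k₂ + k₃ + k₄ + k₅ + 6,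
      Set.Iio k ⊆ Set.Iio (k₁ + k₂ + k₃ + k₄ + k₅ + 6) := fun k hk => Set.Iio_subset_Iio hk
  exact ⟨⟨k₁ + k₂ + k₃ + k₄ + k₅ + 6, by omega, h₁.mono (hsub _ (by omega)),
    h₂.mono (hsub _ (by omega)), h₃.mono (hsub _ (by omega)), h₄.mono (hsub _ (by omega)),
    h₅.mono (hsub _ (by omega)), p, hp, q, hq, t, ht, c, d, by simpa using hcd⟩⟩

namespace Reduction

variable {P : PKE} {A : MKCPAAdversary} (R : Reduction P A)

/-- The number of keys from which the reduction chooses one (before rounding). -/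
def bound (x : ℕ) : ℕ := R.coeff * (x + 1) ^ R.deg

/-- Throughout, `x` is a common bound for `lam` and the lengths of what the challenger has sent. The
last summand allows for the challenger's key, the others for keys generated by the reduction. -/
noncomputable def keyLen (x : ℕ) : ℕ := x + R.keyTime.eval x + x

noncomputable def numKeys (x : ℕ) : ℕ := x + R.advTime.eval x

noncomputable def keySum (x : ℕ) : ℕ := R.numKeys x * R.keyLen x

noncomputable def advEnd (x : ℕ) : ℕ := R.advTime.eval (x + R.keySum x)

noncomputable def regLen (x : ℕ) : ℕ := R.numKeys x + R.keySum x + R.advEnd x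

noncomputable def encEnd (x : ℕ) : ℕ := R.encTime.eval (x + R.keyLen x + x)

/-- The last summand allows for the challenge ciphertext; the others are input lengths and running
time of an encryption made by the reduction. -/
noncomputable def ctLen (x : ℕ) : ℕ := x + R.keyLen x + x + R.encEnd x + x

noncomputable def ctSum (x : ℕ) : ℕ := R.numKeys x * R.ctLen x

noncomputable def guessEnd (x : ℕ) : ℕ := R.advTime.eval (x + R.keySum x + R.ctSum x)

noncomputable def keyStepTime (x : ℕ) : ℕ :=
  R.names + x + R.keyTime.eval x + 2 * R.keyLen x + 12

noncomputable def encStepTime (x : ℕ) : ℕ :=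
  R.names + R.regLen x + 10 * x + R.keyLen x + R.encEnd x + R.ctLen x + 16

noncomputable def startTime (x : ℕ) : ℕ :=
  1 + R.coeff + R.deg * (2 + 3 * (R.bound x + 1) * (x + 1)) +
    (R.bound x * (18 * R.bound x + 36) + 2) + (1 + x)

noncomputable def keysTime (x : ℕ) : ℕ :=
  (1 + R.numKeys x) + (2 * R.bound x + 2) + 1 + R.numKeys x * R.keyStepTime x

noncomputable def chooseTime (x : ℕ) : ℕ :=
  R.startTime x + R.advEnd x + R.keysTime x + R.advEnd x + 2 * (1 + R.regLen x)

noncomputable def guessTime (x : ℕ) : ℕ :=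
  R.chooseTime x + (1 + x) + 2 + (2 * R.bound x + 2) + 1 + R.numKeys x * R.encStepTime x +
    R.guessEnd x + 2

/-! #### Keys -/

/-- Generate a key pair. -/
def keyCmd : Cmd :=
  .seq (wipeAllCmd R.names) (.seq (.copy (.scalar 0) (.scalar (encName 0)))
    (P.keyGen.rename encName))

/-- The wiped registers together with a copy of `1^lam` form the honest input of `KeyGen`, so its
time bound applies and also limits the length of the key. -/
theorem lift_keyCmd {s : Store} {lam : ℕ} (h0 : s.Unary 0 lam) :
    Lift Eq (fun t (pk : List Bool) => t.bits (encName 2, 0) = pk ∧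
      pk.length ≤ lam + R.keyTime.eval lam ∧ Frame (Set.range encName) s t ∧
      t.time ≤ s.time + (R.names + 2 + lam + R.keyTime.eval lam))
      (R.keyCmd.exec s) (P.pubKey lam) := by
  refine Runs.lift_seq (runs_wipeAllCmd _ _) ?_
  rintro t ⟨h1, h2, h3⟩
  have t0 := h0.frame h2 (notMem_range_encName (by omega))
  refine Runs.lift_seq (R := fun t' => Agree encName R.names t' (Store.init lam) ∧
    Frame (Set.range encName) s t' ∧ t'.time = s.time + (R.names + 2 + lam))
    (runs_copy _ _ _ ⟨?_, ?_, ?_⟩) ?_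
  · have := h1.setBits encName_injective 0 0 (List.replicate lam true)
    rw [Store.loc_scalar, Store.loc_scalar, t0]
    exact this.tick _
  · exact (h2.setBits (by simp) 0 _).tick _
  · simp only [Store.time_tick, Store.time_setBits, Store.loc_scalar, t0.length]
    omega
  rintro t' ⟨e1, e2, e3⟩
  have := (e1.lift_exec encName_injective R.uses_keyGen).and_mem
    (p := fun u => u.time ≤ R.keyTime.eval lam ∧ u.LengthLE (lam + u.time)) fun g o ho =>
      ⟨R.keyGen_halts lam g o ho, Cmd.lengthLE ho fun r => by
        simp only [Store.init, Store.bits_setBits, Store.qubits_setBits, Store.blank]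
        split <;> simp⟩
  simp only [PKE.pubKey, PKE.runKeyGen, bind_assoc, pure_bind]
  refine this.bind_pure_right ?_
  rintro u v ⟨⟨f1, f2, f3⟩, f4, f5⟩
  have hu := (f1 2 (by have := R.lt_names; omega) 0).1
  have h0' : (Store.init lam).time = 0 := rfl
  refine ⟨hu, (f5 (2, 0)).1.trans (by omega), e2.trans f2 subset_rfl subset_rfl, by omega⟩

end Reduction

end

section

open QM

namespace Reduction

variable {P : PKE} {A : MKCPAAdversary} (R : Reduction P A)

/-- Generate a key pair and store the public key. -/
def ownKeyCmd : Cmd := .seq R.keyCmd (.copy (.scalar (encName 2)) (.cell 14 11))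

/-- One round of the generation of the keys. Register `1` holds the key of the challenger, `11` the
number of the round, `12` the number of rounds before the one in which that key is used, and `13`
whether it has been used. -/
def keyStepCmd : Cmd :=
  .seq (.ite (.scalar 12) (.seq (.pop (.scalar 12)) R.ownKeyCmd)
    (.ite (.scalar 13) R.ownKeyCmd
      (.seq (.push true (.scalar 13)) (.copy (.scalar 1) (.cell 14 11)))))
    (.seq (.copy (.cell 14 11) (.cell (advName 2) 11)) (.push true (.scalar 11)))

/-- Key `a` has been stored at position `j`. -/
structure KeyStored (X : Set ℕ) (j T L : ℕ) (s t : Store) (a : List Bool) : Prop where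
  key : t.bits (14, j) = a
  other : ∀ k ≠ j, t.bits (14, k) = s.bits (14, k)
  length : a.length ≤ L
  frame : Frame X s t
  time : t.time ≤ s.time + T

/-- The state of the program after the first `j` rounds of the generation of the keys. -/
structure KeyInv (lam i num L T : ℕ) (pk : List Bool) (s₀ : Store) (j : ℕ) (s : Store)
    (l : List (List Bool)) : Prop where
  lam : s.Unary 0 lam
  pk : s.bits (1, 0) = pk
  idx : s.Unary 8 i
  num : (s.bits (10, 0)).length = num
  pos : s.Unary 11 j
  rem : s.Unary 12 (i - j)
  flag : s.Unary 13 (if i < j then 1 else 0)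
  keys : ∀ k < j, s.bits (14, k) = l.getD k []
  len : l.length = j
  lens : ∀ k ∈ l, k.length ≤ L
  agree : Agree advName R.names s (s₀.setBitsArray 2 l)
  time : s.time ≤ T

/-- Register `12` counts down to the special position, and flag `13` tells that position, where the
countdown has just ended, from those after it. Each key is stored twice: in array `14` for later
encryptions and in the adversary's input array. -/
theorem lift_keyStep {lam x i num T : ℕ} {pk : List Bool} {s₀ : Store} {j : ℕ} {s : Store}
    {l : List (List Bool)} (hx : lam ≤ x) (hpk : pk.length ≤ x)
    (h : R.KeyInv lam i num (R.keyLen x) T pk s₀ j s l) :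
    Lift Eq (fun t a => R.KeyInv lam i num (R.keyLen x) (T + R.keyStepTime x) pk s₀ (j + 1) t
      (l ++ [a])) (R.keyStepCmd.exec (s.tick 1)) (keyAt P lam pk i j) := by
  have hpk' : pk.length ≤ R.keyLen x := by
    unfold keyLen
    omega
  set X : Set ℕ := Set.range encName ∪ {12, 13, 14} with hX
  have hnot : ∀ a < 12, a ∉ X := by
    intro a ha
    have := notMem_range_encName (a := a) (by omega)
    simp only [hX, Set.mem_union, this, Set.mem_insert_iff, Set.mem_singleton_iff, false_or]
    omega
  have hadv : ∀ a, advName a ∉ X := by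
    intro a
    simp only [hX, Set.mem_union, advName_notMem_range, Set.mem_insert_iff,
      Set.mem_singleton_iff, advName_ne (show 12 < 20 by omega),
      advName_ne (show 13 < 20 by omega), advName_ne (show 14 < 20 by omega), or_self,
      not_false_eq_true]
  obtain ⟨n, hn⟩ : ∃ n, n = if i < j + 1 then 1 else 0 := ⟨_, rfl⟩
  refine lift_seq_runs (R := fun t a => KeyStored X j
    (R.names + x + R.keyTime.eval x + R.keyLen x + 7) (R.keyLen x) s t a ∧
    t.Unary 12 (i - (j + 1)) ∧ t.Unary 13 n) ?_ ?_
  -- Common to the positions before and after `i`; four steps are reserved for the tests and the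
  -- countdown that precede it.
  · have hown : ∀ t : Store, Frame X s t → (∀ k, t.bits (14, k) = s.bits (14, k)) →
        t.time ≤ s.time + 4 → t.Unary 12 (i - (j + 1)) →
        t.Unary 13 n →
        Lift Eq (fun t a => KeyStored X j
          (R.names + x + R.keyTime.eval x + R.keyLen x + 7) (R.keyLen x) s t a ∧
          t.Unary 12 (i - (j + 1)) ∧ t.Unary 13 n)
          (R.ownKeyCmd.exec t) (P.pubKey lam) := by
      intro t hf h14 ht h12 h13
      have t0 := h.lam.frame hf (hnot 0 (by omega))
      have t11 := h.pos.frame hf (hnot 11 (by omega))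
      refine lift_seq_runs (R.lift_keyCmd t0) ?_
      rintro t' pk' ⟨e1, e2, e3, e4⟩
      have t11' := t11.frame e3 (notMem_range_encName (by omega))
      have hk := Polynomial.eval_mono_nat R.keyTime hx
      have hL : pk'.length ≤ R.keyLen x := by
        unfold keyLen
        omega
      have hloc : t'.loc (.cell 14 11) = (14, j) := by rw [Store.loc_cell, t11'.length]
      refine runs_copy _ _ _ ⟨⟨?_, ?_, hL, ?_, ?_⟩, ?_, ?_⟩
      · simp [hloc, e1]
      · intro k hk
        simp only [hloc, Store.bits_tick, Store.bits_setBits, Prod.mk.injEq, hk, and_false,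
          if_false]
        rw [e3.bits (notMem_range_encName (by omega)) k, h14]
      · rw [hloc]
        exact ((hf.trans e3 subset_rfl Set.subset_union_left).setBits (by simp [hX]) j _).tick _
      · simp only [Store.loc_scalar, e1, Store.time_tick, Store.time_setBits]
        omega
      · have := h12.frame e3 (notMem_range_encName (by omega))
        simpa [Store.Unary, hloc] using this
      · have := h13.frame e3 (notMem_range_encName (by omega))
        simpa [Store.Unary, hloc] using this
    have h12 : ((s.tick 1).bits ((s.tick 1).loc (.scalar 12))).headD false = decide (j < i) := by
      rw [Store.loc_scalar, Store.bits_tick, h.rem, headD_replicate, decide_eq_decide]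
      omega
    have h13 : (((s.tick 1).tick 1).bits (((s.tick 1).tick 1).loc (.scalar 13))).headD false =
        decide (i < j) := by
      rw [Store.loc_scalar, Store.bits_tick, Store.bits_tick, h.flag, headD_replicate,
        decide_eq_decide]
      split <;> simp_all
    rw [Cmd.exec_ite, h12, Cmd.exec_ite, h13, keyAt]
    simp only [decide_eq_true_eq]
    rcases lt_trichotomy j i with hji | rfl | hji
    · rw [if_pos hji, if_neg hji.ne]
      refine Runs.lift_seq (R := fun t => t = (((s.tick 1).tick 1).setBits (12, 0)
        (((s.tick 1).tick 1).bits (12, 0)).tail).tick 1) (runs_pop _ _ rfl) ?_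
      rintro t rfl
      refine hown _ ?_ ?_ ?_ ?_ ?_
      · exact (Frame.setBits (Frame.tick (Frame.refl X s) 2) (by simp [hX]) 0 _).tick 1
      · simp
      · simp
      · simp only [Store.Unary, Store.bits_tick, Store.bits_setBits, if_true]
        rw [h.rem, List.tail_replicate]
        rfl
      · have := h.flag
        rw [if_neg (by omega)] at this
        rw [hn, if_neg (by omega)]
        simpa [Store.Unary] using this
    · rw [if_neg (lt_irrefl j), if_neg (lt_irrefl j), if_pos rfl]
      have h13' : s.bits (13, 0) = [] := by
        have := h.flag
        rwa [if_neg (lt_irrefl j)] at this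
      refine Runs.lift_seq (R := fun t => Frame X s t ∧ (∀ k, t.bits (14, k) = s.bits (14, k)) ∧
        t.bits (1, 0) = pk ∧ t.Unary 11 j ∧ t.Unary 12 (j - (j + 1)) ∧ t.Unary 13 n ∧
        t.time = s.time + 4) (runs_push _ _ _ ⟨?_, ?_, ?_, ?_, ?_, ?_, ?_⟩) ?_
      · exact (Frame.setBits (Frame.tick (Frame.refl X s) 3) (by simp [hX]) 0 _).tick 1
      · simp
      · simpa using h.pk
      · simpa [Store.Unary] using h.pos
      -- The countdown is at zero already, and truncated subtraction keeps it there.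
      · rw [show j - (j + 1) = j - j by omega]
        simpa [Store.Unary] using h.rem
      · rw [hn, if_pos (by omega)]
        simp [Store.Unary, h13']
      · simp
      rintro t ⟨hf, t14, t1, t11, t12, t13, ht⟩
      have hloc : t.loc (.cell 14 11) = (14, j) := by rw [Store.loc_cell, t11.length]
      refine Lift.pure ⟨⟨?_, ?_, hpk', ?_, ?_⟩, ?_, ?_⟩
      · simp [hloc, t1]
      · intro k hk
        simp [hloc, hk, t14]
      · rw [hloc]
        exact Frame.tick (Frame.setBits hf (by simp [hX]) j _) _
      · simp only [Store.loc_scalar, t1, Store.time_tick, Store.time_setBits]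
        omega
      · simpa [Store.Unary, hloc] using t12
      · simpa [Store.Unary, hloc] using t13
    · rw [if_neg hji.le.not_gt, if_pos hji, if_neg hji.ne']
      refine hown _ ?_ ?_ ?_ ?_ ?_
      · exact Frame.tick (Frame.refl X s) 3
      · simp
      · simp
      · have := h.rem
        rw [show i - (j + 1) = i - j by omega]
        exact this
      · have := h.flag
        rw [if_pos (by omega)] at this
        rw [hn, if_pos (by omega)]
        exact this
  · rintro t a ⟨⟨h1, h2, h3, h4, h5⟩, h12, h13⟩
    have t11 := h.pos.frame h4 (hnot 11 (by omega))
    have hloc : t.loc (.cell 14 11) = (14, j) := by rw [Store.loc_cell, t11.length]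
    have hloc' : t.loc (.cell (advName 2) 11) = (advName 2, j) := by
      rw [Store.loc_cell, t11.length]
    have hne : ∀ b < 20, ∀ k, ((b, k) : ℕ × ℕ) ≠ (advName 2, j) := by
      intro b hb k e
      exact advName_ne hb (Prod.mk.inj e).1.symm
    have hbits : ∀ b < 20, ∀ k, ((t.setBits (advName 2, j) a).tick (1 + a.length)).bits (b, k) =
        t.bits (b, k) := by
      intro b hb k
      simp [hne b hb k]
    refine Runs.seq (R := fun t' => t' = (t.setBits (advName 2, j) a).tick (1 + a.length))
      (runs_copy _ _ _ (by rw [hloc, hloc', h1])) ?_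
    rintro t' rfl
    set t' := (t.setBits (advName 2, j) a).tick (1 + a.length) with ht'
    have key : ∀ b < 20, b ≠ 11 → ∀ k, ((t'.setBits (11, 0) (true :: t'.bits (11, 0))).tick 1).bits
        (b, k) = t.bits (b, k) := by
      intro b hb h11 k
      simp [h11, hbits b hb k]
    refine runs_push _ _ _ ⟨?_, ?_, ?_, ?_, ?_, ?_, ?_, ?_, ?_, ?_, ?_, ?_⟩
    · exact (key 0 (by omega) (by omega) 0).trans (h.lam.frame h4 (hnot 0 (by omega)))
    · exact (key 1 (by omega) (by omega) 0).trans ((h4.bits (hnot 1 (by omega)) 0).trans h.pk)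
    · exact (key 8 (by omega) (by omega) 0).trans (h.idx.frame h4 (hnot 8 (by omega)))
    · rw [key 10 (by omega) (by omega) 0, h4.bits (hnot 10 (by omega)) 0, h.num]
    · refine Store.Unary.push ?_ 1
      exact (hbits 11 (by omega) 0).trans t11
    · exact (key 12 (by omega) (by omega) 0).trans h12
    · rw [← hn]
      exact (key 13 (by omega) (by omega) 0).trans h13
    · intro k hk
      rw [key 14 (by omega) (by omega) k]
      rcases Nat.lt_succ_iff_lt_or_eq.1 hk with hk | rfl
      · rw [h2 k hk.ne, h.keys k hk, List.getD_append _ _ _ _ (by rw [h.len]; exact hk)]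
      · rw [h1, List.getD_append_right _ _ _ _ h.len.le, h.len]
        simp
    · simp [h.len]
    · intro k hk
      rcases List.mem_append.1 hk with hk | hk
      · exact h.lens k hk
      · rw [List.mem_singleton.1 hk]
        exact h3
    · have hag := ((h.agree.frame h4 hadv).setBits advName_injective 2 j a).tick (1 + a.length)
      rw [Store.setBitsArray_append, h.len]
      refine Agree.frame (X := {11}) hag ?_ fun a => ?_
      · exact (Frame.setBits (Frame.refl _ _) (by simp) 0 _).tick 1
      · simpa using advName_ne (show 11 < 20 by omega)
    · have := h.time
      simp only [ht', Store.time_tick, Store.time_setBits, keyStepTime]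
      omega

end Reduction

end

section

open QM

namespace Reduction

variable {P : PKE} {A : MKCPAAdversary} (R : Reduction P A)

/-! #### Ciphertexts -/

/-- Write the message in array `a` whose index is in register `11` to register `16`. -/
def messageCmd (a : ℕ) : Cmd :=
  .seq (.wipe 15) (.seq (.wipe 16) (.seq (.copy (.cell a 11) (.scalar 6))
    (.seq (.loop (.scalar 0) (transferCmd 6 15)) (.loop (.scalar 0) (transferCmd 15 16)))))

/-- The experiment normalises messages to length `lam`, and the reduction must do so for those it
encrypts itself. The first transfer cuts or pads but reverses; the second restores the order. The
bound `20 ≤ a` keeps the source array apart from the scratch registers. -/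
theorem runs_messageCmd {s : Store} {lam a j : ℕ} (ha : 20 ≤ a) (h0 : s.Unary 0 lam)
    (h11 : s.Unary 11 j) :
    Runs (messageCmd a) s fun t => t.bits (16, 0) = toMessage lam (s.bits (a, j)) ∧
      Frame {6, 15, 16} s t ∧ t.time = s.time + (5 + (s.bits (a, j)).length + 8 * lam) := by
  refine Runs.seq (R := fun t => t.bits (15, 0) = [] ∧ Frame {6, 15, 16} s t ∧
    t.time = s.time + 1) (runs_wipe _ _ fun t e1 e2 e3 => ⟨(e1 0).1, e2.mono (by simp), e3⟩) ?_
  rintro t ⟨a15, afr, at'⟩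
  refine Runs.seq (R := fun t => t.bits (15, 0) = [] ∧ t.bits (16, 0) = [] ∧
    Frame {6, 15, 16} s t ∧ t.time = s.time + 2) (runs_wipe _ _ fun t' e1 e2 e3 =>
      ⟨(e2.bits (by simp) 0).trans a15, (e1 0).1, afr.trans e2 subset_rfl (by simp), by omega⟩) ?_
  rintro t ⟨b15, b16, bfr, bt⟩
  have hloc : t.loc (.cell a 11) = (a, j) := by
    rw [Store.loc_cell, (h11.frame bfr (by simp)).length]
  have ha' : t.bits (a, j) = s.bits (a, j) := bfr.bits (by simp; omega) j
  refine Runs.seq (R := fun t => t.bits (6, 0) = s.bits (a, j) ∧ t.bits (15, 0) = [] ∧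
    t.bits (16, 0) = [] ∧ Frame {6, 15, 16} s t ∧
    t.time = s.time + (3 + (s.bits (a, j)).length)) (runs_copy _ _ _ ⟨?_, ?_, ?_, ?_, ?_⟩) ?_
  · simp [hloc, ha']
  · simpa using b15
  · simpa using b16
  · exact (bfr.setBits (by simp) 0 _).tick _
  · rw [hloc, ha', Store.time_tick, Store.time_setBits]
    omega
  rintro t ⟨c6, c15, c16, cfr, ct⟩
  refine (runs_transferLoop (by decide) t).seq ?_
  rintro t' ⟨d15, dfr, dt⟩
  have hlen := (h0.frame cfr (by simp)).length
  rw [Store.loc_scalar, hlen] at d15 dt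
  have dfr' : Frame {6, 15, 16} s t' := cfr.trans dfr subset_rfl (by simp)
  have d16 := (dfr.bits (a := 16) (by simp) 0).trans c16
  refine (runs_transferLoop (by decide) t').mono ?_
  rintro u ⟨e16, efr, et⟩
  have hlen' := (h0.frame dfr' (by simp)).length
  rw [Store.loc_scalar, hlen'] at e16 et
  refine ⟨?_, dfr'.trans efr subset_rfl (by simp), by omega⟩
  rw [e16, d15, d16, c15, c6, List.append_nil, List.append_nil, takeD_reverse_takeD, toMessage]

/-- Prepare the input of the encryption algorithm: the key is the one in array `14` whose index is
in register `11`, and the message is in register `16`. -/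
def encInputCmd : Cmd :=
  .seq (wipeAllCmd R.names) (.seq (.copy (.scalar 0) (.scalar (encName 0)))
    (.seq (.copy (.cell 14 11) (.scalar (encName 1))) (.copy (.scalar 16) (.scalar (encName 2)))))

theorem runs_encInputCmd {s : Store} {lam j : ℕ} {pk m : List Bool} (h0 : s.Unary 0 lam)
    (h11 : s.Unary 11 j) (h14 : s.bits (14, j) = pk) (h16 : s.bits (16, 0) = m) :
    Runs R.encInputCmd s fun t => Agree encName R.names t (encInput lam pk m) ∧
      Frame (Set.range encName) s t ∧
      t.time = s.time + (R.names + 4 + lam + pk.length + m.length) := by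
  refine (runs_wipeAllCmd _ _).seq ?_
  rintro t ⟨a1, a2, a3⟩
  have t0 := h0.frame a2 (notMem_range_encName (by omega))
  refine Runs.seq (R := fun t' => Agree encName R.names t' (Store.init lam) ∧
    Frame (Set.range encName) s t' ∧ t'.time = s.time + (R.names + 2 + lam))
    (runs_copy _ _ _ ⟨?_, ?_, ?_⟩) ?_
  · rw [Store.loc_scalar, Store.loc_scalar, t0]
    exact (a1.setBits encName_injective 0 0 (List.replicate lam true)).tick _
  · exact (a2.setBits (by simp) 0 _).tick _
  · simp only [Store.time_tick, Store.time_setBits, Store.loc_scalar, t0.length]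
    omega
  rintro t ⟨b1, b2, b3⟩
  have hloc : t.loc (.cell 14 11) = (14, j) := by
    rw [Store.loc_cell, (h11.frame b2 (notMem_range_encName (by omega))).length]
  have t14 : t.bits (14, j) = pk := (b2.bits (notMem_range_encName (by omega)) j).trans h14
  refine Runs.seq (R := fun t' => Agree encName R.names t' ((Store.init lam).setBits (1, 0) pk) ∧
    Frame (Set.range encName) s t' ∧ t'.time = s.time + (R.names + 3 + lam + pk.length))
    (runs_copy _ _ _ ⟨?_, ?_, ?_⟩) ?_
  · rw [hloc, Store.loc_scalar, t14]
    exact (b1.setBits encName_injective 1 0 pk).tick _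
  · exact (b2.setBits (by simp) 0 _).tick _
  · simp only [Store.time_tick, Store.time_setBits, hloc, t14]
    omega
  rintro t ⟨c1, c2, c3⟩
  have t16 : t.bits (16, 0) = m := (c2.bits (notMem_range_encName (by omega)) 0).trans h16
  refine runs_copy _ _ _ ⟨?_, ?_, ?_⟩
  · rw [Store.loc_scalar, Store.loc_scalar, t16]
    exact (c1.setBits encName_injective 2 0 m).tick _
  · exact (c2.setBits (by simp) 0 _).tick _
  · simp only [Store.time_tick, Store.time_setBits, Store.loc_scalar, t16]
    omega

/-- Encrypt the message in array `a` and give the ciphertext to the adversary. -/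
def encCmd (a : ℕ) : Cmd :=
  .seq (messageCmd a) (.seq R.encInputCmd (.seq (P.enc.rename encName)
    (.qmove (.scalar (encName 0)) (.cell (advName 0) 11))))

/-- The ciphertext `ct` has been given to the adversary. -/
structure CtStored (X : Set ℕ) (j T L : ℕ) (s t : Store) (ct : List ℕ) : Prop where
  frame : Frame X (s.setQubits (advName 0, j) ct) t
  length : ct.length ≤ L
  time : t.time ≤ s.time + T

/-- The encryption runs on wiped registers with its honest input, and only its ciphertext is moved
on. Its discarded registers lie in the frame, matching the experiment, where other qubits of the
algorithm become inaccessible. -/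
theorem lift_encCmd {s : Store} {lam x a j : ℕ} {pk m : List Bool} (hx : lam ≤ x) (ha : 20 ≤ a)
    (h0 : s.Unary 0 lam) (h11 : s.Unary 11 j) (h14 : s.bits (14, j) = pk) (hm : s.bits (a, j) = m)
    (hpk : pk.length ≤ R.keyLen x) (hml : m.length ≤ R.regLen x) :
    Lift Eq (CtStored (Set.range encName ∪ {6, 15, 16}) j
      (R.names + R.regLen x + 10 * x + R.keyLen x + R.encEnd x + R.ctLen x + 10) (R.ctLen x) s)
      ((R.encCmd a).exec s) (P.runEnc lam pk (toMessage lam m)) := by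
  refine Runs.lift_seq (runs_messageCmd ha h0 h11) ?_
  rintro t ⟨a16, afr, at'⟩
  rw [hm] at a16 at'
  refine Runs.lift_seq (R.runs_encInputCmd (h0.frame afr (by simp)) (h11.frame afr (by simp))
    ((afr.bits (by simp) j).trans h14) a16) ?_
  rintro t' ⟨b1, bfr, bt⟩
  have hlen : (toMessage lam m).length = lam := by simp [toMessage]
  rw [hlen] at bt
  have hmono : R.encTime.eval (lam + pk.length + lam) ≤ R.encEnd x :=
    Polynomial.eval_mono_nat _ (by omega)
  have := (b1.lift_exec encName_injective R.uses_enc).and_mem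
    (p := fun u => u.time ≤ R.encEnd x ∧ u.LengthLE (lam + pk.length + lam + u.time))
    fun g o ho => ⟨(R.enc_halts lam pk _ g o ho).trans (by rwa [hlen]), Cmd.lengthLE ho fun r => by
        simp only [encInput, Store.init, Store.bits_setBits, Store.qubits_setBits, Store.blank]
        split
        · simp only [hlen, List.length_nil]
          omega
        · split
          · simp only [List.length_nil]
            omega
          · split <;> simp⟩
  have hfr : Frame (Set.range encName ∪ {6, 15, 16}) s t' := afr.trans bfr Set.subset_union_right Set.subset_union_left
  rw [PKE.runEnc, Cmd.exec_seq]
  refine this.bind ?_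
  rintro u v ⟨⟨f1, f2, f3⟩, f4, f5⟩
  have hu := (f1 0 (by have := R.lt_names; omega) 0).2
  have ufr : Frame (Set.range encName ∪ {6, 15, 16}) s u := hfr.trans f2 subset_rfl Set.subset_union_left
  have u11 := h11.frame ufr (by simp [notMem_range_encName (show 11 < 20 by omega)])
  have hloc : u.loc (.cell (advName 0) 11) = (advName 0, j) := by rw [Store.loc_cell, u11.length]
  have hL : (v.qubits (0, 0)).length ≤ R.ctLen x := by
    have := (f5 (0, 0)).2
    unfold ctLen
    omega
  have hin : (encInput lam pk (toMessage lam m)).time = 0 := rfl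
  refine Lift.pure ⟨?_, hL, ?_⟩
  · rw [hloc, Store.loc_scalar, hu]
    intro r hr
    have hr0 : r ≠ (encName 0, 0) := fun e => hr (by simp [e])
    simp only [Store.bits_tick, Store.bits_setQubits, Store.qubits_tick, Store.qubits_setQubits,
      hr0, if_false, (ufr r hr).1, (ufr r hr).2, and_self]
  · simp only [Store.time_tick, Store.time_setQubits, Store.loc_scalar, hu]
    omega

/-- One round of the generation of the ciphertexts. Register `17` holds the ciphertext of the
challenger; registers `11`, `12` and `13` are as in the generation of the keys. -/
def encStepCmd : Cmd :=
  .seq (.ite (.scalar 12) (.seq (.pop (.scalar 12)) (R.encCmd (advName 4)))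
    (.ite (.scalar 13) (R.encCmd (advName 3))
      (.seq (.push true (.scalar 13)) (.qmove (.scalar 17) (.cell (advName 0) 11)))))
    (.push true (.scalar 11))

/-- The state of the program after the first `j` rounds of the generation of the ciphertexts. -/
structure EncInv (lam i num L T : ℕ) (pks : List (List Bool)) (mem : Store) (ct : List ℕ) (j : ℕ)
    (s : Store) (cts : List (List ℕ)) : Prop where
  lam : s.Unary 0 lam
  pos : s.Unary 11 j
  rem : s.Unary 12 (i - j)
  flag : s.Unary 13 (if i < j then 1 else 0)
  challenge : j ≤ i → s.qubits (17, 0) = ct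
  keys : ∀ k < num, s.bits (14, k) = pks.getD k []
  len : cts.length = j
  lens : ∀ c ∈ cts, c.length ≤ L
  agree : Agree advName R.names s (mem.setQubitsArray 0 cts)
  time : s.time ≤ T

/-- The control flow of `keyStepCmd` again, with the second message before position `i` and the
first after it. The challenge can be moved only once, so the invariant promises it only up to round
`i`. -/
theorem lift_encStep {lam x i num T : ℕ} {pks : List (List Bool)} {mem : Store} {ct : List ℕ}
    {j : ℕ} {s : Store} {cts : List (List ℕ)} (hx : lam ≤ x) (hct : ct.length ≤ x)
    (hnum : pks.length = num) (hpks : ∀ k ∈ pks, k.length ≤ R.keyLen x)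
    (hmem : mem.LengthLE (R.regLen x)) (hj : j < num)
    (h : R.EncInv lam i num (R.ctLen x) T pks mem ct j s cts) :
    Lift Eq (fun t c => R.EncInv lam i num (R.ctLen x) (T + R.encStepTime x) pks mem ct (j + 1) t
      (cts ++ [c])) (R.encStepCmd.exec (s.tick 1)) (encAt P lam pks mem ct i j) := by
  set X : Set ℕ := Set.range encName ∪ {6, 12, 13, 15, 16, 17} with hX
  have hnot : ∀ a < 20, a ≠ 6 → a ≠ 12 → a ≠ 13 → a ≠ 15 → a ≠ 16 → a ≠ 17 → a ∉ X := by
    intro a ha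
    have := notMem_range_encName (a := a) (by omega)
    simp only [hX, Set.mem_union, this, Set.mem_insert_iff, Set.mem_singleton_iff, false_or]
    omega
  have hadv : ∀ a, advName a ∉ X := by
    intro a
    simp only [hX, Set.mem_union, advName_notMem_range, Set.mem_insert_iff,
      Set.mem_singleton_iff, advName_ne (show 6 < 20 by omega), advName_ne (show 12 < 20 by omega),
      advName_ne (show 13 < 20 by omega), advName_ne (show 15 < 20 by omega),
      advName_ne (show 16 < 20 by omega), advName_ne (show 17 < 20 by omega), or_self,
      not_false_eq_true]
  have hctx : x ≤ R.ctLen x := by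
    unfold ctLen
    omega
  have hkey : (pks.getD j []).length ≤ R.keyLen x := by
    rw [List.getD_eq_getElem _ _ (by omega)]
    exact hpks _ (List.getElem_mem _)
  obtain ⟨n, hn⟩ : ∃ n, n = if i < j + 1 then 1 else 0 := ⟨_, rfl⟩
  set Tr : ℕ := R.names + R.regLen x + 10 * x + R.keyLen x + R.encEnd x + R.ctLen x + 14 with hTr
  refine lift_seq_runs (R := fun t c => CtStored X j Tr (R.ctLen x) s t c ∧
    t.Unary 12 (i - (j + 1)) ∧ t.Unary 13 n ∧ (j < i → t.qubits (17, 0) = ct)) ?_ ?_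
  · have hown : ∀ (t : Store) (b : ℕ), b < R.names → Frame {12, 13} s t → t.time ≤ s.time + 4 →
        t.Unary 12 (i - (j + 1)) → t.Unary 13 n →
        Lift Eq (fun t c => CtStored X j Tr (R.ctLen x) s t c ∧
          t.Unary 12 (i - (j + 1)) ∧ t.Unary 13 n ∧ (j < i → t.qubits (17, 0) = ct))
          ((R.encCmd (advName b)).exec t)
          (P.runEnc lam (pks.getD j []) (toMessage lam (mem.bits (b, j)))) := by
      intro t b hb hf ht h12 h13
      have hm : t.bits (advName b, j) = mem.bits (b, j) := by
        rw [hf.bits (by simp [advName_ne (show 12 < 20 by omega),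
          advName_ne (show 13 < 20 by omega)]) j, (h.agree b hb j).1]
        rfl
      refine (R.lift_encCmd hx (by unfold advName; omega) (h.lam.frame hf (by simp))
        (h.pos.frame hf (by simp)) ((hf.bits (by simp) j).trans (h.keys j hj)) hm hkey
        (hmem _).1).mono ?_
      rintro u c ⟨e1, e2, e3⟩
      have hY : ∀ a < 20, a ≠ 6 → a ≠ 15 → a ≠ 16 → a ∉ Set.range encName ∪ {6, 15, 16} := by
        intro a ha
        have := notMem_range_encName (a := a) (by omega)
        simp only [Set.mem_union, this, Set.mem_insert_iff, Set.mem_singleton_iff, false_or]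
        omega
      refine ⟨⟨?_, e2, by omega⟩, ?_, ?_, ?_⟩
      · intro r hr
        have h1 := e1 r (by
          simp only [hX, Set.mem_union, Set.mem_insert_iff, Set.mem_singleton_iff] at hr ⊢
          tauto)
        have h2 := hf r (by
          simp only [hX, Set.mem_union, Set.mem_insert_iff, Set.mem_singleton_iff] at hr ⊢
          tauto)
        simp only [Store.bits_setQubits, Store.qubits_setQubits] at h1 ⊢
        exact ⟨h1.1.trans h2.1, by rw [h1.2, h2.2]⟩
      · exact (show (t.setQubits (advName 0, j) c).Unary 12 _ from h12).frame e1
          (hY 12 (by omega) (by omega) (by omega) (by omega))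
      · exact (show (t.setQubits (advName 0, j) c).Unary 13 _ from h13).frame e1
          (hY 13 (by omega) (by omega) (by omega) (by omega))
      -- Before position `i` the challenge must survive the reduction's own encryption, whose
      -- registers do not include `17`.
      · intro hji
        rw [e1.qubits (hY 17 (by omega) (by omega) (by omega) (by omega)) 0,
          Store.qubits_setQubits, if_neg, hf.qubits (by simp) 0, h.challenge hji.le]
        intro e
        exact advName_ne (show 17 < 20 by omega) (Prod.mk.inj e).1.symm
    have h12 : ((s.tick 1).bits ((s.tick 1).loc (.scalar 12))).headD false = decide (j < i) := by
      rw [Store.loc_scalar, Store.bits_tick, h.rem, headD_replicate, decide_eq_decide]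
      omega
    have h13 : (((s.tick 1).tick 1).bits (((s.tick 1).tick 1).loc (.scalar 13))).headD false =
        decide (i < j) := by
      rw [Store.loc_scalar, Store.bits_tick, Store.bits_tick, h.flag, headD_replicate,
        decide_eq_decide]
      split <;> simp_all
    have hnames := R.lt_names
    rw [Cmd.exec_ite, h12, Cmd.exec_ite, h13, encAt]
    simp only [decide_eq_true_eq]
    rcases lt_trichotomy j i with hji | rfl | hji
    · rw [if_pos hji, if_pos hji]
      refine Runs.lift_seq (R := fun t => t = (((s.tick 1).tick 1).setBits (12, 0)
        (((s.tick 1).tick 1).bits (12, 0)).tail).tick 1) (runs_pop _ _ rfl) ?_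
      rintro t rfl
      refine hown _ 4 (by omega) ?_ ?_ ?_ ?_
      · exact (Frame.setBits (Frame.tick (Frame.refl _ s) 2) (by simp) 0 _).tick 1
      · simp
      · simp only [Store.Unary, Store.bits_tick, Store.bits_setBits, if_true]
        rw [h.rem, List.tail_replicate]
        rfl
      · have := h.flag
        rw [if_neg (by omega)] at this
        rw [hn, if_neg (by omega)]
        simpa [Store.Unary] using this
    · rw [if_neg (lt_irrefl j), if_neg (lt_irrefl j), if_neg (lt_irrefl j), if_pos rfl]
      have h13' : s.bits (13, 0) = [] := by
        have := h.flag
        rwa [if_neg (lt_irrefl j)] at this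
      refine Runs.lift_seq (R := fun t => Frame X s t ∧ t.qubits (17, 0) = ct ∧ t.Unary 11 j ∧
        t.Unary 12 (j - (j + 1)) ∧ t.Unary 13 n ∧ t.time = s.time + 4)
        (runs_push _ _ _ ⟨?_, ?_, ?_, ?_, ?_, ?_⟩) ?_
      · exact (Frame.setBits (Frame.tick (Frame.refl X s) 3) (by simp [hX]) 0 _).tick 1
      · simpa using h.challenge le_rfl
      · simpa [Store.Unary] using h.pos
      · rw [show j - (j + 1) = j - j by omega]
        simpa [Store.Unary] using h.rem
      · rw [hn, if_pos (by omega)]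
        simp [Store.Unary, h13']
      · simp
      rintro t ⟨hf, t17, t11, t12, t13, ht⟩
      have hloc : t.loc (.cell (advName 0) 11) = (advName 0, j) := by
        rw [Store.loc_cell, t11.length]
      refine Lift.pure ⟨⟨?_, hct.trans hctx, ?_⟩, ?_, ?_, fun h => absurd h (lt_irrefl j)⟩
      · rw [hloc, Store.loc_scalar, t17]
        intro r hr
        have hr17 : r ≠ (17, 0) := fun e => hr (by simp [e, hX])
        simp only [Store.bits_tick, Store.bits_setQubits, Store.qubits_tick, Store.qubits_setQubits,
          hr17, if_false, (hf r hr).1, (hf r hr).2, and_self]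
      · simp only [Store.loc_scalar, t17, Store.time_tick, Store.time_setQubits]
        omega
      · exact t12
      · exact t13
    · rw [if_neg hji.le.not_gt, if_pos hji, if_neg hji.le.not_gt, if_neg hji.ne']
      refine hown _ 3 (by omega) ?_ ?_ ?_ ?_
      · exact Frame.tick (Frame.refl _ s) 3
      · simp
      · have := h.rem
        rw [show i - (j + 1) = i - j by omega]
        exact this
      · have := h.flag
        rw [if_pos (by omega)] at this
        rw [hn, if_pos (by omega)]
        exact this
  · rintro t c ⟨⟨h1, h2, h3⟩, h12, h13, h17⟩
    have hb : ∀ a < 20, a ≠ 6 → a ≠ 12 → a ≠ 13 → a ≠ 15 → a ≠ 16 → a ≠ 17 → ∀ k,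
        t.bits (a, k) = s.bits (a, k) := fun a ha a6 a12 a13 a15 a16 a17 k =>
      h1.bits (hnot a ha a6 a12 a13 a15 a16 a17) k
    have key : ∀ b, b ≠ 11 → ∀ k, ((t.setBits (11, 0) (true :: t.bits (11, 0))).tick 1).bits
        (b, k) = t.bits (b, k) := by
      intro b h11 k
      simp [h11]
    refine runs_push _ _ _ ⟨?_, ?_, ?_, ?_, ?_, ?_, ?_, ?_, ?_, ?_⟩
    · exact (key 0 (by omega) 0).trans ((hb 0 (by omega) (by omega) (by omega) (by omega) (by omega)
        (by omega) (by omega) 0).trans h.lam)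
    · refine Store.Unary.push ?_ 1
      exact (hb 11 (by omega) (by omega) (by omega) (by omega) (by omega)
        (by omega) (by omega) 0).trans h.pos
    · exact (key 12 (by omega) 0).trans h12
    · rw [← hn]
      exact (key 13 (by omega) 0).trans h13
    · intro hji
      exact h17 (by omega)
    · intro k hk
      rw [key 14 (by omega) k, hb 14 (by omega) (by omega) (by omega) (by omega) (by omega)
        (by omega) (by omega) k, h.keys k hk]
    · simp [h.len]
    · intro k hk
      rcases List.mem_append.1 hk with hk | hk
      · exact h.lens k hk
      · rw [List.mem_singleton.1 hk]
        exact h2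
    · rw [Store.setQubitsArray_append, h.len]
      have h0 : Agree advName R.names (s.setQubits (advName 0, j) c)
          ((mem.setQubitsArray 0 cts).setQubits (0, j) c) := h.agree.setQubits advName_injective 0 j c
      refine Agree.frame (X := {11}) (h0.frame h1 hadv) ?_ fun a => ?_
      · exact (Frame.setBits (Frame.refl _ _) (by simp) 0 _).tick 1
      · simpa using advName_ne (show 11 < 20 by omega)
    · have := h.time
      simp only [Store.time_tick, Store.time_setBits, encStepTime]
      omega

end Reduction

end

section

open QM

theorem QM.length_sum_le {α : Type} {l : List (List α)} {n L : ℕ} (hn : l.length = n)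
    (h : ∀ k ∈ l, k.length ≤ L) : (l.map List.length).sum ≤ n * L := by
  have := List.sum_le_card_nsmul (l.map List.length) L (by simpa using h)
  simpa [hn] using this

/-- The keys are input that the adversary did not spend time on writing, so their lengths enter its
memory bound separately. -/
theorem Store.LengthLE.setBitsArray {s : Store} {n L : ℕ} (h : s.LengthLE n) (a : ℕ)
    {l : List (List Bool)} (hl : ∀ k ∈ l, k.length ≤ L) :
    (s.setBitsArray a l).LengthLE (n + l.length * L) := fun r => by
  refine ⟨?_, (h r).2.trans (by omega)⟩
  simp only [Store.setBitsArray]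
  split
  · rename_i hr
    rw [List.getD_eq_getElem _ _ hr.2]
    have h1 := hl _ (List.getElem_mem hr.2)
    have h2 : 1 * L ≤ l.length * L := Nat.mul_le_mul_right _ (by omega)
    omega
  · exact (h r).1.trans (by omega)

namespace Reduction

variable {P : PKE} {A : MKCPAAdversary} (R : Reduction P A)

theorem bound_mono {x y : ℕ} (h : x ≤ y) : R.bound x ≤ R.bound y := by
  unfold bound
  gcongr

/-! #### The first phase -/

/-- Choose the index of the key of the challenger, and start the adversary. -/
def startCmd : Cmd :=
  .seq (boundCmd R.coeff R.deg) (.seq sampleCmd (.copy (.scalar 0) (.scalar (advName 0))))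

theorem lift_startCmd {lam x : ℕ} {pk : List Bool} (hx : lam ≤ x) :
    Lift Eq (fun t (p : ℕ × ℕ) => t.Unary 8 p.2 ∧ p.2 ≤ 2 * R.bound x + 1 ∧
      Agree advName R.names t (Store.init lam) ∧
      Frame (Set.range advName ∪ {5, 6, 7, 8, 9}) ((Store.init lam).setBits (1, 0) pk) t ∧
      t.time ≤ R.startTime x)
      (R.startCmd.exec ((Store.init lam).setBits (1, 0) pk))
      (QM.iter (sampleRound (R.bound lam)) (R.bound lam) (1, 0)) := by
  set s := (Store.init lam).setBits (1, 0) pk with hs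
  have hb := R.bound_mono hx
  have s0 : s.Unary 0 lam := by simp [hs, Store.init, Store.Unary]
  have hblank : ∀ a, a ≠ 0 → a ≠ 1 → ∀ i, s.bits (a, i) = [] ∧ s.qubits (a, i) = [] := by
    intro a h0 h1 i
    simp [hs, Store.init, Store.blank, h0, h1]
  refine Runs.lift_seq (runs_boundCmd s0 R.coeff R.deg) ?_
  rintro t ⟨a1, a2, a3⟩
  refine lift_seq_runs (lift_sample a1 ?_ ?_) ?_
  · exact (a2.bits (by simp) 0).trans (hblank 7 (by omega) (by omega) 0).1
  · exact (a2.bits (by simp) 0).trans (hblank 8 (by omega) (by omega) 0).1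
  rintro u p ⟨-, -, b1, b2, b3, b4, b5⟩
  have hfr : Frame {5, 6, 7, 8, 9} s u :=
    a2.trans b4 (by simp [Set.insert_subset_iff]) (by simp)
  have u0 := s0.frame hfr (by simp)
  refine runs_copy _ _ _ ⟨?_, ?_, ?_, ?_, ?_⟩
  · have : (8, 0) ≠ (advName 0, 0) := fun e => advName_ne (show 8 < 20 by omega) (Prod.mk.inj e).1.symm
    simpa [Store.Unary, this] using b1
  · have : R.coeff * (lam + 1) ^ R.deg = R.bound lam := rfl
    omega
  -- Sampling has touched only registers `5` to `9`, so the simulated adversary finds empty memory;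
  -- the copy then supplies its `1^lam`.
  · have : Agree advName R.names u Store.blank := fun a _ i => by
      have hnot : advName a ∉ ({5, 6, 7, 8, 9} : Set ℕ) := by
        simp only [Set.mem_insert_iff, Set.mem_singleton_iff, advName]
        omega
      rw [hfr.bits hnot, hfr.qubits hnot]
      exact hblank _ (by unfold advName; omega) (by unfold advName; omega) i
    rw [Store.loc_scalar, Store.loc_scalar, u0]
    exact (this.setBits advName_injective 0 0 _).tick _
  · exact (Frame.setBits (hfr.mono Set.subset_union_right) (by simp) 0 _).tick _
  · have hs0 : s.time = 0 := rfl
    have h1 : R.coeff * (lam + 1) ^ R.deg = R.bound lam := rfl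
    rw [h1] at a3
    have h2 : R.deg * (2 + 3 * (R.bound lam + 1) * (lam + 1)) ≤
        R.deg * (2 + 3 * (R.bound x + 1) * (x + 1)) := by gcongr
    have h3 : R.bound lam * (18 * R.bound lam + 36) ≤ R.bound x * (18 * R.bound x + 36) := by
      gcongr
    simp only [Store.time_tick, Store.time_setBits, Store.loc_scalar, u0.length, startTime]
    omega

/-- Generate the keys. -/
def keysCmd : Cmd :=
  .seq (.copy (.scalar (advName 1)) (.scalar 10)) (.seq (.copy (.scalar 8) (.scalar 12))
    (.loop (.scalar 10) R.keyStepCmd))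

theorem lift_keysCmd {lam x i num : ℕ} {pk : List Bool} {s s₀ : Store} (hx : lam ≤ x)
    (hpk : pk.length ≤ x) (h0 : s.Unary 0 lam) (h1 : s.bits (1, 0) = pk) (h8 : s.Unary 8 i)
    (h11 : s.bits (11, 0) = []) (h13 : s.bits (13, 0) = []) (hs : Agree advName R.names s s₀)
    (hnum : (s₀.bits (1, 0)).length = num) (hnum' : num ≤ R.numKeys x)
    (hi : i ≤ 2 * R.bound x + 1) :
    Lift Eq (fun t keys => R.KeyInv lam i num (R.keyLen x) (s.time + R.keysTime x) pk s₀ num t keys)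
      (R.keysCmd.exec s) (QM.collect (keyAt P lam pk i) num) := by
  have hnames := R.lt_names
  have s1 : (s.bits (advName 1, 0)).length = num := by rw [(hs 1 (by omega) 0).1, hnum]
  refine Runs.lift_seq (R := fun t => Frame {10} s t ∧ (t.bits (10, 0)).length = num ∧
    t.time = s.time + (1 + num)) (runs_copy _ _ _ ⟨?_, ?_, ?_⟩) ?_
  · exact Frame.tick (Frame.setBits (Frame.refl _ s) (by simp) 0 _) _
  · simp [s1]
  · simp [s1]
  rintro t ⟨a1, a2, a3⟩
  have t8 := h8.frame a1 (by simp)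
  refine Runs.lift_seq (R := fun t => Frame {10, 12} s t ∧ (t.bits (10, 0)).length = num ∧
    t.Unary 12 i ∧ t.time = s.time + (1 + num) + (1 + i)) (runs_copy _ _ _ ⟨?_, ?_, ?_, ?_⟩) ?_
  · exact Frame.tick (Frame.setBits (a1.mono (by simp)) (by simp) 0 _) _
  · simpa using a2
  · simpa [Store.Unary] using t8
  · simp [a3, t8.length]
  rintro t ⟨b1, b2, b3, b4⟩
  rw [Cmd.exec_loop, Store.loc_scalar, b2]
  refine (Lift.iter_collect (R := fun j t keys => R.KeyInv lam i num (R.keyLen x)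
    (s.time + (1 + num) + (1 + i) + 1 + j * R.keyStepTime x) pk s₀ j t keys) num ?_ ?_).mono ?_
  · intro j _ a l h
    have := R.lift_keyStep hx hpk h
    simpa only [add_mul, one_mul, ← add_assoc] using this
  · refine ⟨h0.frame b1 (by simp), (b1.bits (by simp) 0).trans h1, h8.frame b1 (by simp), b2,
      (b1.bits (by simp) 0).trans h11, b3, (b1.bits (by simp) 0).trans h13, by simp, rfl, by simp,
      ?_, ?_⟩
    · rw [Store.setBitsArray_nil]
      refine (hs.frame b1 fun a => ?_).tick 1
      simp [advName_ne (show 10 < 20 by omega), advName_ne (show 12 < 20 by omega)]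
    · simp only [Store.time_tick]
      omega
  · intro u keys h
    refine { h with time := h.time.trans ?_ }
    have := Nat.mul_le_mul_right (R.keyStepTime x) hnum'
    unfold keysTime
    omega

/-- What the reduction has chosen in its first phase: the index of the key of the challenger, the
number of keys, the keys, and the memory of the adversary. -/
noncomputable def chosen (P : PKE) (A : MKCPAAdversary) (lam : ℕ) (pk : List Bool) (r : ℕ) :
    QM (ℕ × ℕ × List (List Bool) × Store) := do
  let p ← QM.iter (sampleRound r) r (1, 0)
  let s₀ ← A.count.exec (Store.init lam)
  let pks ← QM.collect (keyAt P lam pk p.2) (s₀.bits (1, 0)).length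
  let s₁ ← A.choose.exec (s₀.setBitsArray 2 pks)
  pure (p.2, (s₀.bits (1, 0)).length, pks, s₁)

/-- The program of the first phase. -/
def chooseCmd : Cmd :=
  .seq R.startCmd (.seq (A.count.rename advName) (.seq R.keysCmd (.seq (A.choose.rename advName)
    (.seq (.copy (.cell (advName 3) 8) (.scalar 2)) (.copy (.cell (advName 4) 8) (.scalar 3))))))

/-- The state of the program after the first phase. -/
structure ChosenRel (lam x : ℕ) (t : Store) (d : ℕ × ℕ × List (List Bool) × Store) : Prop where
  lam : t.Unary 0 lam
  idx : t.Unary 8 d.1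
  idx_le : d.1 ≤ 2 * R.bound x + 1
  num : (t.bits (10, 0)).length = d.2.1
  num_le : d.2.1 ≤ R.numKeys x
  len : d.2.2.1.length = d.2.1
  keys : ∀ k < d.2.1, t.bits (14, k) = d.2.2.1.getD k []
  lens : ∀ k ∈ d.2.2.1, k.length ≤ R.keyLen x
  agree : Agree advName R.names t d.2.2.2
  fst : t.bits (2, 0) = d.2.2.2.bits (3, d.1)
  snd : t.bits (3, 0) = d.2.2.2.bits (4, d.1)
  mem : d.2.2.2.LengthLE (R.regLen x)
  halts : ∀ cts : List (List ℕ), cts.length = d.2.1 →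
    A.guess.HaltsWithin (d.2.2.2.setQubitsArray 0 cts)
      (R.advTime.eval (x + R.keySum x + (cts.map List.length).sum))
  time : t.time ≤ R.chooseTime x

/-- The phases are simulated in sequence. At the end the message pair at position `i` is offered to
the challenger, even if `i` is not below the number of keys, since the challenge is then ignored. -/
theorem lift_chooseCmd {lam x : ℕ} {pk : List Bool} (hx : lam ≤ x) (hpk : pk.length ≤ x) :
    Lift Eq (R.ChosenRel lam x) (R.chooseCmd.exec ((Store.init lam).setBits (1, 0) pk))
      (chosen P A lam pk (R.bound lam)) := by
  have hnames := R.lt_names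
  set s := (Store.init lam).setBits (1, 0) pk with hs
  have s0 : s.Unary 0 lam := by simp [hs, Store.init, Store.Unary]
  have s1 : s.bits (1, 0) = pk := by simp [hs]
  have s11 : s.bits (11, 0) = [] := by simp [hs, Store.init, Store.blank]
  have s13 : s.bits (13, 0) = [] := by simp [hs, Store.init, Store.blank]
  refine lift_seq (R.lift_startCmd hx) ?_
  rintro t p ⟨a1, a2, a3, a4, a5⟩
  -- The time bounds for the later phases are conditional on the branch taken here, so they are
  -- carried along with it.
  have hcount := (a3.lift_exec advName_injective R.uses_count).and_mem (p := fun s₀ =>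
      (s₀.time ≤ R.advTime.eval lam ∧
        ∀ (pks : List (List Bool)) (g' : QState), pks.length = (s₀.bits (1, 0)).length →
          ∀ o' ∈ A.choose.exec (s₀.setBitsArray 2 pks) g',
          o'.1.time ≤ R.advTime.eval (lam + (pks.map List.length).sum) ∧
          ∀ cts : List (List ℕ), cts.length = (s₀.bits (1, 0)).length →
            A.guess.HaltsWithin (o'.1.setQubitsArray 0 cts)
              (R.advTime.eval (lam + (pks.map List.length).sum + (cts.map List.length).sum))) ∧
      s₀.LengthLE (lam + s₀.time)) fun g o ho => ⟨R.adv_halts lam g o ho, Cmd.lengthLE ho fun r => by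
        simp only [Store.init, Store.bits_setBits, Store.qubits_setBits, Store.blank]
        split <;> simp⟩
  refine lift_seq hcount ?_
  rintro u s₀ ⟨⟨b1, b2, b3⟩, ⟨b4, b5⟩, b6⟩
  have hadv := Polynomial.eval_mono_nat R.advTime hx
  have hfr : Frame (Set.range advName ∪ {5, 6, 7, 8, 9}) s u :=
    a4.trans b2 subset_rfl Set.subset_union_left
  have hX : ∀ a < 20, a < 5 ∨ 9 < a → a ∉ Set.range advName ∪ {5, 6, 7, 8, 9} := by
    intro a ha ha'
    simp only [Set.mem_union, notMem_range_advName ha, Set.mem_insert_iff, Set.mem_singleton_iff,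
      false_or]
    omega
  have hnum : (s₀.bits (1, 0)).length ≤ R.numKeys x := by
    have := (b6 (1, 0)).1
    unfold numKeys
    omega
  refine lift_seq (R.lift_keysCmd hx hpk (s0.frame hfr (hX 0 (by omega) (by omega)))
    ((hfr.bits (hX 1 (by omega) (by omega)) 0).trans s1)
    (a1.frame b2 (notMem_range_advName (by omega)))
    ((hfr.bits (hX 11 (by omega) (by omega)) 0).trans s11)
    ((hfr.bits (hX 13 (by omega) (by omega)) 0).trans s13) b1 rfl hnum a2) ?_
  intro v pks hk
  set num := (s₀.bits (1, 0)).length with hnum_def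
  have hsum : (pks.map List.length).sum ≤ R.keySum x :=
    (length_sum_le hk.len hk.lens).trans (Nat.mul_le_mul_right _ hnum)
  have hpks : pks.length * R.keyLen x ≤ R.keySum x := by
    rw [hk.len]
    exact Nat.mul_le_mul_right _ hnum
  have hchoose := (hk.agree.lift_exec advName_injective R.uses_choose).and_mem (p := fun s₁ =>
      (s₁.time ≤ R.advEnd x ∧ ∀ cts : List (List ℕ), cts.length = num →
        A.guess.HaltsWithin (s₁.setQubitsArray 0 cts)
          (R.advTime.eval (x + R.keySum x + (cts.map List.length).sum))) ∧
      s₁.LengthLE (R.regLen x)) fun g o ho => by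
    have h1 := b5 pks g hk.len o ho
    have h2 : o.1.time ≤ R.advEnd x :=
      h1.1.trans (Polynomial.eval_mono_nat _ (by omega))
    refine ⟨⟨h2, fun cts hcts g' o' ho' => (h1.2 cts hcts g' o' ho').trans
      (Polynomial.eval_mono_nat _ (by omega))⟩, ?_⟩
    refine (Cmd.lengthLE ho (b6.setBitsArray 2 hk.lens)).mono ?_
    unfold regLen numKeys
    omega
  refine Lift.bind_pure_right (φ := fun s₁ => (p.2, num, pks, s₁)) (m' :=
    A.choose.exec (s₀.setBitsArray 2 pks)) (lift_seq_runs hchoose ?_) fun _ _ h => h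
  rintro w mem ⟨⟨c1, c2, c3⟩, ⟨c4, c5⟩, c6⟩
  have hw : ∀ a < 20, ∀ k, w.bits (a, k) = v.bits (a, k) := fun a ha k =>
    c2.bits (notMem_range_advName ha) k
  have hloc : ∀ b, ∀ w' : Store, w'.bits (8, 0) = w.bits (8, 0) →
      w'.loc (.cell (advName b) 8) = (advName b, p.2) := by
    intro b w' hw'
    rw [Store.loc_cell, hw', hw 8 (by omega), hk.idx.length]
  have m3 := (c1 3 (by omega) p.2).1
  have m4 := (c1 4 (by omega) p.2).1
  have l3 := (c6 (3, p.2)).1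
  have l4 := (c6 (4, p.2)).1
  refine Runs.seq (R := fun w' => w' = (w.setBits (2, 0) (mem.bits (3, p.2))).tick
    (1 + (mem.bits (3, p.2)).length)) (runs_copy _ _ _ (by
      rw [hloc 3 w rfl, m3, Store.loc_scalar])) ?_
  rintro w' rfl
  -- The first copied message does not overwrite the source of the second.
  have hne : (advName 4, p.2) ≠ (2, 0) := fun e =>
    advName_ne (show 2 < 20 by omega) (Prod.mk.inj e).1
  refine runs_copy _ _ _ ?_
  rw [hloc 4 _ (by simp), Store.loc_scalar, Store.bits_tick, Store.bits_setBits, if_neg hne, m4]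
  have hbits : ∀ a < 20, a ≠ 2 → a ≠ 3 → ∀ k, ((((w.setBits (2, 0) (mem.bits (3, p.2))).tick
      (1 + (mem.bits (3, p.2)).length)).setBits (3, 0) (mem.bits (4, p.2))).tick
      (1 + (mem.bits (4, p.2)).length)).bits (a, k) = v.bits (a, k) := by
    intro a ha h2 h3 k
    simp [h2, h3, hw a ha]
  constructor
  · exact (hbits 0 (by omega) (by omega) (by omega) 0).trans hk.lam
  · exact (hbits 8 (by omega) (by omega) (by omega) 0).trans hk.idx
  · exact a2
  · rw [hbits 10 (by omega) (by omega) (by omega) 0]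
    exact hk.num
  · exact hnum
  · exact hk.len
  · intro k hk'
    rw [hbits 14 (by omega) (by omega) (by omega) k]
    exact hk.keys k hk'
  · exact hk.lens
  · refine Agree.frame (X := {2, 3}) c1 ?_ fun a => ?_
    · exact Frame.tick (Frame.setBits (Frame.tick (Frame.setBits (Frame.refl _ w) (by simp) 0 _) _)
        (by simp) 0 _) _
    · simp [advName_ne (show 2 < 20 by omega), advName_ne (show 3 < 20 by omega)]
  · simp
  · simp
  · exact c6
  · exact c5
  · have h0 : (Store.init lam).time = 0 := rfl
    have hv := hk.time
    have hmono : R.advTime.eval x ≤ R.advEnd x := Polynomial.eval_mono_nat _ (by omega)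
    have hm : (s₀.setBitsArray 2 pks).time = s₀.time := rfl
    simp only [Store.time_tick, Store.time_setBits, chooseTime]
    omega

/-! #### The second phase -/

/-- The program of the second phase. -/
def guessCmd : Cmd :=
  .seq (.qmove (.scalar 0) (.scalar 17)) (.seq (.wipe 11) (.seq (.wipe 13)
    (.seq (.copy (.scalar 8) (.scalar 12)) (.seq (.loop (.scalar 10) R.encStepCmd)
      (.seq (A.guess.rename advName)
        (.ite (.scalar (advName 5)) (.push true (.scalar 4)) (.push false (.scalar 4))))))))

/-- The counters left over from key generation are reset and the same pass over the positions is
made with ciphertexts; then the adversary resumes on the memory it had kept. -/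
theorem lift_guessCmd {lam x : ℕ} {t : Store} {d : ℕ × ℕ × List (List Bool) × Store}
    (hx : lam ≤ x) (h : R.ChosenRel lam x t d) {ct : List ℕ} (hct : ct.length ≤ x) :
    Lift Eq (fun u c => u.topBit 4 = c ∧ u.time ≤ R.guessTime x)
      (R.guessCmd.exec (t.setQubits (0, 0) ct))
      (QM.collect (encAt P lam d.2.2.1 d.2.2.2 ct d.1) d.2.1 >>= fun cts =>
        A.finish d.2.2.2 cts) := by
  obtain ⟨i, num, pks, mem⟩ := d
  have hnames := R.lt_names
  refine Runs.lift_seq (R := fun u => Frame {0, 17} t u ∧ u.Unary 0 lam ∧ u.qubits (17, 0) = ct ∧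
    u.time = t.time + (1 + ct.length)) (runs_qmove _ _ _ ⟨?_, ?_, ?_, ?_⟩) ?_
  · exact Frame.tick (Frame.setQubits (Frame.setQubits (Frame.setQubits (Frame.refl _ t) (by simp)
      0 _) (by simp) 0 _) (by simp) 0 _) _
  · exact h.lam
  · simp
  · simp
  rintro u ⟨a1, a2, a3, a4⟩
  refine Runs.lift_seq (R := fun v => Frame {0, 11, 17} t v ∧ v.Unary 0 lam ∧
    v.qubits (17, 0) = ct ∧ v.bits (11, 0) = [] ∧ v.time = t.time + (2 + ct.length))
    (runs_wipe _ _ fun v e1 e2 e3 => ⟨a1.trans e2 (by simp [Set.insert_subset_iff]) (by simp),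
      a2.frame e2 (by simp), (e2.qubits (by simp) 0).trans a3, (e1 0).1, by omega⟩) ?_
  rintro u ⟨b1, b2, b3, b4, b5⟩
  refine Runs.lift_seq (R := fun v => Frame {0, 11, 13, 17} t v ∧ v.Unary 0 lam ∧
    v.qubits (17, 0) = ct ∧ v.bits (11, 0) = [] ∧ v.bits (13, 0) = [] ∧
    v.time = t.time + (3 + ct.length))
    (runs_wipe _ _ fun v e1 e2 e3 => ⟨b1.trans e2 (by simp [Set.insert_subset_iff]) (by simp),
      b2.frame e2 (by simp), (e2.qubits (by simp) 0).trans b3, (e2.bits (by simp) 0).trans b4,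
      (e1 0).1, by omega⟩) ?_
  rintro u ⟨c1, c2, c3, c4, c5, c6⟩
  have u8 := h.idx.frame c1 (by simp)
  refine Runs.lift_seq (R := fun v => Frame {0, 11, 12, 13, 17} t v ∧ v.Unary 0 lam ∧
    v.qubits (17, 0) = ct ∧ v.bits (11, 0) = [] ∧ v.bits (13, 0) = [] ∧ v.Unary 12 i ∧
    v.time = t.time + (4 + ct.length + i)) (runs_copy _ _ _ ⟨?_, ?_, ?_, ?_, ?_, ?_, ?_⟩) ?_
  · exact Frame.tick (Frame.setBits (c1.mono (by simp [Set.insert_subset_iff])) (by simp) 0 _) _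
  · simpa [Store.Unary] using c2
  · simpa using c3
  · simpa using c4
  · simpa using c5
  · simpa [Store.Unary] using u8
  · simp only [Store.time_tick, Store.time_setBits, Store.loc_scalar, u8.length]
    omega
  rintro u ⟨d1, d2, d3, d4, d5, d6, d7⟩
  have hadv : ∀ a, advName a ∉ ({0, 11, 12, 13, 17} : Set ℕ) := by
    intro a
    simp only [Set.mem_insert_iff, Set.mem_singleton_iff, advName]
    omega
  refine lift_seq (R := fun v cts => R.EncInv lam i num (R.ctLen x)
    (t.time + (5 + ct.length + i) + num * R.encStepTime x) pks mem ct num v cts) ?_ ?_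
  · have hu : (u.bits (10, 0)).length = num := by
      rw [d1.bits (by simp) 0]
      exact h.num
    rw [Cmd.exec_loop, Store.loc_scalar, hu]
    refine Lift.iter_collect (R := fun j v cts => R.EncInv lam i num (R.ctLen x)
      (t.time + (5 + ct.length + i) + j * R.encStepTime x) pks mem ct j v cts) num ?_ ?_
    · intro j hj a l hinv
      have := R.lift_encStep hx hct h.len h.lens h.mem hj hinv
      simpa only [add_mul, one_mul, ← add_assoc] using this
    · refine ⟨d2, d4, d6, d5, fun _ => d3, ?_, rfl, by simp, ?_, ?_⟩
      · intro k hk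
        exact (d1.bits (by simp) k).trans (h.keys k hk)
      · rw [Store.setQubitsArray_nil]
        exact (h.agree.frame d1 hadv).tick 1
      · simp only [Store.time_tick]
        omega
  intro v cts hv
  have hsum : (cts.map List.length).sum ≤ R.ctSum x :=
    (length_sum_le hv.len hv.lens).trans (Nat.mul_le_mul_right _ h.num_le)
  have hguess := (hv.agree.lift_exec advName_injective R.uses_guess).and_mem (p := fun s₂ =>
      s₂.time ≤ R.guessEnd x) fun g o ho => (h.halts cts hv.len g o ho).trans
        (Polynomial.eval_mono_nat _ (by omega))
  refine Lift.bind_pure_right (φ := fun s₂ => s₂.topBit 5) (m' :=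
    A.guess.exec (mem.setQubitsArray 0 cts)) (lift_seq_runs hguess ?_) fun _ _ h => h
  rintro w s₂ ⟨⟨e1, e2, e3⟩, e4⟩
  have htop : (w.bits (advName 5, 0)).headD false = s₂.topBit 5 := by
    rw [(e1 5 (by omega) 0).1, Store.topBit]
  have htime : w.time + 2 ≤ R.guessTime x := by
    have h1 := hv.time
    have h2 : t.time ≤ R.chooseTime x := h.time
    have h3 : num * R.encStepTime x ≤ R.numKeys x * R.encStepTime x :=
      Nat.mul_le_mul_right _ h.num_le
    have h4 : i ≤ 2 * R.bound x + 1 := h.idx_le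
    unfold guessTime
    omega
  refine runs_ite (fun hb => runs_push _ _ _ ⟨?_, htime⟩) (fun hb => runs_push _ _ _ ⟨?_, htime⟩)
  · rw [← htop]
    simpa [Store.topBit] using hb.symm
  · rw [← htop]
    simpa [Store.topBit] using hb.symm

end Reduction

end

section

open QM

/-- Branches are paired by their position in the lists, so the pairing is the same for all indices
and the relations may be intersected. -/
theorem QM.Lift.forall {ι α β : Type} [Nonempty ι] {Q : QState → QState → Prop}
    {R : ι → α → β → Prop} {m : QM α} {m' : QM β} (h : ∀ i, Lift Q (R i) m m') :
    Lift Q (fun a b => ∀ i, R i a b) m m' := by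
  intro g g' hg
  have h' := fun i => List.forall₂_iff_get.1 (h i g g' hg)
  have i₀ : ι := Classical.arbitrary ι
  exact List.forall₂_iff_get.2 ⟨(h' i₀).1, fun k hk hk' =>
    ⟨fun i => ((h' i).2 k hk hk').1, ((h' i₀).2 k hk hk').2⟩⟩

theorem QM.Lift.refl {α : Type} (m : QM α) : Lift Eq Eq m m := by
  rintro g _ rfl
  rw [List.forall₂_same]
  exact fun o _ => ⟨rfl, rfl⟩

theorem QM.Lift.eq {α : Type} {m m' : QM α} (h : Lift Eq Eq m m') : m = m' := by
  funext g
  rw [← List.forall₂_eq_eq_eq]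
  exact (h g g rfl).imp fun _ _ ho => Prod.ext ho.1 ho.2

/-! ### Polynomial functions -/

/-- The function is given by a polynomial. -/
def PolyFun (f : ℕ → ℕ) : Prop := ∃ p : Polynomial ℕ, ∀ x, f x = p.eval x

namespace PolyFun

variable {f g : ℕ → ℕ}

theorem const (c : ℕ) : PolyFun fun _ => c := ⟨Polynomial.C c, fun x => by simp⟩

theorem id : PolyFun fun x => x := ⟨Polynomial.X, fun x => by simp⟩

theorem add (hf : PolyFun f) (hg : PolyFun g) : PolyFun fun x => f x + g x :=
  let ⟨p, hp⟩ := hf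
  let ⟨q, hq⟩ := hg
  ⟨p + q, fun x => by simp only [hp, hq, Polynomial.eval_add]⟩

theorem mul (hf : PolyFun f) (hg : PolyFun g) : PolyFun fun x => f x * g x :=
  let ⟨p, hp⟩ := hf
  let ⟨q, hq⟩ := hg
  ⟨p * q, fun x => by simp only [hp, hq, Polynomial.eval_mul]⟩

theorem pow (hf : PolyFun f) (d : ℕ) : PolyFun fun x => f x ^ d :=
  let ⟨p, hp⟩ := hf
  ⟨p ^ d, fun x => by simp only [hp, Polynomial.eval_pow]⟩

theorem eval (p : Polynomial ℕ) (hf : PolyFun f) : PolyFun fun x => p.eval (f x) :=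
  let ⟨q, hq⟩ := hf
  ⟨p.comp q, fun x => by simp only [hq, Polynomial.eval_comp]⟩

end PolyFun

namespace Reduction

/-! ### Polynomial running time and correctness of the reduction -/

variable {P : PKE} {A : MKCPAAdversary} (R : Reduction P A)

theorem polyFun_bound : PolyFun R.bound := (PolyFun.const _).mul ((PolyFun.id.add (.const 1)).pow _)

theorem polyFun_keyLen : PolyFun R.keyLen := (PolyFun.id.add (.eval _ .id)).add .id

theorem polyFun_numKeys : PolyFun R.numKeys := PolyFun.id.add (.eval _ .id)

theorem polyFun_keySum : PolyFun R.keySum := R.polyFun_numKeys.mul R.polyFun_keyLen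

theorem polyFun_advEnd : PolyFun R.advEnd := .eval _ (PolyFun.id.add R.polyFun_keySum)

theorem polyFun_regLen : PolyFun R.regLen :=
  (R.polyFun_numKeys.add R.polyFun_keySum).add R.polyFun_advEnd

theorem polyFun_encEnd : PolyFun R.encEnd := .eval _ ((PolyFun.id.add R.polyFun_keyLen).add .id)

theorem polyFun_ctLen : PolyFun R.ctLen :=
  (((PolyFun.id.add R.polyFun_keyLen).add .id).add R.polyFun_encEnd).add .id

theorem polyFun_ctSum : PolyFun R.ctSum := R.polyFun_numKeys.mul R.polyFun_ctLen

theorem polyFun_guessEnd : PolyFun R.guessEnd :=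
  .eval _ ((PolyFun.id.add R.polyFun_keySum).add R.polyFun_ctSum)

theorem polyFun_keyStepTime : PolyFun R.keyStepTime :=
  ((((PolyFun.const _).add .id).add (.eval _ .id)).add ((PolyFun.const 2).mul R.polyFun_keyLen)).add
    (.const 12)

theorem polyFun_encStepTime : PolyFun R.encStepTime :=
  ((((((PolyFun.const _).add R.polyFun_regLen).add ((PolyFun.const 10).mul .id)).add
    R.polyFun_keyLen).add R.polyFun_encEnd).add R.polyFun_ctLen).add (.const 16)

theorem polyFun_startTime : PolyFun R.startTime :=
  ((((PolyFun.const 1).add (.const _)).add ((PolyFun.const _).mul ((PolyFun.const 2).add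
    (((PolyFun.const 3).mul (R.polyFun_bound.add (.const 1))).mul (PolyFun.id.add (.const 1)))))).add
    ((R.polyFun_bound.mul (((PolyFun.const 18).mul R.polyFun_bound).add (.const 36))).add
      (.const 2))).add ((PolyFun.const 1).add .id)

theorem polyFun_keysTime : PolyFun R.keysTime :=
  ((((PolyFun.const 1).add R.polyFun_numKeys).add (((PolyFun.const 2).mul R.polyFun_bound).add
    (.const 2))).add (.const 1)).add (R.polyFun_numKeys.mul R.polyFun_keyStepTime)

theorem polyFun_chooseTime : PolyFun R.chooseTime :=
  (((R.polyFun_startTime.add R.polyFun_advEnd).add R.polyFun_keysTime).add R.polyFun_advEnd).add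
    ((PolyFun.const 2).mul ((PolyFun.const 1).add R.polyFun_regLen))

theorem polyFun_guessTime : PolyFun R.guessTime :=
  ((((((R.polyFun_chooseTime.add ((PolyFun.const 1).add .id)).add (.const 2)).add
    (((PolyFun.const 2).mul R.polyFun_bound).add (.const 2))).add (.const 1)).add
    (R.polyFun_numKeys.mul R.polyFun_encStepTime)).add R.polyFun_guessEnd).add (.const 2)

/-- The adversary in the single-key experiment. -/
def adversary : CPAAdversary where
  choose := R.chooseCmd
  guess := R.guessCmd
  polyTime := by
    obtain ⟨p, hp⟩ := R.polyFun_chooseTime.add R.polyFun_guessTime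
    refine ⟨p, fun lam pk g o ho => ⟨?_, fun ct g' o' ho' => ?_⟩⟩
    · obtain ⟨d, -, hd⟩ := (R.lift_chooseCmd (x := lam + pk.length) (by omega)
        (by omega)).exists_of_mem rfl ho
      have := hd.time
      have := hp (lam + pk.length)
      simp only at this
      omega
    -- The first phase is analysed again with a larger `x` that also bounds the ciphertext; the
    -- simulation holds for every admissible `x`.
    · obtain ⟨d, -, hd⟩ := (R.lift_chooseCmd (x := lam + pk.length + ct.length) (by omega)
        (by omega)).exists_of_mem rfl ho
      obtain ⟨c, -, -, hc⟩ := (R.lift_guessCmd (by omega) hd (ct := ct)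
        (by omega)).exists_of_mem rfl ho'
      have := hp (lam + pk.length + ct.length)
      simp only at this
      omega

/-- The branches on both sides have equal results and equal quantum states, in the same order, so
this is an equality of processes. The stores of the reduction disappear with the final comparison of
bits. -/
theorem cpaExperiment_adversary (lam : ℕ) :
    cpaExperiment P R.adversary lam = reduced P A lam (R.bound lam) := by
  have h : reduced P A lam (R.bound lam) = (do
      let key ← P.runKeyGen lam
      let d ← chosen P A lam key.2 (R.bound lam)
      let b ← QM.coin
      let ct ← P.runEnc lam key.2 (toMessage lam
        (if b then d.2.2.2.bits (4, d.1) else d.2.2.2.bits (3, d.1)))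
      let c ← QM.collect (encAt P lam d.2.2.1 d.2.2.2 ct d.1) d.2.1 >>= fun cts =>
        A.finish d.2.2.2 cts
      pure (c == b)) := by
    simp only [reduced, embedded, chosen, bind_assoc, pure_bind]
  rw [h]
  refine Lift.eq ((Lift.refl _).bind ?_)
  rintro key _ rfl
  have : Nonempty {x : ℕ // lam ≤ x ∧ key.2.length ≤ x} :=
    ⟨⟨lam + key.2.length, by omega, by omega⟩⟩
  -- The length of the ciphertext is not known yet, so the relation is kept for all `x` and
  -- specialised after the encryption.
  refine (Lift.forall fun x : {x : ℕ // lam ≤ x ∧ key.2.length ≤ x} =>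
    R.lift_chooseCmd x.2.1 x.2.2).bind ?_
  intro t d htd
  refine (Lift.refl _).bind ?_
  rintro b _ rfl
  have hmsg : (if b then t.bits (3, 0) else t.bits (2, 0)) =
      if b then d.2.2.2.bits (4, d.1) else d.2.2.2.bits (3, d.1) := by
    have h0 := htd ⟨lam + key.2.length, by omega, by omega⟩
    rw [h0.fst, h0.snd]
  rw [hmsg]
  refine (Lift.refl _).bind ?_
  rintro ct _ rfl
  refine (R.lift_guessCmd (x := lam + key.2.length + ct.length) (by omega)
    (htd ⟨_, by omega, by omega⟩) (by omega)).bind fun u c huc => Lift.pure ?_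
  rw [huc.1]

theorem length_count_le (lam : ℕ) (g : QState) : ∀ o ∈ A.count.exec (Store.init lam) g,
    (o.1.bits (1, 0)).length ≤ R.bound lam := by
  intro o ho
  have h1 : o.1.LengthLE (lam + o.1.time) := Cmd.lengthLE ho fun r => by
    simp only [Store.init, Store.bits_setBits, Store.qubits_setBits, Store.blank]
    split <;> simp
  have h2 := (h1 (1, 0)).1
  have h3 := (R.adv_halts lam g o ho).1
  have h4 := R.le_bound lam
  unfold bound
  omega

/-- The size of the sampling range is at most `2 * R.bound lam + 1`, a polynomial, and
superpolynomial decay absorbs polynomial factors. -/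
theorem negligible_mul {ν : ℕ → ℝ} (hν : Negligible ν) :
    Negligible fun lam => (sampleSize (R.bound lam) (R.bound lam) : ℝ) * ν lam := by
  obtain ⟨p, hp⟩ := ((PolyFun.const 2).mul R.polyFun_bound).add (.const 1)
  refine (hν.polynomial_mul (p.map (Nat.castRingHom ℝ))).trans_abs_le fun lam => ?_
  have h1 : (p.map (Nat.castRingHom ℝ)).eval (lam : ℝ) = ((p.eval lam : ℕ) : ℝ) := by
    simp
  rw [h1, ← hp, abs_mul, abs_mul, Nat.abs_cast, Nat.abs_cast]
  gcongr
  exact sampleSize_le _ _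

end Reduction

end

theorem mainTheorem9 (P : PKE) (hP : P.CPASecure) : P.MKCPASecure := by
  intro A
  obtain ⟨R⟩ := Reduction.exists P A
  obtain ⟨ν, hν, hle⟩ := hP R.adversary
  refine ⟨_, R.negligible_mul hν, fun lam => ?_⟩
  -- The many-key advantage is now the range size times the advantage of `R.adversary`, to which the
  -- single-key bound applies.
  rw [prob_reduced P A lam (R.length_count_le lam), ← R.cpaExperiment_adversary]
  have := hle lam
  gcongr
  linarith
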